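/- Let $\Omega=(a,b)$ be a finite interval with $a<b$; functions are complex-valued (real-valued ones included). For $\mu\ge 0$ and $v\in L^2(\mathbb R)$ put $|v|^2_{H^\mu(\mathbb R)}=\int_{\mathbb R}|\omega|^{2\mu}|\mathscr F[v](\omega)|^2\,d\omega$, where $\mathscr F[v](\omega)=\int_{\mathbb R}e^{-i\omega x}v(x)\,dx$ (extended to $L^2(\mathbb R)$ by Plancherel), and $H^\mu(\mathbb R)=\{v\in L^2(\mathbb R): |v|_{H^\mu(\mathbb R)}<\infty\}$. Let $H^\mu(\Omega)$ be the space of restrictions to $\Omega$ of functions in $H^\mu(\mathbb R)$, with $$|u|_{H^\mu(\Omega)}=\inf\{|\tilde u|_{H^\mu(\mathbb R)}:\tilde u\in H^\mu(\mathbb R),\ \tilde u|_\Omega=u\},\qquad \|u\|^2_{H^\mu(\Omega)}=\|u\|^2_{L^2(\Omega)}+|u|^2_{H^\mu(\Omega)},$$ and let $H^\mu_0(\Omega)$ be the closure of $C_0^\infty(\Omega)$ in $H^\mu(\Omega)$ with respect to $\|\cdot\|_{H^\mu(\Omega)}$. For $\lambda\ge0$, $n-1\le\mu<n$ ($n\in\mathbb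 N^+$) and $u\in C_0^\infty(\Omega)$, the left and right tempered derivatives of order $\mu$ are $${}_a\mathbb D_x^{\mu,\lambda}u(x)=\frac{e^{-\lambda x}}{\Gamma(n-\mu)}\frac{d^n}{dx^n}\int_a^x\frac{e^{\lambda\xi}u(\xi)}{(x-\xi)^{\mu-n+1}}\,d\xi,\qquad {}_x\mathbb D_b^{\mu,\lambda}u(x)=\frac{(-1)^n e^{\lambda x}}{\Gamma(n-\mu)}\frac{d^n}{dx^n}\int_x^b\frac{e^{-\lambda\xi}u(\xi)}{(\xi-x)^{\mu-n+1}}\,d\xi .$$ For $0<\mu\le 1$, $\mu\neq\frac12$, they extend by continuity to operators from $H_0^\mu(\Omega)$ to $L^2(\Omega)$, denoted by the same symbols. For nonnegative quantities $A(u),B(u)$ write $A\lesssim B$ on a set $X$ if there is a constant $C<\infty$, which may depend on $\Omega$, $\lambda$ and the orders $\mu,\mu_1$ but not on $u$, with $A(u)\le C\,B(u)$ for all $u\in X$; write $A\sim B$ if $A\lesssim B$ and $B\lesssim A$. Let $\mu\in(0,1]$, $\mu\ne\frac12$, and $\lambda\ge0$. Then, on $X=H_0^\mu(\Omega)$, $$|u|^2_{H^\mu(\Omega)}\sim\|u\|^2_{H^\mu(\Omega)}\sim\|{}_a\mathbb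 D_x^{\mu,\lambda}u\|^2_{L^2(\Omega)}\sim\|{}_x\mathbb D_b^{\mu,\lambda}u\|^2_{L^2(\Omega)},$$ and, if $0<\mu_1<\mu$ and $\mu_1\neq\frac12$, then $X\subseteq H_0^{\mu_1}(\Omega)$ and, on $X$, $$\|{}_a\mathbb D_x^{\mu_1,\lambda}u\|^2_{L^2(\Omega)}\lesssim\|{}_a\mathbb D_x^{\mu,\lambda}u\|^2_{L^2(\Omega)},\qquad \|{}_x\mathbb D_b^{\mu_1,\lambda}u\|^2_{L^2(\Omega)}\lesssim\|{}_x\mathbb D_b^{\mu,\lambda}u\|^2_{L^2(\Omega)}.$$ If $0<\mu<\frac12$, all of this holds with $X=H^\mu(\Omega)$. In fact, $H^\nu(\Omega)=H_0^\nu(\Omega)$ for $0\le\nu\le\frac12$. -/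

import Mathlib

open MeasureTheory Filter Topology
open scoped ENNReal NNReal ContDiff FourierTransform

noncomputable section

/-- `A ≲ B` for nonnegative quantities attached to the elements of `S`: `A` is bounded by a
finite multiple of `B`, with a constant that is independent of the element of `S`. -/
def LeSim {V : Type*} (S : Set V) (A B : V → ℝ≥0∞) : Prop :=
  ∃ C : ℝ≥0, ∀ u ∈ S, A u ≤ C * B u

/-- `A ∼ B` means `A ≲ B ≲ A`. -/
def Sim {V : Type*} (S : Set V) (A B : V → ℝ≥0∞) : Prop :=
  LeSim S A B ∧ LeSim S B A

/-- The `L²(Ω)` norm, `Ω = (a, b)`. -/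
def l2Norm (a b : ℝ) (u : ℝ → ℂ) : ℝ≥0∞ :=
  eLpNorm u 2 (volume.restrict (Set.Ioo a b))

/-- The seminorm `|v|_{H^μ(ℝ)}` of `v ∈ L²(ℝ)`, whose square is `∫ |ω|^(2μ) |v̂(ω)|² dω`, where
`v̂(ω) = ∫ exp(-iωx) v(x) dx` is the value at `ω / (2π)` of Mathlib's (Plancherel) Fourier
transform `𝓕 v`. -/
def seminormLine (μ : ℝ) (v : Lp ℂ 2 (volume : Measure ℝ)) : ℝ≥0∞ :=
  (∫⁻ ξ : ℝ, ENNReal.ofReal (|ξ| ^ (2 * μ)) *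
    ‖(𝓕 v : Lp ℂ 2 (volume : Measure ℝ)) (ξ / (2 * Real.pi))‖ₑ ^ 2) ^ (1 / 2 : ℝ)

/-- `v ∈ H^μ(ℝ)` is an extension of the function `u` on `(a, b)`. -/
def IsSobolevExtension (a b μ : ℝ) (u : ℝ → ℂ) (v : Lp ℂ 2 (volume : Measure ℝ)) : Prop :=
  seminormLine μ v < ⊤ ∧ v =ᵐ[volume.restrict (Set.Ioo a b)] u

/-- `H^μ(Ω)`, `Ω = (a, b)`. Its elements are represented by functions `ℝ → ℂ`, of which only
the almost everywhere class on `(a, b)` matters. -/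
def sobolev (a b μ : ℝ) : Set (ℝ → ℂ) :=
  {u | MemLp u 2 (volume.restrict (Set.Ioo a b)) ∧ ∃ v, IsSobolevExtension a b μ u v}

/-- The seminorm `|u|_{H^μ(Ω)}`: the infimum of `|v|_{H^μ(ℝ)}` over all extensions `v` of `u`
in `H^μ(ℝ)`. -/
def sobolevSeminorm (a b μ : ℝ) (u : ℝ → ℂ) : ℝ≥0∞ :=
  ⨅ (v : Lp ℂ 2 (volume : Measure ℝ)) (_ : IsSobolevExtension a b μ u v), seminormLine μ v

/-- The norm `‖u‖_{H^μ(Ω)} = (‖u‖_{L²(Ω)}² + |u|_{H^μ(Ω)}²)^(1/2)`. -/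
def sobolevNorm (a b μ : ℝ) (u : ℝ → ℂ) : ℝ≥0∞ :=
  (l2Norm a b u ^ 2 + sobolevSeminorm a b μ u ^ 2) ^ (1 / 2 : ℝ)

/-- `φ ∈ C_0^∞(Ω)`: smooth with compact support contained in `(a, b)`. -/
def IsTest (a b : ℝ) (φ : ℝ → ℂ) : Prop :=
  ContDiff ℝ ∞ φ ∧ HasCompactSupport φ ∧ tsupport φ ⊆ Set.Ioo a b

/-- `H_0^μ(Ω)`: the closure of `C_0^∞(Ω)` in `H^μ(Ω)` with respect to `‖·‖_{H^μ(Ω)}`. -/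
def sobolevZero (a b μ : ℝ) : Set (ℝ → ℂ) :=
  {u | u ∈ sobolev a b μ ∧
    ∀ ε : ℝ≥0∞, 0 < ε → ∃ φ, IsTest a b φ ∧ sobolevNorm a b μ (φ - u) < ε}

/-- The left tempered Riemann–Liouville derivative of order `μ ≥ 0` with parameter `lam`,
`e^{-λx} / Γ(n-μ) · dⁿ/dxⁿ ∫_a^x e^{λξ} u(ξ) (x-ξ)^{-(μ-n+1)} dξ` with `n - 1 ≤ μ < n`. -/
def leftTemperedRL (a lam μ : ℝ) (u : ℝ → ℂ) (x : ℝ) : ℂ :=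
  let n : ℕ := ⌊μ⌋₊ + 1
  ((Real.exp (-lam * x) / Real.Gamma (n - μ) : ℝ) : ℂ) *
    iteratedDeriv n
      (fun y : ℝ => ∫ ξ in a..y,
        ((Real.exp (lam * ξ) / (y - ξ) ^ (μ - n + 1) : ℝ) : ℂ) * u ξ) x

/-- The right tempered Riemann–Liouville derivative of order `μ ≥ 0` with parameter `lam`,
`e^{λx} / Γ(n-μ) · (-1)ⁿ dⁿ/dxⁿ ∫_x^b e^{-λξ} u(ξ) (ξ-x)^{-(μ-n+1)} dξ` with `n - 1 ≤ μ < n`. -/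
def rightTemperedRL (b lam μ : ℝ) (u : ℝ → ℂ) (x : ℝ) : ℂ :=
  let n : ℕ := ⌊μ⌋₊ + 1
  ((Real.exp (lam * x) / Real.Gamma (n - μ) : ℝ) : ℂ) * (-1) ^ n *
    iteratedDeriv n
      (fun y : ℝ => ∫ ξ in y..b,
        ((Real.exp (-lam * ξ) / (ξ - y) ^ (μ - n + 1) : ℝ) : ℂ) * u ξ) x

/-- `w ∈ L²(Ω)` is the value at `u ∈ H_0^μ(Ω)` of the continuous extension to `H_0^μ(Ω)` of the
operator `D : C_0^∞(Ω) → L²(Ω)`: for every sequence of test functions `φ k → u` in `H^μ(Ω)`,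
`D (φ k) → w` in `L²(Ω)`. -/
def IsContinuousExtensionValue (a b μ : ℝ) (D : (ℝ → ℂ) → ℝ → ℂ) (u w : ℝ → ℂ) : Prop :=
  u ∈ sobolevZero a b μ ∧ MemLp w 2 (volume.restrict (Set.Ioo a b)) ∧
    ∀ φ : ℕ → ℝ → ℂ, (∀ k, IsTest a b (φ k)) →
      (∀ k, MemLp (D (φ k)) 2 (volume.restrict (Set.Ioo a b))) ∧
      (Tendsto (fun k => sobolevNorm a b μ (φ k - u)) atTop (𝓝 0) →
        Tendsto (fun k => l2Norm a b (D (φ k) - w)) atTop (𝓝 0))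

open Classical in
/-- The extension by continuity to `H_0^μ(Ω)` of an operator `D` defined on `C_0^∞(Ω)`
(determined up to equality almost everywhere on `Ω`; `0` where there is no extension). -/
def continuousExtension (a b μ : ℝ) (D : (ℝ → ℂ) → ℝ → ℂ) (u : ℝ → ℂ) : ℝ → ℂ :=
  if h : ∃ w, IsContinuousExtensionValue a b μ D u w then h.choose else 0

/-- The left tempered derivative of order `μ` as an operator from `H_0^μ(Ω)` to `L²(Ω)`. -/
def leftTempered (a b lam μ : ℝ) : (ℝ → ℂ) → ℝ → ℂ :=
  continuousExtension a b μ (leftTemperedRL a lam μ)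

/-- The right tempered derivative of order `μ` as an operator from `H_0^μ(Ω)` to `L²(Ω)`. -/
def rightTempered (a b lam μ : ℝ) : (ℝ → ℂ) → ℝ → ℂ :=
  continuousExtension a b μ (rightTemperedRL b lam μ)

end

noncomputable section

/-! Two estimates on test functions carry the equivalences; density of the test functions in
`H_0^μ(Ω)` does the rest.

Upper bound. Extension by zero is bounded on test functions: the `L²(ℝ)` norm and the `H^μ(ℝ)`
seminorm of `φ` are controlled by the seminorm of any extension `v` of `φ` from `Ω`
(`zero_extension_bound`). For `μ < 1` the Fourier seminorm is a Gagliardo double integral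
(`gagliardo_eq`). Extending by zero adds to the integral over `Ω × Ω` only terms weighted by
`dist(x, ∂Ω)^(-2μ)`, which the fractional Hardy inequality absorbs (`hardy_of_gt`, `hardy_of_lt`).
This is where `μ ≠ 1/2` enters. For `μ = 1` difference quotients replace Gagliardo integrals. On `Ω`
the tempered derivative is convolution of `φ' + λφ` with a truncated kernel `s^(-μ) e^(-λs) /
Γ(1-μ)`, whose transform is bounded and is `O(|ξ|^(μ-1))`; hence its `L²` norm is at most a multiple
of `‖φ‖ + |φ|_{H^μ(ℝ)}`.

Lower bound. The tempered fractional integral of order `μ` inverts the derivative on `Ω`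
(`conv_leftTemperedRL`, a Beta integral). Its truncated kernel has transform `O(|ξ|^(-μ))`
(`norm_fourier_temperedKernel_le`), so the integral of `1_Ω D^μ φ` is an extension of `φ` whose
seminorm is bounded by the `L²(Ω)` norm of `D^μ φ`. No coercivity or sign of `cos(πμ)` is involved.
The right derivative is the left one conjugated by the reflection of `Ω`.

Density for `ν ≤ 1/2`. Points have zero capacity in `H^{1/2}`. Cutoffs of a smooth function at the
scales `4^(-j)` around an endpoint are almost orthogonal in `H^{1/2}`, so their average over `N`
scales still agrees with the function near the endpoint while its norm is `O(N^(-1/2))`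
(`exists_small_germ`). Subtracting such averages at both endpoints from a smooth approximation
leaves a test function on `Ω`. -/

/-- The space `L²(ℝ)`. -/
abbrev L2 : Type := Lp ℂ 2 (volume : Measure ℝ)

/-! ### The Plancherel transform: integrable functions, translations, reflections. -/

theorem fourier_pairing (v : L2) (G : SchwartzMap ℝ ℂ) :
    ∫ x, G x * (𝓕 v : L2) x = ∫ x, (𝓕 (G : ℝ → ℂ)) x * v x := by
  have h := congrArg (fun T => T G) (Lp.fourier_toTemperedDistribution_eq v)
  simp only [TemperedDistribution.fourier_apply, Lp.toTemperedDistribution_apply,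
    smul_eq_mul] at h
  rw [← h]
  simp [SchwartzMap.fourier_coe]

theorem locallyIntegrable_L2 (v : L2) : LocallyIntegrable v volume :=
  (Lp.memLp v).locallyIntegrable (by norm_num)

/-- The `L²` transform is defined abstractly, so pointwise formulas for it are obtained weakly:
smooth compactly supported functions separate locally integrable ones. All identifications of `𝓕 v`
below go through this criterion. -/
theorem fourier_ae_eq_of_pairing (v : L2) (w : ℝ → ℂ) (hw : LocallyIntegrable w volume)
    (h : ∀ G : ℝ → ℂ, ContDiff ℝ ∞ G → HasCompactSupport G →
      ∫ x, G x * w x = ∫ x, 𝓕 G x * v x) : (𝓕 v : L2) =ᵐ[volume] w := by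
  refine ae_eq_of_integral_contDiff_smul_eq (locallyIntegrable_L2 _) hw fun g hg hc => ?_
  have hg' : ContDiff ℝ ∞ (fun x => (g x : ℂ)) := Complex.ofRealCLM.contDiff.comp hg
  have hc' : HasCompactSupport (fun x => (g x : ℂ)) := hc.comp_left (g := fun x : ℝ => (x : ℂ)) (by simp)
  have h1 := fourier_pairing v (hc'.toSchwartzMap hg')
  have h2 := h _ hg' hc'
  simp only [Complex.real_smul]
  rw [h2]
  exact h1

theorem integral_fourier_mul (f g : ℝ → ℂ) (hf : Integrable f) (hg : Integrable g) :
    ∫ x, 𝓕 f x * g x = ∫ x, f x * 𝓕 g x := by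
  have := VectorFourier.integral_fourierIntegral_smul_eq_flip (μ := (volume : Measure ℝ))
    (ν := (volume : Measure ℝ)) (L := innerₗ ℝ) (e := Real.fourierChar)
    Real.continuous_fourierChar continuous_inner hf hg
  simp only [smul_eq_mul, flip_innerₗ] at this
  exact this

theorem fourier_toLp_ae_eq {f : ℝ → ℂ} (hf : Integrable f) (hf2 : MemLp f 2 volume) :
    (𝓕 (hf2.toLp f) : L2) =ᵐ[volume] 𝓕 f := by
  refine fourier_ae_eq_of_pairing _ _ ?_ ?_
  · exact (VectorFourier.fourierIntegral_continuous Real.continuous_fourierChar continuous_inner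
      hf : Continuous (𝓕 f)).locallyIntegrable
  · intro G hG hc
    have hGi : Integrable G := hG.continuous.integrable_of_hasCompactSupport hc
    rw [integral_fourier_mul _ _ hGi hf |>.symm]
    refine integral_congr_ae ?_
    filter_upwards [hf2.coeFn_toLp] with x hx
    rw [hx]

theorem contDiff_fourierChar (c : ℝ) : ContDiff ℝ ∞ (fun η : ℝ => (Real.fourierChar (c * η) : ℂ)) := by
  simp only [Real.fourierChar_apply]
  have : ContDiff ℝ ∞ (fun η : ℝ => ((2 * Real.pi * (c * η) : ℝ) : ℂ)) :=
    Complex.ofRealCLM.contDiff.comp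
      (contDiff_const.mul (contDiff_const.mul contDiff_id))
  exact Complex.contDiff_exp.comp (this.mul contDiff_const)

theorem fourier_translate_ae_eq {v w : L2} {h : ℝ} (hw : w =ᵐ[volume] fun x => v (x + h)) :
    (𝓕 w : L2) =ᵐ[volume] fun ξ => (Real.fourierChar (h * ξ) : ℂ) * (𝓕 v : L2) ξ := by
  refine fourier_ae_eq_of_pairing _ _ ?_ ?_
  · exact (locallyIntegrable_L2 (𝓕 v : L2)).continuous_mul (contDiff_fourierChar h).continuous
  · intro G hG hc
    set G' : ℝ → ℂ := fun η => (Real.fourierChar (h * η) : ℂ) * G η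
    have hG' : ContDiff ℝ ∞ G' := (contDiff_fourierChar h).mul hG
    have hc' : HasCompactSupport G' := hc.mul_left
    have h1 := fourier_pairing v (hc'.toSchwartzMap hG')
    have e1 : ∀ x, G x * ((Real.fourierChar (h * x) : ℂ) * (𝓕 v : L2) x)
      = hc'.toSchwartzMap hG' x * (𝓕 v : L2) x := by
      intro x; change _ = G' x * _; simp only [G']; ring
    have e2 : ∀ y, 𝓕 G' (y + h) = 𝓕 G y := by
      intro y
      simp only [Real.fourier_eq, Circle.smul_def, smul_eq_mul, G']
      congr 1; ext η
      rw [← mul_assoc, ← Circle.coe_mul, ← AddChar.map_add_eq_mul]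
      congr 3
      simp; ring
    simp_rw [e1]
    rw [h1]
    change ∫ x, 𝓕 G' x * v x = _
    rw [← integral_add_right_eq_self _ h]
    refine integral_congr_ae ?_
    filter_upwards [hw] with x hx
    rw [hx, e2]

theorem fourier_neg_ae_eq {v w : L2} (hw : w =ᵐ[volume] fun x => v (-x)) :
    (𝓕 w : L2) =ᵐ[volume] fun ξ => (𝓕 v : L2) (-ξ) := by
  refine fourier_ae_eq_of_pairing _ _ ?_ ?_
  · have := ((Lp.memLp (𝓕 v : L2)).comp_measurePreserving (Measure.measurePreserving_neg volume))
    exact this.locallyIntegrable (by norm_num)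
  · intro G hG hc
    set G' : ℝ → ℂ := fun η => G (-η)
    have hG' : ContDiff ℝ ∞ G' := hG.comp contDiff_neg
    have hc' : HasCompactSupport G' := hc.comp_homeomorph (Homeomorph.neg ℝ)
    have h1 := fourier_pairing v (hc'.toSchwartzMap hG')
    have e2 : ∀ y, 𝓕 G' (-y) = 𝓕 G y := by
      intro y
      simp only [Real.fourier_eq, Circle.smul_def, smul_eq_mul, G']
      rw [← integral_neg_eq_self]
      simp
    rw [← integral_neg_eq_self]
    simp only [neg_neg]
    refine Eq.trans h1 ?_
    change ∫ x, 𝓕 G' x * v x = _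
    rw [← integral_neg_eq_self]
    refine integral_congr_ae ?_
    filter_upwards [hw] with x hx
    rw [hx, e2]

/-! ### The Fourier seminorm and its invariances. -/

/-- The homogeneous Sobolev seminorm on the Fourier side, without normalising factors. -/
def frSemi (μ : ℝ) (v : L2) : ℝ≥0∞ :=
  eLpNorm (fun ξ : ℝ => ((|ξ| ^ μ : ℝ) : ℂ) * (𝓕 v : L2) ξ) 2 volume

theorem eLpNorm_two_sq {α E : Type*} [MeasurableSpace α] [NormedAddCommGroup E] (m : Measure α)
    (f : α → E) : eLpNorm f 2 m ^ 2 = ∫⁻ x, ‖f x‖ₑ ^ 2 ∂m := by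
  have := eLpNorm_nnreal_pow_eq_lintegral (μ := m) (f := f) (p := 2) (by norm_num)
  simpa using this

theorem enorm_weight (μ ξ : ℝ) (z : ℂ) :
    ‖((|ξ| ^ μ : ℝ) : ℂ) * z‖ₑ ^ 2 = ENNReal.ofReal (|ξ| ^ (2 * μ)) * ‖z‖ₑ ^ 2 := by
  rw [enorm_mul, mul_pow]
  congr 1
  rw [← ofReal_norm, Complex.norm_real, Real.norm_of_nonneg (by positivity),
    ← ENNReal.ofReal_pow (by positivity), mul_comm 2 μ, Real.rpow_mul (by positivity)]
  norm_num

theorem frSemi_sq (μ : ℝ) (v : L2) :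
    frSemi μ v ^ 2 = ∫⁻ ξ, ENNReal.ofReal (|ξ| ^ (2 * μ)) * ‖(𝓕 v : L2) ξ‖ₑ ^ 2 := by
  rw [frSemi, eLpNorm_two_sq]
  simp_rw [enorm_weight]

theorem aestronglyMeasurable_weight (μ : ℝ) (v : L2) :
    AEStronglyMeasurable (fun ξ : ℝ => ((|ξ| ^ μ : ℝ) : ℂ) * (𝓕 v : L2) ξ) volume := by
  refine AEStronglyMeasurable.mul ?_ (Lp.aestronglyMeasurable _)
  have : Measurable (fun ξ : ℝ => ((|ξ| ^ μ : ℝ) : ℂ)) := by fun_prop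
  exact this.aestronglyMeasurable

theorem frSemi_add_le (μ : ℝ) (v w : L2) : frSemi μ (v + w) ≤ frSemi μ v + frSemi μ w := by
  refine le_trans (le_of_eq ?_) (eLpNorm_add_le (aestronglyMeasurable_weight μ v)
    (aestronglyMeasurable_weight μ w) (by norm_num))
  refine eLpNorm_congr_ae ?_
  rw [FourierTransform.fourier_add]
  filter_upwards [Lp.coeFn_add (𝓕 v : L2) (𝓕 w)] with ξ h
  simp only [h, Pi.add_apply]; ring

theorem frSemi_neg (μ : ℝ) (v : L2) : frSemi μ (-v) = frSemi μ v := by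
  have : (𝓕 (-v) : L2) = -𝓕 v := (Lp.fourierTransformₗᵢ ℝ ℂ).map_neg v
  rw [frSemi, this, frSemi, ← eLpNorm_neg]
  refine eLpNorm_congr_ae ?_
  filter_upwards [Lp.coeFn_neg (𝓕 v : L2)] with ξ h
  simp only [Pi.neg_apply, h]; ring

theorem frSemi_sub_le (μ : ℝ) (v w : L2) : frSemi μ (v - w) ≤ frSemi μ v + frSemi μ w := by
  rw [sub_eq_add_neg, ← frSemi_neg μ w]; exact frSemi_add_le _ _ _

theorem eLpNorm_fourier (v : L2) : eLpNorm (𝓕 v : L2) 2 volume = eLpNorm v 2 volume := by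
  rw [← Lp.enorm_def, ← Lp.enorm_def, ← ofReal_norm, ← ofReal_norm, Lp.norm_fourier_eq]

/-- Comes from the pointwise bound `|ξ|^ν ≤ 1 + |ξ|^μ` and Minkowski's inequality. -/
theorem frSemi_le_of_le {μ ν : ℝ} (hν : 0 ≤ ν) (h : ν ≤ μ) (v : L2) :
    frSemi ν v ≤ eLpNorm v 2 volume + frSemi μ v := by
  rw [← eLpNorm_fourier v]
  have h2 : ∀ ξ : ℝ, |ξ| ^ ν ≤ 1 + |ξ| ^ μ := by
    intro ξ
    rcases le_total |ξ| 1 with h1 | h1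
    · have := Real.rpow_le_one (abs_nonneg ξ) h1 hν
      have := Real.rpow_nonneg (abs_nonneg ξ) μ
      linarith
    · have := Real.rpow_le_rpow_of_exponent_le h1 h
      linarith
  calc frSemi ν v ≤ eLpNorm (fun ξ => ‖(𝓕 v : L2) ξ‖ + ‖((|ξ| ^ μ : ℝ) : ℂ) * (𝓕 v : L2) ξ‖) 2 volume := by
        refine eLpNorm_mono_real fun ξ => ?_
        rw [norm_mul, norm_mul, Complex.norm_real, Complex.norm_real,
          Real.norm_of_nonneg (by positivity), Real.norm_of_nonneg (by positivity)]
        nlinarith [h2 ξ, norm_nonneg ((𝓕 v : L2) ξ)]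
    _ ≤ _ := by
        refine (eLpNorm_add_le (Lp.aestronglyMeasurable _).norm
          (aestronglyMeasurable_weight μ v).norm (by norm_num)).trans ?_
        rw [eLpNorm_norm, eLpNorm_norm, frSemi]

theorem lintegral_comp_mul_right {c : ℝ} (hc : c ≠ 0) (f : ℝ → ℝ≥0∞) :
    ∫⁻ x, f (x * c) = ENNReal.ofReal |c⁻¹| * ∫⁻ x, f x := by
  have h : ∫⁻ x, f x ∂(Measure.map (· * c) volume) = ∫⁻ x, f (x * c) :=
    (Homeomorph.mulRight₀ c hc).measurableEmbedding.lintegral_map f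
  rw [← h]
  rw [Real.map_volume_mul_right hc, lintegral_smul_measure, smul_eq_mul]

/-- The factor relating `seminormLine` and `frSemi`. -/
def semiConst (μ : ℝ) : ℝ≥0 := NNReal.mk ((2 * Real.pi) ^ (μ + 1 / 2)) (by positivity)

theorem semiConst_ne_zero (μ : ℝ) : semiConst μ ≠ 0 := by
  have : (0 : ℝ) < (2 * Real.pi) ^ (μ + 1 / 2) := by positivity
  exact fun h => this.ne' (congrArg NNReal.toReal h)

/-- Under `ω = 2πξ` the weight contributes `(2π)^(2μ)` and `dω` contributes `2π`; the square root of
the product is `(2π)^(μ + 1/2)`. -/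
theorem seminormLine_eq (μ : ℝ) (v : L2) : seminormLine μ v = semiConst μ * frSemi μ v := by
  have hpi : (0 : ℝ) < 2 * Real.pi := by positivity
  have key : (∫⁻ ξ : ℝ, ENNReal.ofReal (|ξ| ^ (2 * μ)) *
      ‖(𝓕 v : L2) (ξ / (2 * Real.pi))‖ₑ ^ 2) = (semiConst μ * frSemi μ v) ^ 2 := by
    rw [mul_pow, frSemi_sq]
    set F : ℝ → ℝ≥0∞ := fun ξ => ENNReal.ofReal (|ξ| ^ (2 * μ)) * ‖(𝓕 v : L2) ξ‖ₑ ^ 2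
    have e : ∀ ξ : ℝ, ENNReal.ofReal (|ξ| ^ (2 * μ)) * ‖(𝓕 v : L2) (ξ / (2 * Real.pi))‖ₑ ^ 2
        = ENNReal.ofReal ((2 * Real.pi) ^ (2 * μ)) * F (ξ * (2 * Real.pi)⁻¹) := by
      intro ξ
      simp only [F]
      rw [← mul_assoc, ← ENNReal.ofReal_mul (by positivity), div_eq_mul_inv]
      congr 2
      rw [abs_mul, abs_of_pos (inv_pos.2 hpi), ← Real.mul_rpow (by positivity) (by positivity)]
      congr 1
      field_simp
    simp_rw [e]
    rw [lintegral_const_mul' _ _ ENNReal.ofReal_ne_top]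
    rw [lintegral_comp_mul_right (by positivity), inv_inv, abs_of_pos hpi, ← mul_assoc,
      ← ENNReal.ofReal_mul (by positivity)]
    congr 1
    rw [← ENNReal.ofReal_coe_nnreal, ← ENNReal.ofReal_pow (by positivity)]
    congr 1
    change _ = ((2 * Real.pi) ^ (μ + 1 / 2)) ^ 2
    rw [← Real.rpow_natCast, ← Real.rpow_mul hpi.le]
    nth_rewrite 2 [← Real.rpow_one (2 * Real.pi)]
    rw [← Real.rpow_add hpi]
    congr 1
    push_cast; ring
  rw [seminormLine, key, ← ENNReal.rpow_natCast, ← ENNReal.rpow_mul]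
  norm_num

theorem enorm_fourierChar_mul (t : ℝ) (z : ℂ) : ‖(Real.fourierChar t : ℂ) * z‖ₑ = ‖z‖ₑ := by
  rw [enorm_mul, ← ofReal_norm, Circle.norm_coe]; simp

theorem frSemi_translate {v w : L2} {h : ℝ} (μ : ℝ) (hw : w =ᵐ[volume] fun x => v (x + h)) :
    frSemi μ w = frSemi μ v := by
  refine eLpNorm_congr_enorm_ae ?_
  filter_upwards [fourier_translate_ae_eq hw] with ξ hξ
  rw [hξ, enorm_mul, enorm_fourierChar_mul, enorm_mul]

theorem frSemi_comp_neg {v w : L2} (μ : ℝ) (hw : w =ᵐ[volume] fun x => v (-x)) :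
    frSemi μ w = frSemi μ v := by
  have e : frSemi μ w = eLpNorm ((fun ξ : ℝ => ((|ξ| ^ μ : ℝ) : ℂ) * (𝓕 v : L2) ξ) ∘ (fun x => -x))
      2 volume := by
    refine eLpNorm_congr_ae ?_
    filter_upwards [fourier_neg_ae_eq hw] with ξ hξ
    simp [hξ]
  rw [e, eLpNorm_comp_measurePreserving (aestronglyMeasurable_weight μ v)
    (Measure.measurePreserving_neg volume), frSemi]

theorem frSemi_comp_const_sub {v w : L2} {c : ℝ} (μ : ℝ)
    (hw : w =ᵐ[volume] fun x => v (c - x)) : frSemi μ w = frSemi μ v := by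
  set u : L2 := Lp.compMeasurePreserving (fun x : ℝ => -x) (Measure.measurePreserving_neg volume) v
  have hu : u =ᵐ[volume] fun x => v (-x) := Lp.coeFn_compMeasurePreserving _ _
  have hw' : w =ᵐ[volume] fun x => u (x + -c) := by
    have := (measurePreserving_add_right volume (-c)).quasiMeasurePreserving.ae_eq_comp hu
    filter_upwards [hw, this] with x h1 h2
    simp only [Function.comp] at h2
    rw [h1, h2]; congr 1; ring
  rw [frSemi_translate μ hw', frSemi_comp_neg μ hu]

/-! ### Gagliardo integral and Fourier seminorm. -/

theorem lintegral_translate_sub_sq (v : L2) (h : ℝ) :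
    ∫⁻ x, ‖v (x + h) - v x‖ₑ ^ 2 =
      ∫⁻ ξ, ‖(Real.fourierChar (h * ξ) : ℂ) - 1‖ₑ ^ 2 * ‖(𝓕 v : L2) ξ‖ₑ ^ 2 := by
  set w : L2 := Lp.compMeasurePreserving (fun x : ℝ => x + h) (measurePreserving_add_right volume h) v
  have hw : w =ᵐ[volume] fun x => v (x + h) := Lp.coeFn_compMeasurePreserving _ _
  have h1 : ∫⁻ x, ‖v (x + h) - v x‖ₑ ^ 2 = eLpNorm (w - v : L2) 2 volume ^ 2 := by
    rw [eLpNorm_two_sq]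
    refine lintegral_congr_ae ?_
    filter_upwards [hw, Lp.coeFn_sub w v] with x h1 h2
    rw [h2, Pi.sub_apply, h1]
  have h3 : (𝓕 (w - v) : L2) = 𝓕 w - 𝓕 v := (Lp.fourierTransformₗᵢ ℝ ℂ).map_sub w v
  rw [h1, ← eLpNorm_fourier, eLpNorm_two_sq, h3]
  refine lintegral_congr_ae ?_
  filter_upwards [fourier_translate_ae_eq hw, Lp.coeFn_sub (𝓕 w : L2) (𝓕 v)] with ξ h4 h5
  rw [h5, Pi.sub_apply, h4, ← mul_pow, ← enorm_mul]
  congr 2; ring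

/-- The Gagliardo double integral of order `μ`. -/
def gagliardo (μ : ℝ) (f : ℝ → ℂ) : ℝ≥0∞ :=
  ∫⁻ x, ∫⁻ y, ENNReal.ofReal (|y - x| ^ (-1 - 2 * μ)) * ‖f y - f x‖ₑ ^ 2

/-- The ratio between the Gagliardo seminorm and the Fourier seminorm. -/
def gagliardoConst (μ : ℝ) : ℝ≥0∞ :=
  ∫⁻ h : ℝ, ENNReal.ofReal (|h| ^ (-1 - 2 * μ)) * ‖(Real.fourierChar h : ℂ) - 1‖ₑ ^ 2

theorem gagliardo_eq_lintegral_translate (μ : ℝ) {f : ℝ → ℂ} (hf : Measurable f) :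
    gagliardo μ f =
      ∫⁻ h, ENNReal.ofReal (|h| ^ (-1 - 2 * μ)) * ∫⁻ x, ‖f (x + h) - f x‖ₑ ^ 2 := by
  have e : ∀ h : ℝ, ENNReal.ofReal (|h| ^ (-1 - 2 * μ)) * ∫⁻ x, ‖f (x + h) - f x‖ₑ ^ 2
      = ∫⁻ x, ENNReal.ofReal (|h| ^ (-1 - 2 * μ)) * ‖f (x + h) - f x‖ₑ ^ 2 := fun h => by
    rw [lintegral_const_mul' _ _ ENNReal.ofReal_ne_top]
  simp_rw [e]
  rw [lintegral_lintegral_swap (by fun_prop)]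
  refine lintegral_congr fun x => ?_
  rw [← lintegral_add_left_eq_self _ x]
  simp

theorem norm_fourierChar_sub_one_le (t : ℝ) : ‖(Real.fourierChar t : ℂ) - 1‖ ≤ 2 * Real.pi * |t| := by
  have h := Real.norm_exp_I_mul_ofReal_sub_one_le (x := 2 * Real.pi * t)
  rw [Real.fourierChar_apply, mul_comm]
  refine h.trans (le_of_eq ?_)
  rw [Real.norm_eq_abs, abs_mul, abs_of_pos Real.two_pi_pos]

theorem norm_fourierChar_sub_one_le_two (t : ℝ) : ‖(Real.fourierChar t : ℂ) - 1‖ ≤ 2 := by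
  refine (norm_sub_le _ _).trans ?_
  rw [Circle.norm_coe]; norm_num

theorem lintegral_comp_abs_le (F : ℝ → ℝ≥0∞) :
    ∫⁻ x, F |x| ≤ 2 * ∫⁻ x in Set.Ioi 0, F x := by
  rw [← lintegral_add_compl _ (measurableSet_Ioi (a := (0:ℝ))), two_mul]
  refine add_le_add (le_of_eq ?_) (le_of_eq ?_)
  · refine setLIntegral_congr_fun measurableSet_Ioi fun x hx => ?_
    simp only [abs_of_pos (Set.mem_Ioi.1 hx)]
  · rw [Set.compl_Ioi, ← setLIntegral_congr (Iio_ae_eq_Iic (μ := volume) (a := (0 : ℝ)))]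
    have := (Measure.measurePreserving_neg (volume : Measure ℝ)).setLIntegral_comp_emb
      (MeasurableEquiv.neg ℝ).measurableEmbedding F (Set.Iio 0)
    have e : (fun x : ℝ => -x) '' Set.Iio 0 = Set.Ioi 0 := by simp
    change ∫⁻ a in Set.Iio 0, F (-a) = ∫⁻ b in (fun x : ℝ => -x) '' Set.Iio 0, F b at this
    rw [e] at this
    rw [← this]
    refine setLIntegral_congr_fun measurableSet_Iio fun x hx => ?_
    simp only [abs_of_neg (Set.mem_Iio.1 hx)]

/-- Since `|e(h) - 1| ≤ min(2, 2π|h|)`, the integrand is `O(s^(1-2μ))` near `0`, integrable as `μ <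
1`, and `O(s^(-1-2μ))` at infinity, integrable as `μ > 0`. -/
theorem gagliardoConst_ne_top {μ : ℝ} (h0 : 0 < μ) (h1 : μ < 1) : gagliardoConst μ ≠ ⊤ := by
  set F : ℝ → ℝ≥0∞ := fun s => ENNReal.ofReal (s ^ (-1 - 2 * μ) *
      (min 2 (2 * Real.pi * s)) ^ 2) with hF
  have hb : gagliardoConst μ ≤ ∫⁻ h : ℝ, F |h| := by
    refine lintegral_mono fun h => ?_
    simp only [hF]
    rw [ENNReal.ofReal_mul (by positivity)]
    gcongr
    rw [ENNReal.ofReal_pow (by positivity), ← ofReal_norm]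
    gcongr
    exact le_min (norm_fourierChar_sub_one_le_two _) (norm_fourierChar_sub_one_le _)
  refine ne_top_of_le_ne_top ?_ (hb.trans (lintegral_comp_abs_le F))
  refine ENNReal.mul_ne_top (by norm_num) ?_
  rw [← Set.Ioc_union_Ioi_eq_Ioi (zero_le_one' ℝ)]
  refine ne_top_of_le_ne_top ?_ (lintegral_union_le _ _ _)
  refine ENNReal.add_ne_top.2 ⟨?_, ?_⟩
  · have hi : IntegrableOn (fun s : ℝ => (2 * Real.pi) ^ 2 * s ^ (1 - 2 * μ)) (Set.Ioc 0 1) := by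
      have := (intervalIntegral.intervalIntegrable_rpow' (a := 0) (b := 1)
        (r := 1 - 2 * μ) (by linarith)).const_mul ((2 * Real.pi) ^ 2)
      rwa [intervalIntegrable_iff_integrableOn_Ioc_of_le zero_le_one] at this
    refine ne_top_of_le_ne_top hi.lintegral_lt_top.ne ?_
    refine setLIntegral_mono' measurableSet_Ioc fun s hs => ?_
    refine ENNReal.ofReal_le_ofReal ?_
    have e : s ^ (1 - 2 * μ) = s ^ (-1 - 2 * μ) * s ^ 2 := by
      rw [← Real.rpow_natCast, ← Real.rpow_add hs.1]; congr 1; push_cast; ring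
    rw [e]
    have hm : (min 2 (2 * Real.pi * s)) ^ 2 ≤ (2 * Real.pi * s) ^ 2 := by
      refine pow_le_pow_left₀ ?_ (min_le_right _ _) 2
      have := hs.1.le; positivity
    have := Real.rpow_nonneg hs.1.le (-1 - 2 * μ)
    calc _ ≤ s ^ (-1 - 2 * μ) * (2 * Real.pi * s) ^ 2 := by gcongr
      _ = _ := by ring
  · have hi : IntegrableOn (fun s : ℝ => 4 * s ^ (-1 - 2 * μ)) (Set.Ioi 1) :=
      (integrableOn_Ioi_rpow_of_lt (by linarith) one_pos).const_mul 4
    refine ne_top_of_le_ne_top hi.lintegral_lt_top.ne ?_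
    refine setLIntegral_mono' measurableSet_Ioi fun s hs => ?_
    refine ENNReal.ofReal_le_ofReal ?_
    have hs0 : 0 < s := lt_trans one_pos hs
    have hm : (min 2 (2 * Real.pi * s)) ^ 2 ≤ 2 ^ 2 := by
      refine pow_le_pow_left₀ ?_ (min_le_left _ _) 2
      positivity
    calc _ ≤ s ^ (-1 - 2 * μ) * 2 ^ 2 := by gcongr
      _ = _ := by ring

theorem gagliardoConst_ne_zero {μ : ℝ} (h0 : 0 < μ) : gagliardoConst μ ≠ 0 := by
  have h : (1 / 2 : ℝ≥0∞) ≤ gagliardoConst μ := by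
    -- On `[1/4, 3/4]` the cosine of `2πh` is nonpositive, so `|e(h) - 1| ≥ 1`, and the weight is at
    -- least `1` because `h < 1`.
    calc (1 / 2 : ℝ≥0∞) = ∫⁻ _ in Set.Icc (1 / 4 : ℝ) (3 / 4), 1 := by
          rw [setLIntegral_one, Real.volume_Icc, show (3 / 4 - 1 / 4 : ℝ) = 1 / 2 by norm_num,
            ENNReal.ofReal_div_of_pos (by norm_num)]
          simp
      _ ≤ ∫⁻ h in Set.Icc (1 / 4 : ℝ) (3 / 4), ENNReal.ofReal (|h| ^ (-1 - 2 * μ)) *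
            ‖(Real.fourierChar h : ℂ) - 1‖ₑ ^ 2 := by
          refine setLIntegral_mono' measurableSet_Icc fun h hh => ?_
          have hp : 0 < h := by linarith [hh.1]
          rw [← one_mul (1 : ℝ≥0∞)]
          refine mul_le_mul' ?_ ?_
          · rw [ENNReal.one_le_ofReal, abs_of_pos hp]
            exact Real.one_le_rpow_of_pos_of_le_one_of_nonpos hp (by linarith [hh.2]) (by linarith)
          · refine one_le_pow₀ ?_
            rw [← ofReal_norm, ENNReal.one_le_ofReal]
            refine le_trans ?_ (Complex.abs_re_le_norm _)
            have hre : ((Real.fourierChar h : ℂ) - 1).re = Real.cos (2 * Real.pi * h) - 1 := by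
              rw [Real.fourierChar_apply, Complex.sub_re, Complex.exp_ofReal_mul_I_re]; simp
            have hc : Real.cos (2 * Real.pi * h) ≤ 0 := by
              apply Real.cos_nonpos_of_pi_div_two_le_of_le
              · nlinarith [Real.pi_pos, hh.1]
              · nlinarith [Real.pi_pos, hh.2]
            rw [hre, abs_of_nonpos (by linarith)]
            linarith
      _ ≤ _ := setLIntegral_le_lintegral _ _
  intro h'
  rw [h'] at h
  simp at h

theorem lintegral_fourierChar_weight (μ : ℝ) {ξ : ℝ} (hξ : ξ ≠ 0) :
    ∫⁻ h : ℝ, ENNReal.ofReal (|h| ^ (-1 - 2 * μ)) * ‖(Real.fourierChar (h * ξ) : ℂ) - 1‖ₑ ^ 2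
      = ENNReal.ofReal (|ξ| ^ (2 * μ)) * gagliardoConst μ := by
  have hp : 0 < |ξ| := abs_pos.2 hξ
  set F : ℝ → ℝ≥0∞ := fun s => ENNReal.ofReal (|s| ^ (-1 - 2 * μ)) *
        ‖(Real.fourierChar s : ℂ) - 1‖ₑ ^ 2 with hF
  have e : ∀ h : ℝ, ENNReal.ofReal (|h| ^ (-1 - 2 * μ)) *
      ‖(Real.fourierChar (h * ξ) : ℂ) - 1‖ₑ ^ 2 =
      ENNReal.ofReal (|ξ| ^ (1 + 2 * μ)) * F (h * ξ) := by
    intro h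
    rw [hF, ← mul_assoc, ← ENNReal.ofReal_mul (by positivity)]
    congr 2
    rw [abs_mul, Real.mul_rpow (abs_nonneg _) (abs_nonneg _), mul_left_comm,
      ← Real.rpow_add hp, show (1 + 2 * μ) + (-1 - 2 * μ) = 0 by ring, Real.rpow_zero, mul_one]
  refine (lintegral_congr e).trans ?_
  rw [lintegral_const_mul' _ _ ENNReal.ofReal_ne_top, lintegral_comp_mul_right hξ F, ← mul_assoc,
    ← ENNReal.ofReal_mul (by positivity), gagliardoConst]
  congr 2
  rw [abs_inv, ← Real.rpow_neg_one, ← Real.rpow_add hp]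
  congr 1; ring

/-- Put `y = x + h`, apply Plancherel to each difference `v(· + h) - v`, and integrate in `h` first:
by scaling, the `h`-integral of `|h|^(-1-2μ) |e(hξ) - 1|²` is `|ξ|^(2μ)` times a constant. -/
theorem gagliardo_eq {μ : ℝ} (hμ0 : 0 < μ) (hμ1 : μ < 1) {f : ℝ → ℂ} (hf : Measurable f) {v : L2}
    (hv : v =ᵐ[volume] f) : gagliardo μ f = gagliardoConst μ * frSemi μ v ^ 2 := by
  rw [gagliardo_eq_lintegral_translate μ hf]
  have hm : Measurable (fun ξ => ‖(𝓕 v : L2) ξ‖ₑ ^ 2) :=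
    (Lp.stronglyMeasurable (𝓕 v : L2)).measurable.enorm.pow_const 2
  have hc : Measurable (fun t : ℝ => ‖(Real.fourierChar t : ℂ) - 1‖ₑ ^ 2) := by
    have := (contDiff_fourierChar 1).continuous.measurable
    simp only [one_mul] at this
    fun_prop
  set K : ℝ → ℝ → ℝ≥0∞ := fun h ξ => ENNReal.ofReal (|h| ^ (-1 - 2 * μ)) *
    ‖(Real.fourierChar (h * ξ) : ℂ) - 1‖ₑ ^ 2 * ‖(𝓕 v : L2) ξ‖ₑ ^ 2 with hK
  have h1 : ∀ h : ℝ, ENNReal.ofReal (|h| ^ (-1 - 2 * μ)) * ∫⁻ x, ‖f (x + h) - f x‖ₑ ^ 2 =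
      ∫⁻ ξ, K h ξ := by
    intro h
    simp only [hK, mul_assoc]
    rw [lintegral_const_mul' _ _ ENNReal.ofReal_ne_top]
    refine Eq.trans ?_ (congrArg _ (lintegral_translate_sub_sq v h))
    congr 1
    refine lintegral_congr_ae ?_
    have := (measurePreserving_add_right volume h).quasiMeasurePreserving.ae_eq_comp hv
    filter_upwards [hv, this] with x h1 h2
    simp only [Function.comp] at h2
    rw [h1, h2]
  have hKm : Measurable (Function.uncurry K) := by
    have h1 : Measurable fun p : ℝ × ℝ => ENNReal.ofReal (|p.1| ^ (-1 - 2 * μ)) := by fun_prop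
    exact (h1.mul (hc.comp (measurable_fst.mul measurable_snd))).mul (hm.comp measurable_snd)
  rw [lintegral_congr h1, lintegral_lintegral_swap hKm.aemeasurable, frSemi_sq,
    ← lintegral_const_mul' _ _ (gagliardoConst_ne_top hμ0 hμ1)]
  refine lintegral_congr_ae ?_
  have : ∀ᵐ ξ : ℝ, ξ ≠ 0 := by simp [ae_iff]
  filter_upwards [this] with ξ hξ
  simp only [hK]
  rw [lintegral_mul_const' _ _ (by simp), lintegral_fourierChar_weight μ hξ]
  ring

/-! ### Fractional Hardy inequalities by dilation. -/

/-- The Gagliardo double integral of order `μ` over `S × S`. -/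
def gagliardoOn (μ : ℝ) (S : Set ℝ) (f : ℝ → ℂ) : ℝ≥0∞ :=
  ∫⁻ x in S, ∫⁻ y in S, ENNReal.ofReal (|y - x| ^ (-1 - 2 * μ)) * ‖f y - f x‖ₑ ^ 2

theorem enorm_rpow_mul_sq {x : ℝ} (hx : 0 < x) (μ : ℝ) (z : ℂ) :
    ‖((x ^ (-μ) : ℝ) : ℂ) * z‖ₑ ^ 2 = ENNReal.ofReal (x ^ (-2 * μ)) * ‖z‖ₑ ^ 2 := by
  have := enorm_weight (-μ) x z
  rw [abs_of_pos hx] at this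
  rw [this]; congr 3; ring

/-- Substituting `y = xt` gives `t^(2μ)` from the weight and `t^(-1)` from `dx`. There is only an
inequality because `tS` may be smaller than `S`. -/
theorem setLIntegral_dilation_le {S : Set ℝ} (hS : MeasurableSet S) (hS0 : S ⊆ Set.Ioi 0) {t μ : ℝ}
    (ht : 0 < t) (hinv : ∀ x ∈ S, x * t ∈ S) (f : ℝ → ℂ) :
    ∫⁻ x in S, ENNReal.ofReal (x ^ (-2 * μ)) * ‖f (x * t)‖ₑ ^ 2 ≤
      ENNReal.ofReal (t ^ (2 * μ - 1)) *
        ∫⁻ x in S, ENNReal.ofReal (x ^ (-2 * μ)) * ‖f x‖ₑ ^ 2 := by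
  set G : ℝ → ℝ≥0∞ := S.indicator fun x => ENNReal.ofReal (x ^ (-2 * μ)) * ‖f x‖ₑ ^ 2 with hG
  rw [← lintegral_indicator hS, ← lintegral_indicator hS]
  calc _ ≤ ∫⁻ x, ENNReal.ofReal (t ^ (2 * μ)) * G (x * t) := by
        refine lintegral_mono fun x => ?_
        by_cases hx : x ∈ S
        · have hx0 : 0 < x := hS0 hx
          rw [Set.indicator_of_mem hx, hG, Set.indicator_of_mem (hinv x hx), ← mul_assoc,
            ← ENNReal.ofReal_mul (by positivity)]
          gcongr
          rw [Real.mul_rpow hx0.le ht.le, mul_left_comm, ← Real.rpow_add ht]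
          simp
        · rw [Set.indicator_of_notMem hx]; exact zero_le
    _ = _ := by
        rw [lintegral_const_mul' _ _ ENNReal.ofReal_ne_top, lintegral_comp_mul_right ht.ne' G,
          ← mul_assoc, ← ENNReal.ofReal_mul (by positivity), abs_of_pos (inv_pos.2 ht),
          ← Real.rpow_neg_one, ← Real.rpow_add ht]
        rfl

/-- Dilation by `t` has norm at most `q` on `L²(S, x^(-2μ) dx)`, so the reverse triangle inequality
bounds `(1 - q)‖f‖` by `‖f(t·) - f‖`. Finiteness of `‖f‖` is what allows the subtraction. -/
theorem hardy_fixed_dilation {S : Set ℝ} (hS : MeasurableSet S) (hS0 : S ⊆ Set.Ioi 0) {t μ q : ℝ}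
    (ht : 0 < t) (hinv : ∀ x ∈ S, x * t ∈ S) (hq0 : 0 ≤ q)
    (hq : t ^ (2 * μ - 1) ≤ q ^ 2) {f : ℝ → ℂ} (hf : Measurable f)
    (hfin : ∫⁻ x in S, ENNReal.ofReal (x ^ (-2 * μ)) * ‖f x‖ₑ ^ 2 ≠ ⊤) :
    ENNReal.ofReal (1 - q) ^ 2 * ∫⁻ x in S, ENNReal.ofReal (x ^ (-2 * μ)) * ‖f x‖ₑ ^ 2 ≤
      ∫⁻ x in S, ENNReal.ofReal (x ^ (-2 * μ)) * ‖f (x * t) - f x‖ₑ ^ 2 := by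
  set m := volume.restrict S
  have hw : Measurable fun x : ℝ => ((x ^ (-μ) : ℝ) : ℂ) := by fun_prop
  have key : ∀ g : ℝ → ℂ, eLpNorm (fun x => ((x ^ (-μ) : ℝ) : ℂ) * g x) 2 m ^ 2 =
      ∫⁻ x in S, ENNReal.ofReal (x ^ (-2 * μ)) * ‖g x‖ₑ ^ 2 := by
    intro g
    rw [eLpNorm_two_sq]
    exact setLIntegral_congr_fun hS fun x hx => enorm_rpow_mul_sq (hS0 hx) μ _
  have hft : Measurable fun x => f (x * t) := by fun_prop
  rw [← key, ← key (fun x => f (x * t) - f x), ← mul_pow]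
  rw [← key] at hfin
  have hn : eLpNorm (fun x => ((x ^ (-μ) : ℝ) : ℂ) * f x) 2 m ≠ ⊤ := by
    intro h; rw [h] at hfin; simp at hfin
  have h1 : eLpNorm (fun x => ((x ^ (-μ) : ℝ) : ℂ) * f (x * t)) 2 m ≤
      ENNReal.ofReal q * eLpNorm (fun x => ((x ^ (-μ) : ℝ) : ℂ) * f x) 2 m := by
    rw [← ENNReal.pow_le_pow_left_iff two_ne_zero, mul_pow, key (fun x => f (x * t)), key f,
      ← ENNReal.ofReal_pow hq0]
    refine (setLIntegral_dilation_le hS hS0 ht hinv f).trans ?_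
    gcongr
  have h2 : eLpNorm (fun x => ((x ^ (-μ) : ℝ) : ℂ) * f x) 2 m ≤
      eLpNorm (fun x => ((x ^ (-μ) : ℝ) : ℂ) * f (x * t)) 2 m +
      eLpNorm (fun x => ((x ^ (-μ) : ℝ) : ℂ) * (f (x * t) - f x)) 2 m := by
    have := eLpNorm_sub_le (p := 2) (μ := m) (hw.mul hft).aestronglyMeasurable
      (hw.mul (hft.sub hf)).aestronglyMeasurable (by norm_num)
    refine le_trans (le_of_eq ?_) this
    congr 1; ext x; simp only [Pi.sub_apply, Pi.mul_apply]; ring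
  gcongr
  rw [ENNReal.ofReal_sub _ hq0, ENNReal.sub_mul (fun _ _ => hn), ENNReal.ofReal_one, one_mul,
    tsub_le_iff_left]
  exact h2.trans (add_le_add h1 le_rfl)

/-- Integrating the fixed-dilation estimate over `t ∈ T` and substituting `y = xt` turns `x^(-2μ)
dt` into `x^(-1-2μ) dy`. Since `|y - x| = x|t - 1| ≤ Mx`, this weight is at most `M^(1+2μ) |y -
x|^(-1-2μ)`, the Gagliardo kernel. -/
theorem hardy_of_dilation {S T : Set ℝ} (hS : MeasurableSet S) (hS0 : S ⊆ Set.Ioi 0)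
    (hT : MeasurableSet T) (hT0 : T ⊆ Set.Ioi 0) {μ q M : ℝ} (hμ : 0 < μ)
    (hinv : ∀ t ∈ T, ∀ x ∈ S, x * t ∈ S) (hq0 : 0 ≤ q)
    (hq : ∀ t ∈ T, t ^ (2 * μ - 1) ≤ q ^ 2) (hM : ∀ t ∈ T, |t - 1| ≤ M) {f : ℝ → ℂ}
    (hf : Measurable f)
    (hfin : ∫⁻ x in S, ENNReal.ofReal (x ^ (-2 * μ)) * ‖f x‖ₑ ^ 2 ≠ ⊤) :
    ENNReal.ofReal (1 - q) ^ 2 * volume T *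
      ∫⁻ x in S, ENNReal.ofReal (x ^ (-2 * μ)) * ‖f x‖ₑ ^ 2 ≤
      ENNReal.ofReal (M ^ (1 + 2 * μ)) * gagliardoOn μ S f := by
  set N := ∫⁻ x in S, ENNReal.ofReal (x ^ (-2 * μ)) * ‖f x‖ₑ ^ 2
  have hm : Measurable (Function.uncurry fun t x : ℝ =>
      ENNReal.ofReal (x ^ (-2 * μ)) * ‖f (x * t) - f x‖ₑ ^ 2) := by fun_prop
  calc ENNReal.ofReal (1 - q) ^ 2 * volume T * N
      = ∫⁻ _ in T, ENNReal.ofReal (1 - q) ^ 2 * N := by rw [setLIntegral_const]; ring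
    _ ≤ ∫⁻ t in T, ∫⁻ x in S, ENNReal.ofReal (x ^ (-2 * μ)) * ‖f (x * t) - f x‖ₑ ^ 2 :=
        setLIntegral_mono' hT fun t ht => hardy_fixed_dilation hS hS0 (hT0 ht) (hinv t ht) hq0
          (hq t ht) hf hfin
    _ = ∫⁻ x in S, ∫⁻ t in T, ENNReal.ofReal (x ^ (-2 * μ)) * ‖f (x * t) - f x‖ₑ ^ 2 :=
        lintegral_lintegral_swap hm.aemeasurable
    _ ≤ ∫⁻ x in S, ENNReal.ofReal (M ^ (1 + 2 * μ)) *
          ∫⁻ y in S, ENNReal.ofReal (|y - x| ^ (-1 - 2 * μ)) * ‖f y - f x‖ₑ ^ 2 := by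
        refine setLIntegral_mono' hS fun x hx => ?_
        have hx0 : 0 < x := hS0 hx
        set G : ℝ → ℝ≥0∞ := S.indicator fun y =>
          ENNReal.ofReal (|y - x| ^ (-1 - 2 * μ)) * ‖f y - f x‖ₑ ^ 2 with hG
        have hb : ∀ t ∈ T, ENNReal.ofReal (x ^ (-2 * μ)) * ‖f (x * t) - f x‖ₑ ^ 2 ≤
            ENNReal.ofReal (M ^ (1 + 2 * μ)) * ENNReal.ofReal x * G (t * x) := by
          intro t ht
          rw [mul_comm t x, hG, Set.indicator_of_mem (hinv t ht x hx)]
          -- At `t = 1` the difference on the left vanishes, so the singular kernel is harmless.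
          rcases eq_or_ne t 1 with rfl | h1
          · simp
          have habs : 0 < |t - 1| := abs_pos.2 (sub_ne_zero.2 h1)
          have hM0 : 0 < M := habs.trans_le (hM t ht)
          rw [← mul_assoc, ← ENNReal.ofReal_mul (by positivity),
            ← ENNReal.ofReal_mul (by positivity)]
          gcongr
          have e : |x * t - x| = x * |t - 1| := by
            rw [← mul_sub_one, abs_mul, abs_of_pos hx0]
          have e2 : x * x ^ (-1 - 2 * μ) = x ^ (-2 * μ) := by
            nth_rewrite 1 [← Real.rpow_one x]
            rw [← Real.rpow_add hx0]; congr 1; ring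
          rw [e, Real.mul_rpow hx0.le (abs_nonneg _), mul_assoc, ← mul_assoc x, e2]
          have h3 : M ^ (-1 - 2 * μ) ≤ |t - 1| ^ (-1 - 2 * μ) :=
            Real.rpow_le_rpow_of_nonpos habs (hM t ht) (by linarith)
          have h4 : M ^ (1 + 2 * μ) * M ^ (-1 - 2 * μ) = 1 := by
            rw [← Real.rpow_add hM0]; simp
          calc x ^ (-2 * μ) = M ^ (1 + 2 * μ) * (x ^ (-2 * μ) * M ^ (-1 - 2 * μ)) := by
                rw [mul_left_comm, h4, mul_one]
            _ ≤ _ := by gcongr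
        calc _ ≤ ∫⁻ t in T, ENNReal.ofReal (M ^ (1 + 2 * μ)) * ENNReal.ofReal x * G (t * x) :=
              setLIntegral_mono' hT hb
          _ ≤ ∫⁻ t, ENNReal.ofReal (M ^ (1 + 2 * μ)) * ENNReal.ofReal x * G (t * x) :=
              setLIntegral_le_lintegral _ _
          _ = _ := by
              rw [lintegral_const_mul' _ _ (by finiteness), lintegral_comp_mul_right hx0.ne' G,
                ← mul_assoc, mul_assoc (ENNReal.ofReal (M ^ (1 + 2 * μ))),
                ← ENNReal.ofReal_mul hx0.le, abs_of_pos (inv_pos.2 hx0),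
                mul_inv_cancel₀ hx0.ne', ENNReal.ofReal_one, mul_one, lintegral_indicator hS]
    _ = _ := by rw [lintegral_const_mul' _ _ ENNReal.ofReal_ne_top, gagliardoOn]

theorem gagliardoOn_mono {μ : ℝ} {S T : Set ℝ} (h : S ⊆ T) (f : ℝ → ℂ) :
    gagliardoOn μ S f ≤ gagliardoOn μ T f :=
  lintegral_mono' (Measure.restrict_mono h le_rfl)
    fun _ => lintegral_mono' (Measure.restrict_mono h le_rfl) le_rfl

theorem gagliardoOn_le (μ : ℝ) (S : Set ℝ) (f : ℝ → ℂ) : gagliardoOn μ S f ≤ gagliardo μ f :=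
  lintegral_mono' Measure.restrict_le_self
    fun _ => lintegral_mono' Measure.restrict_le_self le_rfl

theorem weighted_lintegral_ne_top {S : Set ℝ} (hS : MeasurableSet S) {δ μ : ℝ} (hδ : 0 < δ)
    (hμ : 0 < μ) {f : ℝ → ℂ} (hf : ∀ x ∈ S, x ≤ δ → f x = 0)
    (h2 : MemLp f 2 (volume.restrict S)) :
    ∫⁻ x in S, ENNReal.ofReal (x ^ (-2 * μ)) * ‖f x‖ₑ ^ 2 ≠ ⊤ := by
  have h : ∫⁻ x in S, ENNReal.ofReal (x ^ (-2 * μ)) * ‖f x‖ₑ ^ 2 ≤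
      ∫⁻ x in S, ENNReal.ofReal (δ ^ (-2 * μ)) * ‖f x‖ₑ ^ 2 := by
    refine setLIntegral_mono' hS fun x hx => ?_
    rcases le_or_gt x δ with h | h
    · simp [hf x hx h]
    · exact mul_le_mul' (ENNReal.ofReal_le_ofReal
        (Real.rpow_le_rpow_of_nonpos hδ h.le (by linarith))) le_rfl
  refine ne_top_of_le_ne_top ?_ h
  rw [lintegral_const_mul' _ _ ENNReal.ofReal_ne_top, ← eLpNorm_two_sq]
  exact ENNReal.mul_ne_top ENNReal.ofReal_ne_top (ENNReal.pow_ne_top h2.eLpNorm_ne_top)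

theorem le_const_mul_of_pos_mul_le {c d A B : ℝ≥0∞} (hc : c ≠ 0) (hd : d ≠ ⊤) (hc' : c ≠ ⊤)
    (h : c * A ≤ d * B) : A ≤ ((c⁻¹ * d).toNNReal : ℝ≥0∞) * B := by
  rw [ENNReal.coe_toNNReal (ENNReal.mul_ne_top (ENNReal.inv_ne_top.2 hc) hd), mul_assoc]
  calc A = c⁻¹ * (c * A) := by rw [← mul_assoc, ENNReal.inv_mul_cancel hc hc', one_mul]
    _ ≤ _ := by gcongr

/-- The fractional Hardy inequality of order `μ > 1/2` for functions vanishing near `0`. -/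
theorem hardy_of_gt {μ : ℝ} (hμ : 1 / 2 < μ) : ∃ C : ℝ≥0, ∀ (L δ : ℝ) (f : ℝ → ℂ), 0 < δ →
    Measurable f → (∀ x, x ≤ δ → f x = 0) → MemLp f 2 volume →
    ∫⁻ x in Set.Ioo 0 L, ENNReal.ofReal (x ^ (-2 * μ)) * ‖f x‖ₑ ^ 2 ≤
      C * gagliardoOn μ (Set.Ioo 0 L) f := by
  have hq : (1 / 2 : ℝ) ^ (μ - 1 / 2) < 1 :=
    Real.rpow_lt_one (by norm_num) (by norm_num) (by linarith)
  -- For `μ > 1/2` contractions have norm `t^(μ-1/2) < 1`, and they preserve `(0, L)`. Vanishing up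
  -- to `δ` makes the weighted norm finite.
  refine ⟨_, fun L δ f hδ hf hz h2 => le_const_mul_of_pos_mul_le ?_ ?_ ?_ (hardy_of_dilation
    (S := Set.Ioo 0 L) (T := Set.Ioo (1 / 4) (1 / 2)) (q := (1 / 2 : ℝ) ^ (μ - 1 / 2)) (M := 1)
    measurableSet_Ioo (fun x hx => hx.1) measurableSet_Ioo ?_ (by linarith) ?_ (by positivity) ?_ ?_
    hf ?_)⟩
  · have : 0 < 1 - (1 / 2 : ℝ) ^ (μ - 1 / 2) := by linarith
    refine mul_ne_zero (pow_ne_zero _ ?_) ?_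
    · simpa using hq
    · rw [Real.volume_Ioo]; norm_num
  · exact ENNReal.ofReal_ne_top
  · rw [Real.volume_Ioo]; finiteness
  · intro t ht; exact lt_trans (by norm_num) ht.1
  · intro t ht x hx
    have : 0 < t := lt_trans (by norm_num) ht.1
    exact ⟨mul_pos hx.1 this, by nlinarith [hx.1, hx.2, ht.2]⟩
  · intro t ht
    have ht0 : 0 < t := lt_trans (by norm_num) ht.1
    rw [← Real.rpow_natCast, ← Real.rpow_mul (by norm_num)]
    refine (Real.rpow_le_rpow ht0.le ht.2.le (by linarith)).trans (le_of_eq ?_)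
    congr 1; push_cast; ring
  · intro t ht; rw [abs_le]; constructor <;> linarith [ht.1, ht.2]
  · exact weighted_lintegral_ne_top measurableSet_Ioo hδ (by linarith) (fun x _ => hz x) (h2.restrict _)

/-- The fractional Hardy inequality of order `0 < μ < 1/2`. -/
theorem hardy_of_lt {μ : ℝ} (hμ0 : 0 < μ) (hμ : μ < 1 / 2) : ∃ C : ℝ≥0, ∀ f : ℝ → ℂ,
    Measurable f → MemLp f 2 volume →
    ∫⁻ x in Set.Ioi 0, ENNReal.ofReal (x ^ (-2 * μ)) * ‖f x‖ₑ ^ 2 ≤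
      C * gagliardoOn μ (Set.Ioi 0) f := by
  have hq : (2 : ℝ) ^ (μ - 1 / 2) < 1 :=
    Real.rpow_lt_one_of_one_lt_of_neg (by norm_num) (by linarith)
  have h : ∃ C : ℝ≥0, ∀ (δ : ℝ) (f : ℝ → ℂ), 0 < δ →
    Measurable f → MemLp f 2 volume →
    ∫⁻ x in Set.Ioi δ, ENNReal.ofReal (x ^ (-2 * μ)) * ‖f x‖ₑ ^ 2 ≤
      C * gagliardoOn μ (Set.Ioi δ) f := by
    -- For `μ < 1/2` it is the expansions that have norm below `1`. They preserve `(δ, ∞)`, where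
    -- the weight is bounded, so no vanishing is required; the constant does not depend on `δ`,
    -- which then tends to `0`.
    refine ⟨_, fun δ f hδ hf h2 => le_const_mul_of_pos_mul_le ?_ ?_ ?_ (hardy_of_dilation
      (S := Set.Ioi δ) (T := Set.Ioo 2 4) (q := (2 : ℝ) ^ (μ - 1 / 2)) (M := 3)
      measurableSet_Ioi (fun x hx => lt_trans hδ hx) measurableSet_Ioo ?_ (by linarith) ?_
      (by positivity) ?_ ?_ hf ?_)⟩
    · refine mul_ne_zero (pow_ne_zero _ ?_) ?_
      · simpa using hq
      · rw [Real.volume_Ioo]; norm_num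
    · exact ENNReal.ofReal_ne_top
    · rw [Real.volume_Ioo]; finiteness
    · intro t ht; exact lt_trans (by norm_num) ht.1
    · intro t ht x hx
      have := ht.1
      simp only [Set.mem_Ioi] at hx ⊢
      nlinarith
    · intro t ht
      rw [← Real.rpow_natCast, ← Real.rpow_mul (by norm_num)]
      refine (Real.rpow_le_rpow_of_nonpos (by norm_num) ht.1.le (by linarith)).trans (le_of_eq ?_)
      congr 1; push_cast; ring
    · intro t ht; rw [abs_le]; constructor <;> linarith [ht.1, ht.2]
    · exact weighted_lintegral_ne_top measurableSet_Ioi hδ hμ0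
        (fun x hx hx' => absurd hx' (not_le.2 hx)) (h2.restrict _)
  obtain ⟨C, hC⟩ := h
  refine ⟨C, fun f hf h2 => ?_⟩
  have hU : Set.Ioi (0 : ℝ) = ⋃ n : ℕ, Set.Ioi (1 / ((n : ℝ) + 1)) := by
    ext x
    simp only [Set.mem_Ioi, Set.mem_iUnion]
    exact ⟨fun hx => exists_nat_one_div_lt hx, fun ⟨n, hn⟩ => lt_trans (by positivity) hn⟩
  have hd : Directed (· ⊆ ·) fun n : ℕ => Set.Ioi (1 / ((n : ℝ) + 1)) := by
    refine (monotone_nat_of_le_succ fun n => ?_).directed_le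
    refine Set.Ioi_subset_Ioi ?_
    push_cast
    gcongr; linarith
  have hsup := setLIntegral_iUnion_of_directed (μ := volume)
    (fun x : ℝ => ENNReal.ofReal (x ^ (-2 * μ)) * ‖f x‖ₑ ^ 2) hd
  rw [hU, hsup]
  refine iSup_le fun n => (hC _ f (by positivity) hf h2).trans ?_
  gcongr
  exact gagliardoOn_mono (Set.subset_iUnion (fun n : ℕ => Set.Ioi (1 / ((n : ℝ) + 1))) n) f

/-! ### Elementary properties of test functions. -/

namespace IsTest

variable {a b : ℝ} {φ ψ : ℝ → ℂ}

theorem continuous (h : IsTest a b φ) : Continuous φ := h.1.continuous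

theorem memLp (h : IsTest a b φ) : MemLp φ 2 volume :=
  h.continuous.memLp_of_hasCompactSupport h.2.1

/-- A test function as an element of `L²(ℝ)`. -/
def toL2 (h : IsTest a b φ) : L2 := h.memLp.toLp φ

theorem coe_toL2 (h : IsTest a b φ) : h.toL2 =ᵐ[volume] φ := h.memLp.coeFn_toLp

theorem eq_zero (h : IsTest a b φ) {x : ℝ} (hx : x ∉ Set.Ioo a b) : φ x = 0 :=
  image_eq_zero_of_notMem_tsupport fun hx' => hx (h.2.2 hx')

theorem comp_add (h : IsTest a b φ) (c : ℝ) : IsTest (a - c) (b - c) fun x => φ (x + c) := by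
  refine ⟨h.1.comp (contDiff_id.add contDiff_const),
    h.2.1.comp_homeomorph (Homeomorph.addRight c), ?_⟩
  have := tsupport_comp_eq_preimage φ (Homeomorph.addRight c)
  change tsupport (fun x => φ (x + c)) = _ at this
  rw [this]
  intro x hx
  have := h.2.2 hx
  simp only [Homeomorph.coe_addRight, Set.mem_Ioo] at this ⊢
  constructor <;> linarith [this.1, this.2]

theorem comp_const_sub (h : IsTest a b φ) (c : ℝ) : IsTest (c - b) (c - a) fun x => φ (c - x) := by
  refine ⟨h.1.comp (contDiff_const.sub contDiff_id),
    h.2.1.comp_homeomorph (Homeomorph.subLeft c), ?_⟩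
  have := tsupport_comp_eq_preimage φ (Homeomorph.subLeft c)
  change tsupport (fun x => φ (c - x)) = _ at this
  rw [this]
  intro x hx
  have := h.2.2 hx
  simp only [Homeomorph.coe_subLeft, Set.mem_Ioo] at this ⊢
  constructor <;> linarith [this.1, this.2]

theorem exists_margin (h : IsTest a b φ) :
    ∃ δ > 0, ∀ x, x ≤ a + δ ∨ b - δ ≤ x → φ x = 0 := by
  rcases (tsupport φ).eq_empty_or_nonempty with he | hne
  · refine ⟨1, one_pos, fun x _ => image_eq_zero_of_notMem_tsupport ?_⟩
    rw [he]; simp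
  · have hc : IsCompact (tsupport φ) := h.2.1
    obtain ⟨m, hm, hmin⟩ := hc.exists_isLeast hne
    obtain ⟨M, hM, hmax⟩ := hc.exists_isGreatest hne
    have h1 := h.2.2 hm
    have h2 := h.2.2 hM
    refine ⟨min (m - a) (b - M) / 2, by have := h1.1; have := h2.2; simp; constructor <;> linarith,
      fun x hx => image_eq_zero_of_notMem_tsupport fun hx' => ?_⟩
    have h3 := hmin hx'
    have h4 := hmax hx'
    have h5 := min_le_left (m - a) (b - M)
    have h6 := min_le_right (m - a) (b - M)
    have h7 := h1.1
    have h8 := h2.2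
    have : 0 < min (m - a) (b - M) := lt_min (by linarith) (by linarith)
    rcases hx with hx | hx <;> linarith

theorem sub (h : IsTest a b φ) (h' : IsTest a b ψ) : IsTest a b (φ - ψ) :=
  ⟨h.1.sub h'.1, h.2.1.sub h'.2.1, (tsupport_sub φ ψ).trans (Set.union_subset h.2.2 h'.2.2)⟩

end IsTest

/-! ### Hardy inequalities on an interval and boundedness of extension by zero. -/

theorem gagliardoOn_congr {μ : ℝ} {S : Set ℝ} {f g : ℝ → ℂ}
    (h : f =ᵐ[volume.restrict S] g) : gagliardoOn μ S f = gagliardoOn μ S g := by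
  refine lintegral_congr_ae ?_
  filter_upwards [h] with x hx
  refine lintegral_congr_ae ?_
  filter_upwards [h] with y hy
  rw [hx, hy]

/-- For `μ < 1/2` the half-line inequality needs no boundary condition and is applied to the
extension `v` itself. For `μ > 1/2` it is applied to `φ`, which vanishes near `0`; its Gagliardo
integral over `(0, L)` sees only values shared with `v`. -/
theorem hardy_left {μ : ℝ} (h0 : 0 < μ) (h1 : μ < 1) (hμ : μ ≠ 1 / 2) : ∃ C : ℝ≥0,
    ∀ (L : ℝ) (φ : ℝ → ℂ), IsTest 0 L φ → ∀ v : L2, v =ᵐ[volume.restrict (Set.Ioo 0 L)] φ →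
    ∫⁻ x in Set.Ioo 0 L, ENNReal.ofReal (x ^ (-2 * μ)) * ‖φ x‖ₑ ^ 2 ≤ C * frSemi μ v ^ 2 := by
  have hc := gagliardoConst_ne_top h0 h1
  have key : ∃ C : ℝ≥0, ∀ (L : ℝ) (φ : ℝ → ℂ), IsTest 0 L φ → ∀ v : L2,
      v =ᵐ[volume.restrict (Set.Ioo 0 L)] φ →
      ∫⁻ x in Set.Ioo 0 L, ENNReal.ofReal (x ^ (-2 * μ)) * ‖φ x‖ₑ ^ 2 ≤ C * gagliardo μ v := by
    rcases lt_or_gt_of_ne hμ with h | h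
    · obtain ⟨C, hC⟩ := hardy_of_lt h0 h
      refine ⟨C, fun L φ hφ v hv => ?_⟩
      have e : ∫⁻ x in Set.Ioo 0 L, ENNReal.ofReal (x ^ (-2 * μ)) * ‖φ x‖ₑ ^ 2 =
          ∫⁻ x in Set.Ioo 0 L, ENNReal.ofReal (x ^ (-2 * μ)) * ‖v x‖ₑ ^ 2 := by
        refine lintegral_congr_ae ?_
        filter_upwards [hv] with x hx
        rw [hx]
      rw [e]
      refine (lintegral_mono_set Set.Ioo_subset_Ioi_self).trans
        ((hC v (Lp.stronglyMeasurable v).measurable (Lp.memLp v)).trans ?_)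
      gcongr
      exact gagliardoOn_le _ _ _
    · obtain ⟨C, hC⟩ := hardy_of_gt h
      refine ⟨C, fun L φ hφ v hv => ?_⟩
      obtain ⟨δ, hδ, hz⟩ := hφ.exists_margin
      refine (hC L δ φ hδ hφ.continuous.measurable (fun x hx => hz x (Or.inl (by linarith)))
        hφ.memLp).trans ?_
      gcongr
      rw [← gagliardoOn_congr hv]
      exact gagliardoOn_le _ _ _
  obtain ⟨C, hC⟩ := key
  refine ⟨C * (gagliardoConst μ).toNNReal, fun L φ hφ v hv => (hC L φ hφ v hv).trans ?_⟩
  rw [gagliardo_eq h0 h1 (Lp.stronglyMeasurable v).measurable (ae_eq_refl _), ENNReal.coe_mul,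
    ENNReal.coe_toNNReal hc, mul_assoc]

theorem ae_restrict_comp_const_sub {a b c : ℝ} {f g : ℝ → ℂ}
    (h : f =ᵐ[volume.restrict (Set.Ioo a b)] g) :
    (fun x => f (c - x)) =ᵐ[volume.restrict (Set.Ioo (c - b) (c - a))] fun x => g (c - x) := by
  have h' := (ae_restrict_iff' measurableSet_Ioo).1 h
  have h2 := (Measure.measurePreserving_sub_left volume c).quasiMeasurePreserving.ae h'
  refine (ae_restrict_iff' measurableSet_Ioo).2 ?_
  filter_upwards [h2] with x hx hx'
  exact hx ⟨by linarith [hx'.2], by linarith [hx'.1]⟩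

theorem ae_restrict_comp_add {a b c : ℝ} {f g : ℝ → ℂ}
    (h : f =ᵐ[volume.restrict (Set.Ioo a b)] g) :
    (fun x => f (x + c)) =ᵐ[volume.restrict (Set.Ioo (a - c) (b - c))] fun x => g (x + c) := by
  have h' := (ae_restrict_iff' measurableSet_Ioo).1 h
  have h2 := (measurePreserving_add_right volume c).quasiMeasurePreserving.ae h'
  refine (ae_restrict_iff' measurableSet_Ioo).2 ?_
  filter_upwards [h2] with x hx hx'
  exact hx ⟨by linarith [hx'.1], by linarith [hx'.2]⟩

theorem setLIntegral_comp_const_sub (c a b : ℝ) (F : ℝ → ℝ≥0∞) :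
    ∫⁻ x in Set.Ioo (c - b) (c - a), F (c - x) = ∫⁻ x in Set.Ioo a b, F x := by
  have := (Measure.measurePreserving_sub_left volume c).setLIntegral_comp_emb
    (MeasurableEquiv.subLeft c).measurableEmbedding F (Set.Ioo (c - b) (c - a))
  simpa using this

theorem hardy_right {μ : ℝ} (h0 : 0 < μ) (h1 : μ < 1) (hμ : μ ≠ 1 / 2) : ∃ C : ℝ≥0,
    ∀ (L : ℝ) (φ : ℝ → ℂ), IsTest 0 L φ → ∀ v : L2, v =ᵐ[volume.restrict (Set.Ioo 0 L)] φ →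
    ∫⁻ x in Set.Ioo 0 L, ENNReal.ofReal ((L - x) ^ (-2 * μ)) * ‖φ x‖ₑ ^ 2 ≤
      C * frSemi μ v ^ 2 := by
  obtain ⟨C, hC⟩ := hardy_left h0 h1 hμ
  refine ⟨C, fun L φ hφ v hv => ?_⟩
  set w : L2 := Lp.compMeasurePreserving (fun x : ℝ => L - x) (Measure.measurePreserving_sub_left volume L) v
  have hw : w =ᵐ[volume] fun x => v (L - x) := Lp.coeFn_compMeasurePreserving _ _
  have hφ' := hφ.comp_const_sub L
  have hv' := ae_restrict_comp_const_sub (c := L) hv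
  rw [sub_self, sub_zero] at hφ' hv'
  have := hC L _ hφ' w ((hw.filter_mono (ae_mono Measure.restrict_le_self)).trans hv')
  rw [frSemi_comp_const_sub μ hw] at this
  refine le_trans (le_of_eq ?_) this
  rw [← setLIntegral_comp_const_sub L 0 L]
  simp

/-- Outside `(0, L)` one has `|y - x| ≥ d`, the distance from `x` to the boundary, and the tail
integral `2∫_d^∞ s^(-1-2μ) ds` equals `d^(-2μ) / μ`. -/
theorem lintegral_compl_Ioo_le {μ : ℝ} (h0 : 0 < μ) {L x : ℝ} (hx : x ∈ Set.Ioo 0 L) :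
    ∫⁻ y in (Set.Ioo 0 L)ᶜ, ENNReal.ofReal (|y - x| ^ (-1 - 2 * μ)) ≤
      ENNReal.ofReal (1 / μ) *
        (ENNReal.ofReal (x ^ (-2 * μ)) + ENNReal.ofReal ((L - x) ^ (-2 * μ))) := by
  set d := min x (L - x) with hd
  have hd0 : 0 < d := lt_min hx.1 (by linarith [hx.2])
  set F : ℝ → ℝ≥0∞ := (Set.Ici d).indicator fun s => ENNReal.ofReal (s ^ (-1 - 2 * μ)) with hF
  calc _ ≤ ∫⁻ y, F |y - x| := by
        rw [← lintegral_indicator measurableSet_Ioo.compl]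
        refine lintegral_mono fun y => ?_
        by_cases hy : y ∈ (Set.Ioo 0 L)ᶜ
        · have hdy : |y - x| ∈ Set.Ici d := by
            rw [Set.mem_Ici]
            by_contra! hlt
            refine hy ?_
            have h1 := min_le_left x (L - x)
            have h2 := min_le_right x (L - x)
            rw [abs_lt] at hlt
            constructor <;> linarith [hlt.1, hlt.2]
          rw [Set.indicator_of_mem hy, hF, Set.indicator_of_mem hdy]
        · rw [Set.indicator_of_notMem hy]; exact zero_le
    _ = ∫⁻ y, F |y| := lintegral_sub_right_eq_self (fun y => F |y|) x
    _ ≤ 2 * ∫⁻ s in Set.Ioi 0, F s := lintegral_comp_abs_le F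
    _ ≤ 2 * ∫⁻ s in Set.Ioi d, ENNReal.ofReal (s ^ (-1 - 2 * μ)) := by
        refine mul_le_mul' le_rfl ((setLIntegral_le_lintegral _ _).trans ?_)
        rw [hF, lintegral_indicator measurableSet_Ici, setLIntegral_congr Ioi_ae_eq_Ici]
    _ = ENNReal.ofReal (1 / μ) * ENNReal.ofReal (d ^ (-2 * μ)) := by
        rw [← ofReal_integral_eq_lintegral_ofReal
          (integrableOn_Ioi_rpow_of_lt (by linarith) hd0)
          ((ae_restrict_iff' measurableSet_Ioi).2 (Eventually.of_forall fun s hs =>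
            Real.rpow_nonneg (hd0.trans hs).le _)),
          integral_Ioi_rpow_of_lt (by linarith) hd0, ← ENNReal.ofReal_mul (by positivity),
          show (2 : ℝ≥0∞) = ENNReal.ofReal 2 by simp, ← ENNReal.ofReal_mul (by norm_num)]
        congr 1
        rw [show -1 - 2 * μ + 1 = -2 * μ by ring]
        field_simp
    _ ≤ _ := by
        gcongr
        rcases min_choice x (L - x) with h | h
        · rw [hd, h]; exact le_self_add
        · rw [hd, h]; exact le_add_self

/-- Split `ℝ × ℝ` along `Ω` and its complement: the outer block vanishes, the two mixed blocks agree
by symmetry, and in a mixed block `|φ y - φ x|² = |φ x|²`, so the `y`-integral gives the Hardy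
weights. -/
theorem gagliardo_le_of_support {μ : ℝ} (h0 : 0 < μ) {L : ℝ} {φ : ℝ → ℂ} (hm : Measurable φ)
    (hφ : ∀ x ∉ Set.Ioo 0 L, φ x = 0) :
    gagliardo μ φ ≤ gagliardoOn μ (Set.Ioo 0 L) φ + 2 * (ENNReal.ofReal (1 / μ) *
      ((∫⁻ x in Set.Ioo 0 L, ENNReal.ofReal (x ^ (-2 * μ)) * ‖φ x‖ₑ ^ 2) +
       ∫⁻ x in Set.Ioo 0 L, ENNReal.ofReal ((L - x) ^ (-2 * μ)) * ‖φ x‖ₑ ^ 2)) := by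
  set Ω := Set.Ioo 0 L
  have hΩ : MeasurableSet Ω := measurableSet_Ioo
  set K : ℝ → ℝ → ℝ≥0∞ := fun x y => ENNReal.ofReal (|y - x| ^ (-1 - 2 * μ)) * ‖φ y - φ x‖ₑ ^ 2
    with hK
  have hKm : Measurable (Function.uncurry K) := by simp only [hK]; fun_prop
  have hKs : ∀ x y, K x y = K y x := fun x y => by
    simp only [hK, abs_sub_comm y x, ← edist_eq_enorm_sub, edist_comm (φ y)]
  have hmix : ∫⁻ x in Ω, ∫⁻ y in Ωᶜ, K x y ≤ ENNReal.ofReal (1 / μ) *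
      ((∫⁻ x in Ω, ENNReal.ofReal (x ^ (-2 * μ)) * ‖φ x‖ₑ ^ 2) +
       ∫⁻ x in Ω, ENNReal.ofReal ((L - x) ^ (-2 * μ)) * ‖φ x‖ₑ ^ 2) := by
    rw [← lintegral_add_left (by fun_prop), ← lintegral_const_mul' _ _ ENNReal.ofReal_ne_top]
    refine setLIntegral_mono' hΩ fun x hx => ?_
    have e : ∫⁻ y in Ωᶜ, K x y =
        (∫⁻ y in Ωᶜ, ENNReal.ofReal (|y - x| ^ (-1 - 2 * μ))) * ‖φ x‖ₑ ^ 2 := by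
      rw [← lintegral_mul_const' _ _ (by finiteness)]
      refine setLIntegral_congr_fun hΩ.compl fun y hy => ?_
      simp [hK, hφ y hy]
    rw [e, ← add_mul, ← mul_assoc]
    exact mul_le_mul' (lintegral_compl_Ioo_le h0 hx) le_rfl
  have hmix' : ∫⁻ x in Ωᶜ, ∫⁻ y in Ω, K x y = ∫⁻ x in Ω, ∫⁻ y in Ωᶜ, K x y := by
    rw [lintegral_lintegral_swap hKm.aemeasurable]
    simp_rw [hKs]
  have hzero : ∫⁻ x in Ωᶜ, ∫⁻ y in Ωᶜ, K x y = 0 := by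
    refine (setLIntegral_congr_fun hΩ.compl fun x hx => ?_).trans lintegral_zero
    refine (setLIntegral_congr_fun hΩ.compl fun y hy => ?_).trans lintegral_zero
    simp [hK, hφ x hx, hφ y hy]
  have hsplit : gagliardo μ φ = (∫⁻ x in Ω, ∫⁻ y in Ω, K x y) + (∫⁻ x in Ω, ∫⁻ y in Ωᶜ, K x y) +
      ((∫⁻ x in Ωᶜ, ∫⁻ y in Ω, K x y) + ∫⁻ x in Ωᶜ, ∫⁻ y in Ωᶜ, K x y) := by
    rw [← lintegral_add_left hKm.lintegral_prod_right,
      ← lintegral_add_left hKm.lintegral_prod_right]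
    simp_rw [lintegral_add_compl _ hΩ]
    rfl
  rw [hsplit, hzero, hmix', add_zero, add_assoc, ← two_mul]
  gcongr
  rfl

/-- Jordan's inequality for `|e(t) - 1| = 2|sin πt|`. -/
theorem norm_fourierChar_sub_one_ge {t : ℝ} (ht : |t| ≤ 1 / 2) :
    4 * |t| ≤ ‖(Real.fourierChar t : ℂ) - 1‖ := by
  have h := Real.mul_abs_le_abs_sin (x := Real.pi * t) (by
    rw [abs_mul, abs_of_pos Real.pi_pos]; nlinarith [Real.pi_pos])
  have e : ‖(Real.fourierChar t : ℂ) - 1‖ = 2 * |Real.sin (Real.pi * t)| := by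
    rw [Real.fourierChar_apply, mul_comm _ Complex.I, Complex.norm_exp_I_mul_ofReal_sub_one,
      norm_mul, Real.norm_eq_abs, Real.norm_eq_abs, abs_two]
    congr 3; ring
  rw [e]
  rw [abs_mul, abs_of_pos Real.pi_pos] at h
  have : 2 / Real.pi * (Real.pi * |t|) = 2 * |t| := by field_simp
  linarith

theorem lintegral_translate_sub_sq_le (v : L2) (h : ℝ) :
    ∫⁻ x, ‖v (x + h) - v x‖ₑ ^ 2 ≤ ENNReal.ofReal (2 * Real.pi * |h|) ^ 2 * frSemi 1 v ^ 2 := by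
  rw [lintegral_translate_sub_sq, frSemi_sq, ← lintegral_const_mul' _ _ (by finiteness)]
  refine lintegral_mono fun ξ => ?_
  rw [← mul_assoc]
  gcongr
  rw [mul_one, Real.rpow_two, ENNReal.ofReal_pow (abs_nonneg _), ← mul_pow,
    ← ENNReal.ofReal_mul (by positivity), ← ofReal_norm]
  gcongr
  refine (norm_fourierChar_sub_one_le _).trans (le_of_eq ?_)
  rw [abs_mul]; ring

theorem IsTest.lintegral_translate {L : ℝ} {φ : ℝ → ℂ} (hφ : IsTest 0 L φ) (h : ℝ) :
    ∫⁻ x, ‖hφ.toL2 (x + h) - hφ.toL2 x‖ₑ ^ 2 = ∫⁻ x, ‖φ (x + h) - φ x‖ₑ ^ 2 := by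
  refine lintegral_congr_ae ?_
  have := (measurePreserving_add_right volume h).quasiMeasurePreserving.ae_eq_comp hφ.coe_toL2
  filter_upwards [hφ.coe_toL2, this] with x h1 h2
  simp only [Function.comp] at h2
  rw [h1, h2]

/-- A Poincaré inequality: translating by the full length `L` moves the support off `(0, L)`, so
`|φ(x)| = |φ(x + L) - φ(x)|` there. -/
theorem IsTest.eLpNorm_le_frSemi_one {L : ℝ} {φ : ℝ → ℂ} (hL : 0 ≤ L) (hφ : IsTest 0 L φ) :
    eLpNorm φ 2 volume ≤ ENNReal.ofReal (2 * Real.pi * L) * frSemi 1 hφ.toL2 := by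
  rw [← ENNReal.pow_le_pow_left_iff two_ne_zero, mul_pow, eLpNorm_two_sq]
  have h := lintegral_translate_sub_sq_le hφ.toL2 L
  rw [hφ.lintegral_translate, abs_of_nonneg hL] at h
  refine le_trans (lintegral_mono fun x => ?_) h
  by_cases hx : x ∈ Set.Ioo 0 L
  · rw [hφ.eq_zero (x := x + L) (fun hx' => by linarith [hx'.2, hx.1]), zero_sub, enorm_neg]
  · rw [hφ.eq_zero hx]; simp

/-- The endpoint `μ = 1`, where no Gagliardo integral is available. For steps `h` below the margin
of the support, the increments of `φ` are increments of `v` or zero; on the Fourier side `|e(hξ) -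
1| ≥ 4h|ξ|` for `|ξ| ≤ 1/(2h)`, and letting `h → 0` exhausts all frequencies. -/
theorem IsTest.frSemi_one_le {L : ℝ} {φ : ℝ → ℂ} (hφ : IsTest 0 L φ) {v : L2}
    (hv : v =ᵐ[volume.restrict (Set.Ioo 0 L)] φ) :
    frSemi 1 hφ.toL2 ≤ ENNReal.ofReal Real.pi * frSemi 1 v := by
  obtain ⟨δ, hδ, hz⟩ := hφ.exists_margin
  have hstep : ∀ h : ℝ, 0 < h → h < δ → ∫⁻ x, ‖φ (x + h) - φ x‖ₑ ^ 2 ≤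
      ENNReal.ofReal (2 * Real.pi * h) ^ 2 * frSemi 1 v ^ 2 := by
    intro h h0 h1
    have h2 := lintegral_translate_sub_sq_le v h
    rw [abs_of_pos h0] at h2
    refine le_trans (lintegral_mono_ae ?_) h2
    have hv' := (ae_restrict_iff' measurableSet_Ioo).1 hv
    have hv2 := (measurePreserving_add_right volume h).quasiMeasurePreserving.ae hv'
    filter_upwards [hv', hv2] with x h3 h4
    -- Either both points lie in `(0, L)`, where `φ = v`, or both lie in the zone within `δ` of the
    -- ends or outside, where `φ` vanishes.
    by_cases hx : 0 < x ∧ x + h < L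
    · rw [h3 ⟨hx.1, by linarith⟩, h4 ⟨by linarith, hx.2⟩]
    · have e1 : φ x = 0 := by
        refine hz x ?_
        by_contra! hh
        exact hx ⟨by linarith, by linarith⟩
      have e2 : φ (x + h) = 0 := by
        refine hz _ ?_
        by_contra! hh
        exact hx ⟨by linarith, by linarith⟩
      simp [e1, e2]
  have hset : ∀ n : ℕ, 0 < 1 / ((n : ℝ) + 1) ∧ 1 / ((n : ℝ) + 1) < δ →
      ∫⁻ ξ in Set.Icc (-((n : ℝ) + 1) / 2) (((n : ℝ) + 1) / 2),
        ENNReal.ofReal (|ξ| ^ (2 * (1 : ℝ))) * ‖(𝓕 hφ.toL2 : L2) ξ‖ₑ ^ 2 ≤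
      (ENNReal.ofReal Real.pi * frSemi 1 v) ^ 2 := by
    intro n hn
    set h := 1 / ((n : ℝ) + 1) with hh
    have h1 := hstep h hn.1 hn.2
    rw [← hφ.lintegral_translate, lintegral_translate_sub_sq] at h1
    have h2 : ENNReal.ofReal (4 * h) ^ 2 *
        ∫⁻ ξ in Set.Icc (-((n : ℝ) + 1) / 2) (((n : ℝ) + 1) / 2),
        ENNReal.ofReal (|ξ| ^ (2 * (1 : ℝ))) * ‖(𝓕 hφ.toL2 : L2) ξ‖ₑ ^ 2 ≤
        ENNReal.ofReal (2 * Real.pi * h) ^ 2 * frSemi 1 v ^ 2 := by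
      refine le_trans ?_ h1
      rw [← lintegral_const_mul' _ _ (by finiteness)]
      refine le_trans (setLIntegral_mono' measurableSet_Icc fun ξ hξ => ?_)
        (setLIntegral_le_lintegral _ _)
      rw [← mul_assoc]
      refine mul_le_mul' ?_ le_rfl
      rw [mul_one, Real.rpow_two, ENNReal.ofReal_pow (abs_nonneg _), ← mul_pow,
        ← ENNReal.ofReal_mul (by linarith [hn.1]), ← ofReal_norm]
      gcongr
      refine le_trans (le_of_eq ?_) (norm_fourierChar_sub_one_ge ?_)
      · rw [abs_mul, abs_of_pos hn.1]; ring
      · rw [abs_mul, abs_of_pos hn.1, hh]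
        have : |ξ| ≤ ((n : ℝ) + 1) / 2 := abs_le.2 ⟨by linarith [hξ.1], hξ.2⟩
        rw [one_div, inv_mul_le_iff₀ (by positivity)]
        linarith
    -- The ratio of the two bounds is `π/2`; the cruder `π` is kept.
    have e : ENNReal.ofReal (2 * Real.pi * h) ≤ ENNReal.ofReal (4 * h) * ENNReal.ofReal Real.pi := by
      rw [← ENNReal.ofReal_mul (by linarith [hn.1])]
      exact ENNReal.ofReal_le_ofReal (by nlinarith [Real.pi_pos, hn.1, mul_pos Real.pi_pos hn.1])
    have h3 : ENNReal.ofReal (4 * h) ^ 2 ≠ 0 := by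
      refine pow_ne_zero _ ?_
      simpa using hn.1
    refine (ENNReal.mul_le_mul_iff_right h3 (by finiteness)).1 (h2.trans ?_)
    rw [← mul_pow, ← mul_pow, ← mul_assoc]
    gcongr
  rw [← ENNReal.pow_le_pow_left_iff two_ne_zero, frSemi_sq]
  have hU : (Set.univ : Set ℝ) = ⋃ n : ℕ, Set.Icc (-((n : ℝ) + 1) / 2) (((n : ℝ) + 1) / 2) := by
    symm
    rw [Set.eq_univ_iff_forall]
    intro x
    obtain ⟨n, hn⟩ := exists_nat_ge (2 * |x|)
    have := abs_le.1 (show |x| ≤ ((n : ℝ) + 1) / 2 by linarith)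
    exact Set.mem_iUnion.2 ⟨n, by linarith [this.1], this.2⟩
  have hmono : Monotone fun n : ℕ => Set.Icc (-((n : ℝ) + 1) / 2) (((n : ℝ) + 1) / 2) := by
    intro m n hmn
    have : (m : ℝ) ≤ n := by exact_mod_cast hmn
    exact Set.Icc_subset_Icc (by linarith) (by linarith)
  rw [← setLIntegral_univ, hU, setLIntegral_iUnion_of_directed _ hmono.directed_le]
  obtain ⟨N, hN⟩ := exists_nat_one_div_lt hδ
  refine iSup_le fun n => ?_
  have hle : ((N : ℕ) : ℝ) ≤ ((max n N : ℕ) : ℝ) := by exact_mod_cast le_max_right n N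
  refine le_trans (lintegral_mono_set (hmono (le_max_left n N))) (hset (max n N) ⟨by positivity, ?_⟩)
  refine lt_of_le_of_lt ?_ hN
  gcongr

/-- Extension by zero is bounded from `H^μ(0, L)` to `H^μ(ℝ)` on test functions. -/
theorem zero_extension_bound_aux {μ L : ℝ} (hL : 0 < L) (h0 : 0 < μ) (h1 : μ ≤ 1)
    (hμ : μ ≠ 1 / 2) : ∃ C : ℝ≥0, ∀ (φ : ℝ → ℂ) (hφ : IsTest 0 L φ) (v : L2),
      v =ᵐ[volume.restrict (Set.Ioo 0 L)] φ →
      eLpNorm φ 2 volume ≤ C * frSemi μ v ∧ frSemi μ hφ.toL2 ≤ C * frSemi μ v := by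
  rcases h1.eq_or_lt with rfl | h1
  · refine ⟨max ((2 * Real.pi * L).toNNReal * Real.pi.toNNReal) Real.pi.toNNReal,
      fun φ hφ v hv => ?_⟩
    have h2 := hφ.frSemi_one_le hv
    have h3 := hφ.eLpNorm_le_frSemi_one hL.le
    constructor
    · refine h3.trans ((mul_le_mul' le_rfl h2).trans ?_)
      rw [← mul_assoc]
      refine mul_le_mul' ?_ le_rfl
      rw [ENNReal.ofReal, ENNReal.ofReal, ← ENNReal.coe_mul]
      exact_mod_cast le_max_left _ _
    · refine h2.trans (mul_le_mul' ?_ le_rfl)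
      rw [ENNReal.ofReal]
      exact_mod_cast le_max_right _ _
  · obtain ⟨C₁, hC₁⟩ := hardy_left h0 h1 hμ
    obtain ⟨C₂, hC₂⟩ := hardy_right h0 h1 hμ
    have hc := gagliardoConst_ne_top h0 h1
    have hc0 := gagliardoConst_ne_zero h0
    -- `D` collects the interior Gagliardo term and the two Hardy terms. In `E` the first entry
    -- serves the `L²` bound, where `x^(-2μ) ≥ L^(-2μ)`, and the second serves the seminorm; the
    -- final constant is the square root of `E`.
    set D : ℝ≥0∞ := gagliardoConst μ + 2 * (ENNReal.ofReal (1 / μ) * (C₁ + C₂)) with hD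
    set E : ℝ≥0∞ := max (ENNReal.ofReal (L ^ (2 * μ)) * C₁) ((gagliardoConst μ)⁻¹ * D) with hE
    have hEt : E ≠ ⊤ := by
      have : (gagliardoConst μ)⁻¹ ≠ ⊤ := ENNReal.inv_ne_top.2 hc0
      have : D ≠ ⊤ := by finiteness
      simp only [hE, ne_eq, max_eq_top]; push Not
      constructor <;> finiteness
    have hsq : ∀ A B : ℝ≥0∞, A ^ 2 ≤ E * B ^ 2 → A ≤ ((E ^ (1 / 2 : ℝ)).toNNReal : ℝ≥0∞) * B := by
      intro A B h
      rw [ENNReal.coe_toNNReal (ENNReal.rpow_ne_top_of_nonneg (by norm_num) hEt),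
        ← ENNReal.pow_le_pow_left_iff two_ne_zero, mul_pow, ← ENNReal.rpow_natCast (E ^ _),
        ← ENNReal.rpow_mul]
      norm_num
      exact h
    refine ⟨_, fun φ hφ v hv => ⟨hsq _ _ ?_, hsq _ _ ?_⟩⟩
    · rw [eLpNorm_two_sq, ← lintegral_add_compl _ (measurableSet_Ioo (a := (0:ℝ)) (b := L))]
      have hz : ∫⁻ x in (Set.Ioo 0 L)ᶜ, ‖φ x‖ₑ ^ 2 = 0 := by
        refine (setLIntegral_congr_fun measurableSet_Ioo.compl fun x hx => ?_).trans lintegral_zero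
        simp [hφ.eq_zero hx]
      rw [hz, add_zero]
      calc ∫⁻ x in Set.Ioo 0 L, ‖φ x‖ₑ ^ 2 ≤ ∫⁻ x in Set.Ioo 0 L, ENNReal.ofReal (L ^ (2 * μ)) *
            (ENNReal.ofReal (x ^ (-2 * μ)) * ‖φ x‖ₑ ^ 2) := by
            refine setLIntegral_mono' measurableSet_Ioo fun x hx => ?_
            rw [← mul_assoc, ← ENNReal.ofReal_mul (by positivity)]
            refine le_mul_of_one_le_left zero_le ?_
            rw [ENNReal.one_le_ofReal, neg_mul, Real.rpow_neg hx.1.le, ← div_eq_mul_inv,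
              one_le_div (Real.rpow_pos_of_pos hx.1 _)]
            exact Real.rpow_le_rpow hx.1.le hx.2.le (by positivity)
        _ ≤ ENNReal.ofReal (L ^ (2 * μ)) * (C₁ * frSemi μ v ^ 2) := by
            rw [lintegral_const_mul' _ _ ENNReal.ofReal_ne_top]
            gcongr
            exact hC₁ L φ hφ v hv
        _ ≤ _ := by
            rw [← mul_assoc]
            gcongr
            exact le_max_left _ _
    · have hg := gagliardo_le_of_support h0 hφ.continuous.measurable (fun x hx => hφ.eq_zero hx)
      rw [gagliardo_eq h0 h1 hφ.continuous.measurable hφ.coe_toL2] at hg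
      have hv1 : gagliardoOn μ (Set.Ioo 0 L) φ ≤ gagliardoConst μ * frSemi μ v ^ 2 := by
        rw [← gagliardoOn_congr hv,
          ← gagliardo_eq h0 h1 (Lp.stronglyMeasurable v).measurable (ae_eq_refl _)]
        exact gagliardoOn_le _ _ _
      have hb : gagliardoConst μ * frSemi μ hφ.toL2 ^ 2 ≤ D * frSemi μ v ^ 2 := by
        refine hg.trans ?_
        rw [hD, add_mul, mul_assoc 2, mul_assoc (ENNReal.ofReal _), add_mul]
        gcongr
        · exact hC₁ L φ hφ v hv
        · exact hC₂ L φ hφ v hv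
      calc _ = (gagliardoConst μ)⁻¹ * (gagliardoConst μ * frSemi μ hφ.toL2 ^ 2) := by
            rw [← mul_assoc, ENNReal.inv_mul_cancel hc0 hc, one_mul]
        _ ≤ (gagliardoConst μ)⁻¹ * (D * frSemi μ v ^ 2) := by gcongr
        _ ≤ _ := by
            rw [← mul_assoc]
            gcongr
            exact le_max_right _ _

/-- Extension by zero is bounded from `H^μ(a, b)` to `H^μ(ℝ)` on test functions. -/
theorem zero_extension_bound {a b μ : ℝ} (hab : a < b) (h0 : 0 < μ) (h1 : μ ≤ 1)
    (hμ : μ ≠ 1 / 2) : ∃ C : ℝ≥0, ∀ (φ : ℝ → ℂ) (hφ : IsTest a b φ) (v : L2),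
      v =ᵐ[volume.restrict (Set.Ioo a b)] φ →
      eLpNorm φ 2 volume ≤ C * frSemi μ v ∧ frSemi μ hφ.toL2 ≤ C * frSemi μ v := by
  obtain ⟨C, hC⟩ := zero_extension_bound_aux (sub_pos.2 hab) h0 h1 hμ
  refine ⟨C, fun φ hφ v hv => ?_⟩
  set w : L2 := Lp.compMeasurePreserving (fun x : ℝ => x + a) (measurePreserving_add_right volume a) v
  have hw : w =ᵐ[volume] fun x => v (x + a) := Lp.coeFn_compMeasurePreserving _ _
  have hφ' := hφ.comp_add a
  have hv' := ae_restrict_comp_add (c := a) hv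
  rw [sub_self] at hφ' hv'
  have h := hC _ hφ' w ((hw.filter_mono (ae_mono Measure.restrict_le_self)).trans hv')
  have e1 : eLpNorm (fun x => φ (x + a)) 2 volume = eLpNorm φ 2 volume :=
    eLpNorm_comp_measurePreserving hφ.continuous.aestronglyMeasurable
      (measurePreserving_add_right volume a)
  have e2 : frSemi μ hφ'.toL2 = frSemi μ hφ.toL2 := by
    refine frSemi_translate (h := a) μ (hφ'.coe_toL2.trans ?_)
    exact ((measurePreserving_add_right volume a).quasiMeasurePreserving.ae_eq_comp
      hφ.coe_toL2).symm
  rwa [e1, e2, frSemi_translate μ hw] at h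

/-! ### Convolution and the transform of the tempered kernel. -/

/-- Convolution of complex functions on the line. -/
def conv (K f : ℝ → ℂ) (x : ℝ) : ℂ := ∫ s, K s * f (x - s)

open scoped Convolution in
theorem conv_eq_complex (K f : ℝ → ℂ) :
    conv K f = K ⋆[ContinuousLinearMap.mul ℂ ℂ, volume] f := rfl

open scoped Convolution in
theorem conv_eq_real (K f : ℝ → ℂ) :
    conv K f = K ⋆[ContinuousLinearMap.mul ℝ ℂ, volume] f := rfl

theorem integrable_conv {K f : ℝ → ℂ} (hK : Integrable K) (hf : Integrable f) :
    Integrable (conv K f) := by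
  rw [conv_eq_complex]; exact hK.integrable_convolution _ hf

theorem norm_conv_le {K f : ℝ → ℂ} (hK : Integrable K) {M : ℝ} (hf : ∀ x, ‖f x‖ ≤ M) (x : ℝ) :
    ‖conv K f x‖ ≤ (∫ s, ‖K s‖) * M := by
  rw [← integral_mul_const]
  refine norm_integral_le_of_norm_le (hK.norm.mul_const M) (Eventually.of_forall fun s => ?_)
  rw [norm_mul]
  exact mul_le_mul_of_nonneg_left (hf _) (norm_nonneg _)

theorem memLp_two_of_bounded {f : ℝ → ℂ} (hf : Integrable f) {M : ℝ} (hM : ∀ x, ‖f x‖ ≤ M) :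
    MemLp f 2 volume := by
  rw [memLp_two_iff_integrable_sq_norm hf.aestronglyMeasurable]
  refine (hf.norm.const_mul M).mono' (hf.aestronglyMeasurable.norm.pow 2)
    (Eventually.of_forall fun x => ?_)
  rw [Real.norm_of_nonneg (by positivity), sq]
  exact mul_le_mul_of_nonneg_right (hM x) (norm_nonneg _)

theorem fourier_conv {K f : ℝ → ℂ} (hK : Integrable K) (hf : Integrable f) (ξ : ℝ) :
    𝓕 (conv K f) ξ = 𝓕 K ξ * 𝓕 f ξ := by
  rw [conv_eq_complex]; exact Real.fourier_mul_convolution_eq hK hf ξ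

theorem norm_fourier_le (K : ℝ → ℂ) (ξ : ℝ) : ‖𝓕 K ξ‖ ≤ ∫ s, ‖K s‖ :=
  VectorFourier.norm_fourierIntegral_le_integral_norm _ _ _ _ _

theorem eLpNorm_le_of_pointwise {f g : ℝ → ℂ} {C : ℝ≥0} (h : ∀ᵐ x, ‖f x‖ ≤ C * ‖g x‖) :
    eLpNorm f 2 volume ≤ C * eLpNorm g 2 volume :=
  eLpNorm_le_nnreal_smul_eLpNorm_of_ae_le_mul h 2

theorem frSemi_conv_le {K f : ℝ → ℂ} (hK : Integrable K) (hf : Integrable f)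
    (hf2 : MemLp f 2 volume) (hKf : MemLp (conv K f) 2 volume) {α : ℝ} {C : ℝ≥0}
    (hC : ∀ ξ, |ξ| ^ α * ‖𝓕 K ξ‖ ≤ C) :
    frSemi α (hKf.toLp _) ≤ C * eLpNorm f 2 volume := by
  have e : eLpNorm f 2 volume = eLpNorm (𝓕 (hf2.toLp f) : L2) 2 volume := by
    rw [eLpNorm_fourier, eLpNorm_congr_ae hf2.coeFn_toLp]
  rw [e, frSemi]
  refine eLpNorm_le_of_pointwise ?_
  filter_upwards [fourier_toLp_ae_eq (integrable_conv hK hf) hKf, fourier_toLp_ae_eq hf hf2]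
    with ξ h1 h2
  rw [h1, h2, fourier_conv hK hf, norm_mul, norm_mul, ← mul_assoc, Complex.norm_real,
    Real.norm_of_nonneg (by positivity)]
  exact mul_le_mul_of_nonneg_right (hC ξ) (norm_nonneg _)

/-- The tempered fractional integration kernel of order `ν`, truncated to `(0, L)`. -/
def temperedKernel (ν lam L : ℝ) : ℝ → ℂ :=
  (Set.Ioo 0 L).indicator fun s =>
    ((s ^ (ν - 1) * Real.exp (-lam * s) / Real.Gamma ν : ℝ) : ℂ)

theorem integrableOn_rpow_Ioo {ν L : ℝ} (hν : 0 < ν) :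
    IntegrableOn (fun s : ℝ => s ^ (ν - 1)) (Set.Ioo 0 L) := by
  rcases le_or_gt L 0 with h | h
  · rw [Set.Ioo_eq_empty (not_lt.2 h)]; exact integrableOn_empty
  have := intervalIntegral.intervalIntegrable_rpow' (a := 0) (b := L) (r := ν - 1) (by linarith)
  rw [intervalIntegrable_iff_integrableOn_Ioc_of_le h.le] at this
  exact this.mono_set Set.Ioo_subset_Ioc_self

theorem integrable_temperedKernel {ν lam L : ℝ} (hν : 0 < ν) (hlam : 0 ≤ lam) :
    Integrable (temperedKernel ν lam L) := by
  rw [temperedKernel, integrable_indicator_iff measurableSet_Ioo]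
  refine Integrable.ofReal ?_
  refine Integrable.div_const ?_ _
  refine Integrable.mono' (integrableOn_rpow_Ioo hν) (by fun_prop) ?_
  refine (ae_restrict_iff' measurableSet_Ioo).2 (Eventually.of_forall fun s hs => ?_)
  rw [norm_mul, Real.norm_of_nonneg (Real.rpow_nonneg hs.1.le _), Real.norm_of_nonneg
    (Real.exp_nonneg _)]
  refine mul_le_of_le_one_right (Real.rpow_nonneg hs.1.le _) ?_
  rw [Real.exp_le_one_iff]
  nlinarith [hs.1]

/-- Integrate the exponential by parts: the boundary terms cost `g L + g δ`, and the total variation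
of the decreasing `g` costs `g δ - g L`. -/
theorem norm_integral_oscillatory_le {g g' : ℝ → ℝ} {δ L κ : ℝ} (hδ : δ ≤ L) (hκ : κ ≠ 0)
    (hg : ∀ s ∈ Set.Icc δ L, HasDerivAt g (g' s) s) (hg' : ContinuousOn g' (Set.Icc δ L))
    (hneg : ∀ s ∈ Set.Icc δ L, g' s ≤ 0) (hL : 0 ≤ g L) :
    ‖∫ s in δ..L, (g s : ℂ) * Complex.exp (Complex.I * κ * s)‖ ≤ 2 * g δ / |κ| := by
  have hI : Complex.I * κ ≠ 0 := mul_ne_zero Complex.I_ne_zero (by exact_mod_cast hκ)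
  set E : ℝ → ℂ := fun s => Complex.exp (Complex.I * κ * s) / (Complex.I * κ) with hE
  have hEn : ∀ s, ‖E s‖ = 1 / |κ| := by
    intro s
    simp only [hE]
    rw [norm_div, norm_mul, Complex.norm_I, one_mul, Complex.norm_real, Real.norm_eq_abs]
    congr 1
    rw [mul_assoc, mul_comm, ← Complex.ofReal_mul, Complex.norm_exp_ofReal_mul_I]
  have hEd : ∀ s : ℝ, HasDerivAt E (Complex.exp (Complex.I * κ * s)) s := by
    intro s
    have h1 : HasDerivAt (fun s : ℝ => Complex.I * κ * (s : ℂ)) (Complex.I * κ) s := by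
      simpa using (Complex.ofRealCLM.hasDerivAt (x := s)).const_mul (Complex.I * κ)
    have := (h1.cexp).div_const (Complex.I * κ)
    rwa [mul_div_assoc, div_self hI, mul_one] at this
  have hint : IntervalIntegrable g' volume δ L :=
    ContinuousOn.intervalIntegrable (by rwa [Set.uIcc_of_le hδ])
  have hparts := intervalIntegral.integral_mul_deriv_eq_deriv_mul (a := δ) (b := L)
    (u := fun s => (g s : ℂ)) (u' := fun s => (g' s : ℂ)) (v := E)
    (v' := fun s => Complex.exp (Complex.I * κ * s))
    (fun s hs => (hg s (by rwa [Set.uIcc_of_le hδ] at hs)).ofReal_comp) (fun s _ => hEd s)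
    ⟨hint.1.ofReal, hint.2.ofReal⟩ (Continuous.intervalIntegrable (by fun_prop) _ _)
  rw [hparts]
  have hftc : ∫ s in δ..L, g' s = g L - g δ :=
    intervalIntegral.integral_eq_sub_of_hasDerivAt
      (fun s hs => hg s (by rwa [Set.uIcc_of_le hδ] at hs)) hint
  have h1 : ‖∫ s in δ..L, (g' s : ℂ) * E s‖ ≤ (g δ - g L) / |κ| := by
    have : ∫ s in δ..L, -g' s * (1 / |κ|) = (g δ - g L) / |κ| := by
      rw [intervalIntegral.integral_mul_const, intervalIntegral.integral_neg, hftc]; ring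
    rw [← this]
    refine intervalIntegral.norm_integral_le_of_norm_le hδ ?_ (hint.neg.mul_const _)
    refine Eventually.of_forall fun s hs => ?_
    rw [norm_mul, hEn, Complex.norm_real, Real.norm_of_nonpos (hneg s ⟨hs.1.le, hs.2⟩)]
  have hgδ : g L ≤ g δ := by
    have : ∫ s in δ..L, g' s ≤ 0 := by
      rw [intervalIntegral.integral_of_le hδ]
      exact setIntegral_nonpos measurableSet_Ioc fun s hs => hneg s ⟨hs.1.le, hs.2⟩
    linarith
  calc _ ≤ ‖(g L : ℂ) * E L‖ + ‖(g δ : ℂ) * E δ‖ + ‖∫ s in δ..L, (g' s : ℂ) * E s‖ :=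
        (norm_sub_le _ _).trans (add_le_add (norm_sub_le _ _) le_rfl)
    _ ≤ g L / |κ| + g δ / |κ| + (g δ - g L) / |κ| := by
        refine add_le_add (add_le_add (le_of_eq ?_) (le_of_eq ?_)) h1
        · rw [norm_mul, hEn, Complex.norm_real, Real.norm_of_nonneg hL]; ring
        · rw [norm_mul, hEn, Complex.norm_real, Real.norm_of_nonneg (hL.trans hgδ)]; ring
    _ = _ := by ring

/-- Up to `s = 1/|ξ|` the kernel is integrated absolutely, giving `|ξ|^(-ν) / ν`. Beyond, it is
decreasing (`ν ≤ 1`, `λ ≥ 0`) and the oscillatory bound gives at most `|ξ|^(-ν)`. -/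
theorem norm_fourier_temperedKernel_le {ν lam L : ℝ} (hν0 : 0 < ν) (hν1 : ν ≤ 1) (hlam : 0 ≤ lam)
    (hL : 0 < L) : ∃ C : ℝ≥0, ∀ ξ : ℝ, |ξ| ^ ν * ‖𝓕 (temperedKernel ν lam L) ξ‖ ≤ C := by
  set g : ℝ → ℝ := fun s => s ^ (ν - 1) * Real.exp (-lam * s) with hg
  have hΓ := Real.Gamma_pos_of_pos hν0
  have hgle : ∀ s, 0 < s → g s ≤ s ^ (ν - 1) := by
    intro s hs
    refine mul_le_of_le_one_right (Real.rpow_nonneg hs.le _) ?_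
    rw [Real.exp_le_one_iff]
    nlinarith
  have hg0 : ∀ s, 0 < s → 0 ≤ g s := fun s hs =>
    mul_nonneg (Real.rpow_nonneg hs.le _) (Real.exp_nonneg _)
  refine ⟨NNReal.mk ((1 / ν + 1) / Real.Gamma ν) (by positivity), fun ξ => ?_⟩
  rw [NNReal.coe_mk]
  rcases eq_or_ne ξ 0 with rfl | hξ
  · rw [abs_zero, Real.zero_rpow hν0.ne', zero_mul]; positivity
  have hξ0 : 0 < |ξ| := abs_pos.2 hξ
  set κ : ℝ := -(2 * Real.pi * ξ) with hκ
  have hκ0 : κ ≠ 0 := neg_ne_zero.2 (mul_ne_zero (by positivity) hξ)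
  have hκa : |κ| = 2 * Real.pi * |ξ| := by
    rw [hκ, abs_neg, abs_mul, abs_of_pos Real.two_pi_pos]
  have hF : 𝓕 (temperedKernel ν lam L) ξ =
      (Real.Gamma ν : ℂ)⁻¹ * ∫ s in (0:ℝ)..L, (g s : ℂ) * Complex.exp (Complex.I * κ * s) := by
    rw [Real.fourier_eq', intervalIntegral.integral_of_le hL.le, integral_Ioc_eq_integral_Ioo,
      ← integral_indicator measurableSet_Ioo, ← integral_const_mul]
    refine integral_congr_ae (Eventually.of_forall fun s => ?_)
    simp only [temperedKernel, Set.indicator_apply]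
    split_ifs with hs
    · have hin : inner ℝ s ξ = ξ * s := by simp
      simp only [hg, hκ, smul_eq_mul, hin]
      push_cast
      rw [div_eq_mul_inv, mul_comm (Complex.exp _), mul_comm _ (Complex.ofReal (Real.Gamma ν))⁻¹,
        mul_assoc]
      congr 3
      ring_nf
    · simp
  set δ := min (1 / |ξ|) L with hδ
  have hδ0 : 0 < δ := lt_min (by positivity) hL
  have hδL : δ ≤ L := min_le_right _ _
  have hδξ : δ ^ ν ≤ |ξ| ^ (-ν) := by
    rw [Real.rpow_neg hξ0.le, ← Real.inv_rpow hξ0.le, ← one_div]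
    exact Real.rpow_le_rpow hδ0.le (min_le_left _ _) hν0.le
  have hii : ∀ x y : ℝ, IntervalIntegrable (fun s : ℝ => s ^ (ν - 1)) volume x y :=
    fun x y => intervalIntegral.intervalIntegrable_rpow' (by linarith)
  have hint : ∀ x y : ℝ, IntervalIntegrable
      (fun s : ℝ => (g s : ℂ) * Complex.exp (Complex.I * κ * s)) volume x y := by
    intro x y
    refine IntervalIntegrable.mul_continuousOn ?_ (by fun_prop)
    have h : IntervalIntegrable g volume x y := (hii x y).mul_continuousOn (by fun_prop)
    exact ⟨h.1.ofReal, h.2.ofReal⟩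
  have hnorm : ∀ s, 0 < s → ‖(g s : ℂ) * Complex.exp (Complex.I * κ * s)‖ = g s := by
    intro s hs
    rw [mul_assoc, mul_comm Complex.I, ← Complex.ofReal_mul, norm_mul,
      Complex.norm_exp_ofReal_mul_I, mul_one, Complex.norm_real, Real.norm_of_nonneg (hg0 s hs)]
  have h1 : ‖∫ s in (0:ℝ)..δ, (g s : ℂ) * Complex.exp (Complex.I * κ * s)‖ ≤ |ξ| ^ (-ν) / ν := by
    have e : ∫ s in (0:ℝ)..δ, s ^ (ν - 1) = δ ^ ν / ν := by
      rw [integral_rpow (Or.inl (by linarith))]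
      rw [sub_add_cancel, Real.zero_rpow hν0.ne', sub_zero]
    calc _ ≤ ∫ s in (0:ℝ)..δ, s ^ (ν - 1) := by
          refine intervalIntegral.norm_integral_le_of_norm_le hδ0.le ?_ (hii _ _)
          refine Eventually.of_forall fun s hs => ?_
          rw [hnorm s hs.1]; exact hgle s hs.1
      _ = δ ^ ν / ν := e
      _ ≤ _ := by gcongr
  have h2 : ‖∫ s in δ..L, (g s : ℂ) * Complex.exp (Complex.I * κ * s)‖ ≤ |ξ| ^ (-ν) := by
    rcases le_total L (1 / |ξ|) with h | h
    · have : δ = L := min_eq_right h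
      rw [this, intervalIntegral.integral_same, norm_zero]; positivity
    · have hδe : δ = 1 / |ξ| := min_eq_left h
      have hd : ∀ s ∈ Set.Icc δ L, HasDerivAt g ((ν - 1) * s ^ (ν - 1 - 1) * Real.exp (-lam * s) +
          s ^ (ν - 1) * (Real.exp (-lam * s) * (-lam))) s := by
        intro s hs
        have hs0 : 0 < s := hδ0.trans_le hs.1
        have e1 := Real.hasDerivAt_rpow_const (x := s) (p := ν - 1) (Or.inl hs0.ne')
        have e2 : HasDerivAt (fun s : ℝ => Real.exp (-lam * s)) (Real.exp (-lam * s) * (-lam)) s := by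
          have : HasDerivAt (fun s : ℝ => -lam * s) (-lam) s := by
            simpa using (hasDerivAt_id s).const_mul (-lam)
          exact this.exp
        exact e1.mul e2
      have hb := norm_integral_oscillatory_le (g := g) hδL hκ0 hd ?_ ?_ (hg0 L hL)
      · refine hb.trans ?_
        have h3 := hgle δ hδ0
        rw [hκa, div_le_iff₀ (by positivity)]
        have e3 : δ ^ (ν - 1) = |ξ| ^ (-ν) * |ξ| := by
          rw [hδe, one_div, Real.inv_rpow hξ0.le, ← Real.rpow_neg hξ0.le]
          nth_rewrite 3 [← Real.rpow_one |ξ|]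
          rw [← Real.rpow_add hξ0]; congr 1; ring
        rw [e3] at h3
        have h4 : 0 ≤ |ξ| ^ (-ν) * |ξ| := by positivity
        nlinarith [Real.pi_gt_three]
      · refine ContinuousOn.add (ContinuousOn.mul (ContinuousOn.mul continuousOn_const ?_) ?_)
          (ContinuousOn.mul ?_ (by fun_prop))
        · exact continuousOn_id.rpow_const fun s hs => Or.inl (hδ0.trans_le hs.1).ne'
        · fun_prop
        · exact continuousOn_id.rpow_const fun s hs => Or.inl (hδ0.trans_le hs.1).ne'
      · intro s hs
        have hs0 : 0 < s := hδ0.trans_le hs.1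
        have p1 := Real.rpow_nonneg hs0.le (ν - 1)
        have p2 := Real.rpow_nonneg hs0.le (ν - 1 - 1)
        have p3 := Real.exp_nonneg (-lam * s)
        have q1 : 0 ≤ (1 - ν) * (s ^ (ν - 1 - 1) * Real.exp (-lam * s)) :=
          mul_nonneg (by linarith) (mul_nonneg p2 p3)
        have q2 : 0 ≤ lam * (s ^ (ν - 1) * Real.exp (-lam * s)) :=
          mul_nonneg hlam (mul_nonneg p1 p3)
        nlinarith
  rw [hF, ← intervalIntegral.integral_add_adjacent_intervals (hint 0 δ) (hint δ L), norm_mul,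
    norm_inv, Complex.norm_real, Real.norm_of_nonneg hΓ.le]
  have h3 := (norm_add_le (∫ s in (0:ℝ)..δ, (g s : ℂ) * Complex.exp (Complex.I * κ * s))
    (∫ s in δ..L, (g s : ℂ) * Complex.exp (Complex.I * κ * s))).trans (add_le_add h1 h2)
  have e4 : |ξ| ^ ν * |ξ| ^ (-ν) = 1 := by rw [← Real.rpow_add hξ0]; simp
  calc _ ≤ |ξ| ^ ν * ((Real.Gamma ν)⁻¹ * (|ξ| ^ (-ν) / ν + |ξ| ^ (-ν))) := by gcongr
    _ = (|ξ| ^ ν * |ξ| ^ (-ν)) * ((1 / ν + 1) / Real.Gamma ν) := by field_simp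
    _ ≤ _ := by rw [e4, one_mul]

open scoped Convolution in
-- A bounded third factor gives associativity at every point rather than almost everywhere: the
-- triple integrand is dominated by `‖f‖ · ‖g‖₁ · sup ‖k‖`.
theorem conv_assoc {f g k : ℝ → ℂ} (hf : Integrable f) (hg : Integrable g) (hk : Continuous k)
    (hc : HasCompactSupport k) (x : ℝ) : conv f (conv g k) x = conv (conv f g) k x := by
  have hgk : ConvolutionExists (fun x => ‖g x‖) (fun x => ‖k x‖)
      (ContinuousLinearMap.mul ℝ ℝ) volume :=
    hc.norm.convolutionExists_right _ hg.norm.locallyIntegrable hk.norm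
  have hcont : Continuous ((fun x => ‖g x‖) ⋆[ContinuousLinearMap.mul ℝ ℝ, volume] fun x => ‖k x‖) :=
    hc.norm.continuous_convolution_right _ hg.norm.locallyIntegrable hk.norm
  obtain ⟨M, hM⟩ := hk.bounded_above_of_compact_support hc
  refine (convolution_assoc (ContinuousLinearMap.mul ℂ ℂ) (ContinuousLinearMap.mul ℂ ℂ)
    (ContinuousLinearMap.mul ℂ ℂ) (ContinuousLinearMap.mul ℂ ℂ) (fun x y z => mul_assoc x y z)
    hf.aestronglyMeasurable hg.aestronglyMeasurable hk.aestronglyMeasurable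
    (hf.ae_convolution_exists _ hg) (Eventually.of_forall hgk) ?_).symm
  refine Integrable.mono' (hf.norm.mul_const ((∫ s, ‖g s‖) * M)) ?_ (Eventually.of_forall fun s => ?_)
  · exact hf.norm.aestronglyMeasurable.mul (hcont.comp (by fun_prop)).aestronglyMeasurable
  · simp only [ContinuousLinearMap.mul_apply', norm_mul, norm_norm]
    refine mul_le_mul_of_nonneg_left ?_ (norm_nonneg _)
    rw [← integral_mul_const]
    refine norm_integral_le_of_norm_le (hg.norm.mul_const M) (Eventually.of_forall fun t => ?_)
    simp only [ContinuousLinearMap.mul_apply', norm_mul, norm_norm]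
    exact mul_le_mul_of_nonneg_left (hM _) (norm_nonneg _)

theorem hasDerivAt_conv {K ψ : ℝ → ℂ} (hK : Integrable K) (hψ : ContDiff ℝ 1 ψ)
    (hc : HasCompactSupport ψ) (x : ℝ) : HasDerivAt (conv K ψ) (conv K (deriv ψ) x) x := by
  rw [conv_eq_real, conv_eq_real]
  exact hc.hasDerivAt_convolution_right _ hK.locallyIntegrable hψ x

theorem continuous_conv {K ψ : ℝ → ℂ} (hK : Integrable K) (hψ : Continuous ψ)
    (hc : HasCompactSupport ψ) : Continuous (conv K ψ) := by
  rw [conv_eq_real]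
  exact hc.continuous_convolution_right _ hK.locallyIntegrable hψ

/-! ### Tempered derivatives of test functions as convolutions, and their inversion. -/

/-- The first order tempered derivative `φ' + λ φ`. -/
def temperedDeriv (lam : ℝ) (φ : ℝ → ℂ) (x : ℝ) : ℂ := deriv φ x + lam * φ x

namespace IsTest

variable {a b lam : ℝ} {φ ψ : ℝ → ℂ}

theorem differentiable (h : IsTest a b φ) : Differentiable ℝ φ := h.1.differentiable (by simp)

theorem temperedDeriv (h : IsTest a b φ) (lam : ℝ) : IsTest a b (temperedDeriv lam φ) := by
  have h1 : ContDiff ℝ ∞ (deriv φ) := ((contDiff_infty_iff_deriv (f := φ)).1 h.1).2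
  have hs : tsupport (_root_.temperedDeriv lam φ) ⊆ tsupport φ := by
    refine (tsupport_add (deriv φ) (fun x => (lam : ℂ) * φ x)).trans (Set.union_subset ?_ ?_)
    · exact closure_minimal (support_deriv_subset (f := φ)) isClosed_closure
    · exact closure_mono (Function.support_mul_subset_right _ _)
  exact ⟨h1.add (contDiff_const.mul h.1), h.2.1.mono' (subset_closure.trans hs), hs.trans h.2.2⟩

theorem temperedDeriv_sub (h : IsTest a b φ) (h' : IsTest a b ψ) (lam : ℝ) :
    _root_.temperedDeriv lam (φ - ψ) =
      _root_.temperedDeriv lam φ - _root_.temperedDeriv lam ψ := by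
  ext x
  have := deriv_sub h.differentiable.differentiableAt h'.differentiable.differentiableAt (x := x)
  simp only [_root_.temperedDeriv, Pi.sub_apply, this]
  ring

theorem exp_mul (h : IsTest a b φ) (lam : ℝ) :
    IsTest a b fun x => (Real.exp (lam * x) : ℂ) * φ x := by
  have h1 : ContDiff ℝ ∞ fun x : ℝ => (Real.exp (lam * x) : ℂ) :=
    Complex.ofRealCLM.contDiff.comp (Real.contDiff_exp.comp (contDiff_const.mul contDiff_id))
  exact ⟨h1.mul h.1, h.2.1.mul_left,
    (closure_mono (Function.support_mul_subset_right _ _)).trans h.2.2⟩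

theorem deriv_exp_mul (h : IsTest a b φ) (lam x : ℝ) :
    deriv (fun x => (Real.exp (lam * x) : ℂ) * φ x) x =
      (Real.exp (lam * x) : ℂ) * _root_.temperedDeriv lam φ x := by
  have e : HasDerivAt (fun x : ℝ => (Real.exp (lam * x) : ℂ)) ((Real.exp (lam * x) * lam : ℝ) : ℂ) x := by
    have : HasDerivAt (fun x : ℝ => lam * x) lam x := by
      simpa using (hasDerivAt_id x).const_mul lam
    exact this.exp.ofReal_comp
  refine (HasDerivAt.deriv (e.mul (h.differentiable x).hasDerivAt)).trans ?_
  rw [_root_.temperedDeriv]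
  push_cast; ring

end IsTest

/-- Substitute `s = y - ξ`. Truncating the kernel at `b - a` is invisible for `y` in `(a, b)`,
because `ψ(y - s)` vanishes once `s ≥ y - a`. -/
theorem intervalIntegral_eq_conv {a b μ : ℝ} (hμ1 : μ < 1) {ψ : ℝ → ℂ} (hψ : IsTest a b ψ) {y : ℝ}
    (hy : y ∈ Set.Ioo a b) :
    ∫ ξ in a..y, ((1 / (y - ξ) ^ μ : ℝ) : ℂ) * ψ ξ =
      Real.Gamma (1 - μ) * conv (temperedKernel (1 - μ) 0 (b - a)) ψ y := by
  have hΓ := (Real.Gamma_pos_of_pos (sub_pos.2 hμ1)).ne'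
  have h1 := intervalIntegral.integral_comp_sub_left (a := a) (b := y)
    (fun s => ((1 / s ^ μ : ℝ) : ℂ) * ψ (y - s)) y
  simp only [sub_sub_cancel, sub_self] at h1
  rw [h1, intervalIntegral.integral_of_le (by linarith [hy.1]), integral_Ioc_eq_integral_Ioo, conv,
    ← integral_const_mul, ← integral_indicator measurableSet_Ioo]
  refine integral_congr_ae (Eventually.of_forall fun s => ?_)
  simp only [temperedKernel, Set.indicator_apply]
  by_cases hs : s ∈ Set.Ioo 0 (y - a)
  · have hs' : s ∈ Set.Ioo 0 (b - a) := ⟨hs.1, by linarith [hs.2, hy.2]⟩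
    rw [if_pos hs, if_pos hs', ← mul_assoc, ← Complex.ofReal_mul]
    congr 2
    rw [neg_zero, zero_mul, Real.exp_zero, sub_sub_cancel_left, Real.rpow_neg hs.1.le]
    field_simp
  · rw [if_neg hs]
    split_ifs with hs'
    · have : ψ (y - s) = 0 := hψ.eq_zero fun h => hs ⟨hs'.1, by linarith [h.1]⟩
      rw [this]; ring
    · ring

/-- Here `n = 1`, and the derivative falls on the smooth factor `e^(λ·) φ`, whose derivative is
`e^(λ·)(φ' + λφ)`. The identity `e^(-λx) e^(λ(x-s)) = e^(-λs)` moves the exponentials into the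
kernel. -/
theorem leftTemperedRL_eq_conv {a b lam μ : ℝ} (hμ1 : μ < 1) {φ : ℝ → ℂ}
    (hφ : IsTest a b φ) {x : ℝ} (hx : x ∈ Set.Ioo a b) :
    leftTemperedRL a lam μ φ x =
      conv (temperedKernel (1 - μ) lam (b - a)) (temperedDeriv lam φ) x := by
  have hn : ⌊μ⌋₊ = 0 := Nat.floor_eq_zero.2 hμ1
  have hψ := hφ.exp_mul lam
  set ψ : ℝ → ℂ := fun x => (Real.exp (lam * x) : ℂ) * φ x with hψd
  have hΓ := (Real.Gamma_pos_of_pos (sub_pos.2 hμ1)).ne'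
  have hK : Integrable (temperedKernel (1 - μ) 0 (b - a)) :=
    integrable_temperedKernel (by linarith) le_rfl
  have hF : (fun y : ℝ => ∫ ξ in a..y, ((Real.exp (lam * ξ) / (y - ξ) ^ μ : ℝ) : ℂ) * φ ξ) =ᶠ[𝓝 x]
      fun y => Real.Gamma (1 - μ) * conv (temperedKernel (1 - μ) 0 (b - a)) ψ y := by
    filter_upwards [Ioo_mem_nhds hx.1 hx.2] with y hy
    rw [← intervalIntegral_eq_conv hμ1 hψ hy]
    congr 1; ext ξ
    simp only [hψd]
    rw [← mul_assoc, ← Complex.ofReal_mul]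
    congr 2; ring
  have hd : HasDerivAt (fun y => Real.Gamma (1 - μ) * conv (temperedKernel (1 - μ) 0 (b - a)) ψ y)
      (Real.Gamma (1 - μ) * conv (temperedKernel (1 - μ) 0 (b - a)) (deriv ψ) x) x :=
    (hasDerivAt_conv hK (hψ.1.of_le (by exact_mod_cast le_top)) hψ.2.1 x).const_mul _
  simp only [leftTemperedRL, hn, zero_add, Nat.cast_one, iteratedDeriv_one, sub_add_cancel]
  rw [hF.deriv_eq, hd.deriv, ← mul_assoc, ← Complex.ofReal_mul, div_mul_cancel₀ _ hΓ, conv, conv,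
    ← integral_const_mul]
  refine integral_congr_ae (Eventually.of_forall fun s => ?_)
  simp only [hψd, hφ.deriv_exp_mul lam, temperedKernel, Set.indicator_apply]
  split_ifs with hs
  · rw [← mul_assoc, ← mul_assoc, ← Complex.ofReal_mul, ← Complex.ofReal_mul]
    congr 2
    rw [neg_zero, zero_mul, Real.exp_zero, mul_one]
    have : Real.exp (-lam * s) = Real.exp (-lam * x) * Real.exp (lam * (x - s)) := by
      rw [← Real.exp_add]; congr 1; ring
    rw [this]; ring
  · ring

/-- At `μ = 1` the convention `n - 1 ≤ μ < n` forces `n = 2`; the kernel exponent is then `0` and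
`Γ(1) = 1`, leaving the second derivative of a primitive. -/
theorem leftTemperedRL_one {a b lam : ℝ} {φ : ℝ → ℂ} (hφ : IsTest a b φ) (x : ℝ) :
    leftTemperedRL a lam 1 φ x = temperedDeriv lam φ x := by
  have hψ := hφ.exp_mul lam
  set ψ : ℝ → ℂ := fun x => (Real.exp (lam * x) : ℂ) * φ x with hψd
  have e : (fun y : ℝ => ∫ ξ in a..y, ((Real.exp (lam * ξ) /
      (y - ξ) ^ ((1 : ℝ) - ((1 + 1 : ℕ) : ℝ) + 1) : ℝ) : ℂ) * φ ξ) = fun y => ∫ ξ in a..y, ψ ξ := by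
    ext y; congr 1; ext ξ
    norm_num [hψd]
  have hd : deriv (fun y => ∫ ξ in a..y, ψ ξ) = ψ := by
    ext y
    exact hψ.continuous.deriv_integral ψ a y
  simp only [leftTemperedRL, Nat.floor_one]
  rw [e, iteratedDeriv_succ, iteratedDeriv_one, hd, hφ.deriv_exp_mul lam, ← mul_assoc,
    ← Complex.ofReal_mul]
  norm_num
  rw [← Complex.exp_add]
  simp

/-- The integrand `e^(-λr) (φ' + λφ)(x - r)` is the `r`-derivative of `-e^(-λr) φ(x - r)`, and the
endpoint `x - (b - a)` lies to the left of `a`. For the same reason the values of `G` beyond `b - a`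
are irrelevant. -/
theorem conv_exp_temperedDeriv {a b lam : ℝ} (hab : a < b) {φ : ℝ → ℂ} (hφ : IsTest a b φ)
    {G : ℝ → ℂ} (hG0 : ∀ r ≤ 0, G r = 0)
    (hG : ∀ r ∈ Set.Ioo 0 (b - a), G r = (Real.exp (-lam * r) : ℂ)) {x : ℝ}
    (hx : x ∈ Set.Ioo a b) : conv G (temperedDeriv lam φ) x = φ x := by
  have hχ := hφ.temperedDeriv lam
  have hL : (0 : ℝ) ≤ b - a := by linarith
  have h1 : conv G (temperedDeriv lam φ) x =
      ∫ r in (0 : ℝ)..(b - a), (Real.exp (-lam * r) : ℂ) * temperedDeriv lam φ (x - r) := by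
    rw [conv, intervalIntegral.integral_of_le hL, integral_Ioc_eq_integral_Ioo,
      ← integral_indicator measurableSet_Ioo]
    refine integral_congr_ae (Eventually.of_forall fun r => ?_)
    simp only [Set.indicator_apply]
    split_ifs with hr
    · rw [hG r hr]
    · rcases le_or_gt r 0 with h | h
      · rw [hG0 r h, zero_mul]
      · rw [hχ.eq_zero, mul_zero]
        intro h'
        exact hr ⟨h, by linarith [h'.1, hx.2]⟩
  have hd : ∀ r : ℝ, HasDerivAt (fun r : ℝ => -((Real.exp (-lam * r) : ℂ) * φ (x - r)))
      ((Real.exp (-lam * r) : ℂ) * temperedDeriv lam φ (x - r)) r := by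
    intro r
    have e : HasDerivAt (fun r : ℝ => (Real.exp (-lam * r) : ℂ))
        ((Real.exp (-lam * r) * (-lam) : ℝ) : ℂ) r := by
      have : HasDerivAt (fun r : ℝ => -lam * r) (-lam) r := by
        simpa using (hasDerivAt_id r).const_mul (-lam)
      exact this.exp.ofReal_comp
    have e2 : HasDerivAt (fun r : ℝ => φ (x - r)) (-deriv φ (x - r)) r := by
      exact HasDerivAt.comp_const_sub x r (hφ.differentiable (x - r)).hasDerivAt
    refine HasDerivAt.congr_deriv (f := fun r : ℝ => -((Real.exp (-lam * r) : ℂ) * φ (x - r)))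
      (e.mul e2).neg ?_
    simp only [temperedDeriv]; push_cast; ring
  rw [h1, intervalIntegral.integral_eq_sub_of_hasDerivAt (fun r _ => hd r)]
  · rw [hφ.eq_zero (x := x - (b - a)) (fun h => by linarith [h.1, hx.2])]
    simp
  · refine Continuous.intervalIntegrable ?_ _ _
    have := hχ.continuous
    fun_prop

/-- The exponentials multiply to `e^(-λr)`, and what remains is the Beta integral `B(μ, 1-μ) = Γ(μ)
Γ(1-μ)`. For `r < L` the truncation plays no role. -/
theorem conv_temperedKernel {μ lam L : ℝ} (hμ0 : 0 < μ) (hμ1 : μ < 1) {r : ℝ}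
    (hr : r ∈ Set.Ioo 0 L) :
    conv (temperedKernel μ lam L) (temperedKernel (1 - μ) lam L) r = (Real.exp (-lam * r) : ℂ) := by
  have hΓ1 := Real.Gamma_pos_of_pos hμ0
  have hΓ2 := Real.Gamma_pos_of_pos (sub_pos.2 hμ1)
  have h1 : conv (temperedKernel μ lam L) (temperedKernel (1 - μ) lam L) r =
      (Real.exp (-lam * r) / (Real.Gamma μ * Real.Gamma (1 - μ)) : ℝ) *
      ∫ s in (0 : ℝ)..r, (s : ℂ) ^ ((μ : ℂ) - 1) * ((r : ℂ) - s) ^ ((1 - μ : ℂ) - 1) := by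
    rw [conv, intervalIntegral.integral_of_le hr.1.le, integral_Ioc_eq_integral_Ioo,
      ← integral_const_mul, ← integral_indicator measurableSet_Ioo]
    refine integral_congr_ae (Eventually.of_forall fun s => ?_)
    simp only [temperedKernel, Set.indicator_apply]
    by_cases hs : s ∈ Set.Ioo 0 r
    · have e1 : s ∈ Set.Ioo 0 L := ⟨hs.1, hs.2.trans hr.2⟩
      have e2 : r - s ∈ Set.Ioo 0 L := ⟨by linarith [hs.2], by linarith [hs.1, hr.2]⟩
      rw [if_pos hs, if_pos e1, if_pos e2]
      have c1 : (s : ℂ) ^ ((μ : ℂ) - 1) = ((s ^ (μ - 1) : ℝ) : ℂ) := by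
        rw [Complex.ofReal_cpow hs.1.le]; push_cast; rfl
      have c2 : ((r : ℂ) - s) ^ ((1 - μ : ℂ) - 1) = (((r - s) ^ (1 - μ - 1) : ℝ) : ℂ) := by
        rw [Complex.ofReal_cpow e2.1.le]; push_cast; rfl
      rw [c1, c2, ← Complex.ofReal_mul, ← Complex.ofReal_mul, ← Complex.ofReal_mul]
      congr 1
      have : Real.exp (-lam * r) = Real.exp (-lam * s) * Real.exp (-lam * (r - s)) := by
        rw [← Real.exp_add]; congr 1; ring
      rw [this]; field_simp
    · rw [if_neg hs]
      by_cases e1 : s ∈ Set.Ioo 0 L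
      · rw [if_neg (c := r - s ∈ Set.Ioo 0 L), mul_zero]
        intro e2
        exact hs ⟨e1.1, by linarith [e2.1]⟩
      · rw [if_neg e1, zero_mul]
  have hb := Complex.Gamma_mul_Gamma_eq_betaIntegral (s := μ) (t := 1 - μ)
    (by simpa using hμ0) (by simpa using hμ1)
  rw [add_sub_cancel, Complex.Gamma_one, one_mul] at hb
  rw [h1, Complex.betaIntegral_scaled _ _ hr.1, ← hb, add_sub_cancel, sub_self, Complex.cpow_zero,
    one_mul, Complex.Gamma_ofReal, ← Complex.ofReal_one, ← Complex.ofReal_sub, Complex.Gamma_ofReal,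
    ← Complex.ofReal_mul, ← Complex.ofReal_mul, div_mul_cancel₀]
  positivity

theorem conv_temperedKernel_of_nonpos {μ ν lam L : ℝ} {r : ℝ} (hr : r ≤ 0) :
    conv (temperedKernel μ lam L) (temperedKernel ν lam L) r = 0 := by
  rw [conv]
  refine (integral_congr_ae (Eventually.of_forall fun s => ?_)).trans (integral_zero _ _)
  simp only [temperedKernel, Set.indicator_apply]
  split_ifs with h1 h2
  · linarith [h1.1, h2.1]
  all_goals simp

theorem temperedKernel_of_nonpos {ν lam L : ℝ} {r : ℝ} (hr : r ≤ 0) :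
    temperedKernel ν lam L r = 0 := Set.indicator_of_notMem (fun h => by linarith [h.1]) _

/-- By causality: the kernel lives on `s > 0`, so at `x < b` the convolution only sees `W` to the
left of `b`. -/
theorem conv_temperedKernel_indicator {a b ν lam : ℝ} {W : ℝ → ℂ} (hW : ∀ y ≤ a, W y = 0) {x : ℝ}
    (hx : x ∈ Set.Ioo a b) : conv (temperedKernel ν lam (b - a)) ((Set.Ioo a b).indicator W) x =
      conv (temperedKernel ν lam (b - a)) W x := by
  refine integral_congr_ae (Eventually.of_forall fun s => ?_)
  simp only
  rcases le_or_gt s 0 with hs | hs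
  · rw [temperedKernel_of_nonpos hs, zero_mul, zero_mul]
  · congr 1
    simp only [Set.indicator_apply]
    split_ifs with h
    · rfl
    · rw [hW]
      by_contra! h'
      exact h ⟨h', by linarith [hx.2]⟩

theorem conv_eq_zero_of_le {a b ν lam L : ℝ} {χ : ℝ → ℂ} (hχ : IsTest a b χ) {y : ℝ} (hy : y ≤ a) :
    conv (temperedKernel ν lam L) χ y = 0 := by
  rw [conv]
  refine (integral_congr_ae (Eventually.of_forall fun s => ?_)).trans (integral_zero _ _)
  rcases le_or_gt s 0 with hs | hs
  · rw [temperedKernel_of_nonpos hs, zero_mul]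
  · rw [hχ.eq_zero (fun h => by linarith [h.1]), mul_zero]

/-- The tempered fractional integral inverts the left tempered derivative. -/
theorem conv_leftTemperedRL {a b lam μ : ℝ} (hab : a < b) (hμ0 : 0 < μ) (hμ1 : μ ≤ 1)
    (hlam : 0 ≤ lam) {φ : ℝ → ℂ} (hφ : IsTest a b φ) {x : ℝ} (hx : x ∈ Set.Ioo a b) :
    conv (temperedKernel μ lam (b - a)) ((Set.Ioo a b).indicator (leftTemperedRL a lam μ φ)) x =
      φ x := by
  have hχ := hφ.temperedDeriv lam
  rcases hμ1.eq_or_lt with rfl | hμ1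
  · have e : leftTemperedRL a lam 1 φ = temperedDeriv lam φ := funext fun x => leftTemperedRL_one hφ x
    rw [e, conv_temperedKernel_indicator (fun y hy => hχ.eq_zero fun h => by linarith [h.1]) hx]
    refine conv_exp_temperedDeriv hab hφ (fun r hr => temperedKernel_of_nonpos hr) (fun r hr => ?_) hx
    simp only [temperedKernel, Set.indicator_of_mem hr]
    simp
  · have e : (Set.Ioo a b).indicator (leftTemperedRL a lam μ φ) = (Set.Ioo a b).indicator
        (conv (temperedKernel (1 - μ) lam (b - a)) (temperedDeriv lam φ)) :=
      Set.indicator_congr fun x hx => leftTemperedRL_eq_conv hμ1 hφ hx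
    rw [e, conv_temperedKernel_indicator (fun y hy => conv_eq_zero_of_le hχ hy) hx,
      conv_assoc (integrable_temperedKernel hμ0 hlam)
        (integrable_temperedKernel (by linarith) hlam) hχ.continuous hχ.2.1]
    exact conv_exp_temperedDeriv hab hφ (fun r hr => conv_temperedKernel_of_nonpos hr)
      (fun r hr => conv_temperedKernel hμ0 hμ1 hr) hx

theorem IsTest.integrable {a b : ℝ} {φ : ℝ → ℂ} (h : IsTest a b φ) : Integrable φ :=
  h.continuous.integrable_of_hasCompactSupport h.2.1

theorem IsTest.fourier_temperedDeriv {a b : ℝ} {φ : ℝ → ℂ} (h : IsTest a b φ) (lam ξ : ℝ) :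
    𝓕 (_root_.temperedDeriv lam φ) ξ = (2 * Real.pi * Complex.I * ξ + lam) * 𝓕 φ ξ := by
  have h0 : _root_.temperedDeriv 0 φ = deriv φ := by ext x; simp [_root_.temperedDeriv]
  have hd : Integrable (deriv φ) := h0 ▸ (h.temperedDeriv 0).integrable
  have h1 := congrFun (Real.fourier_deriv h.integrable h.differentiable hd) ξ
  have h2 : 𝓕 (_root_.temperedDeriv lam φ) ξ = 𝓕 (deriv φ) ξ + lam * 𝓕 φ ξ := by
    rw [Real.fourier_eq, Real.fourier_eq, Real.fourier_eq, ← integral_const_mul, ← integral_add]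
    · congr 1; ext x
      simp only [_root_.temperedDeriv, Circle.smul_def, smul_eq_mul]; ring
    · exact (Real.fourierIntegral_convergent_iff ξ).2 hd
    · exact ((Real.fourierIntegral_convergent_iff ξ).2 h.integrable).const_mul _
  rw [h2, h1, smul_eq_mul]; ring

/-- The symbol of `φ' + λφ` is `2πiξ + λ`; multiplied by `m` it is at most `2πC|ξ|^μ + λM`, the
decay of `m` serving the first term and its boundedness the second. -/
theorem eLpNorm_le_of_fourier_multiplier {a b μ lam : ℝ} (hlam : 0 ≤ lam) {φ : ℝ → ℂ}
    (hφ : IsTest a b φ) {W : ℝ → ℂ} (hW : Integrable W)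
    (hW2 : MemLp W 2 volume) {m : ℝ → ℂ} {M C : ℝ≥0}
    (hF : ∀ ξ, 𝓕 W ξ = m ξ * 𝓕 (temperedDeriv lam φ) ξ) (hM : ∀ ξ, ‖m ξ‖ ≤ M)
    (hC : ∀ ξ, |ξ| ^ (1 - μ) * ‖m ξ‖ ≤ C) :
    eLpNorm W 2 volume ≤ ((M * lam.toNNReal + C * (2 * Real.pi).toNNReal : ℝ≥0) : ℝ≥0∞) *
      (eLpNorm φ 2 volume + frSemi μ hφ.toL2) := by
  set A : ℝ≥0 := M * lam.toNNReal + C * (2 * Real.pi).toNNReal with hA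
  have hAr : (A : ℝ) = M * lam + C * (2 * Real.pi) := by
    rw [hA]; push_cast
    rw [Real.coe_toNNReal _ hlam, Real.coe_toNNReal _ (by positivity)]
  set F : ℝ → ℂ := fun ξ => (𝓕 hφ.toL2 : L2) ξ with hFd
  have hae : F =ᵐ[volume] 𝓕 φ := fourier_toLp_ae_eq hφ.integrable hφ.memLp
  have e1 : eLpNorm W 2 volume = eLpNorm (𝓕 W) 2 volume := by
    rw [← eLpNorm_congr_ae (fourier_toLp_ae_eq hW hW2), eLpNorm_fourier,
      eLpNorm_congr_ae hW2.coeFn_toLp]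
  have e2 : eLpNorm φ 2 volume = eLpNorm F 2 volume := by
    rw [hFd, eLpNorm_fourier, eLpNorm_congr_ae hφ.coe_toL2]
  have hFm : AEStronglyMeasurable F volume := Lp.aestronglyMeasurable _
  rw [e1, e2]
  calc eLpNorm (𝓕 W) 2 volume
      ≤ eLpNorm (fun ξ => (A : ℝ) * (‖F ξ‖ + ‖((|ξ| ^ μ : ℝ) : ℂ) * F ξ‖)) 2 volume := by
        refine eLpNorm_mono_ae_real ?_
        filter_upwards [hae] with ξ hξ
        rw [hF, hφ.fourier_temperedDeriv, norm_mul, norm_mul, norm_mul, hξ, hAr, Complex.norm_real,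
          Real.norm_of_nonneg (by positivity)]
        have h1 : ‖2 * (Real.pi : ℂ) * Complex.I * ξ + lam‖ ≤ 2 * Real.pi * |ξ| + lam := by
          refine (norm_add_le _ _).trans (le_of_eq ?_)
          simp [abs_of_pos Real.pi_pos, abs_of_nonneg hlam]
        have h2 : |ξ| * ‖m ξ‖ ≤ C * |ξ| ^ μ := by
          rcases eq_or_ne ξ 0 with rfl | hξ0
          · simp; positivity
          have : |ξ| = |ξ| ^ μ * |ξ| ^ (1 - μ) := by
            rw [← Real.rpow_add (abs_pos.2 hξ0)]; simp
          calc |ξ| * ‖m ξ‖ = |ξ| ^ μ * (|ξ| ^ (1 - μ) * ‖m ξ‖) := by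
                nth_rewrite 1 [this]; ring
            _ ≤ |ξ| ^ μ * C := by gcongr; exact hC ξ
            _ = _ := by ring
        have h3 : ‖m ξ‖ * ‖2 * (Real.pi : ℂ) * Complex.I * ξ + lam‖ ≤
            M * lam + C * (2 * Real.pi) * |ξ| ^ μ := by
          calc _ ≤ ‖m ξ‖ * (2 * Real.pi * |ξ| + lam) := by gcongr
            _ = 2 * Real.pi * (|ξ| * ‖m ξ‖) + ‖m ξ‖ * lam := by ring
            _ ≤ 2 * Real.pi * (C * |ξ| ^ μ) + M * lam := by
              gcongr; exact hM ξ
            _ = _ := by ring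
        have p1 : (0 : ℝ) ≤ M * lam * |ξ| ^ μ := by positivity
        have p2 : (0 : ℝ) ≤ C * (2 * Real.pi) := by positivity
        rw [← mul_assoc]
        calc _ ≤ (M * lam + C * (2 * Real.pi) * |ξ| ^ μ) * ‖𝓕 φ ξ‖ := by gcongr
          _ ≤ ((M * lam + C * (2 * Real.pi)) * (1 + |ξ| ^ μ)) * ‖𝓕 φ ξ‖ := by
              gcongr; nlinarith
          _ = _ := by ring
    _ = A * eLpNorm (fun ξ => ‖F ξ‖ + ‖((|ξ| ^ μ : ℝ) : ℂ) * F ξ‖) 2 volume := by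
        have h := eLpNorm_const_smul (A : ℝ) (fun ξ => ‖F ξ‖ + ‖((|ξ| ^ μ : ℝ) : ℂ) * F ξ‖) 2 volume
        rw [Real.enorm_of_nonneg A.coe_nonneg, ENNReal.ofReal_coe_nnreal] at h
        exact h
    _ ≤ _ := by
        gcongr
        refine (eLpNorm_add_le hFm.norm (aestronglyMeasurable_weight μ _).norm (by norm_num)).trans ?_
        rw [eLpNorm_norm, eLpNorm_norm, frSemi]

/-- On test functions the left tempered derivative agrees on `(a, b)` with a bounded
square integrable function, controlled by the Sobolev norm. -/
theorem leftTemperedRL_rep {a b lam μ : ℝ} (hab : a < b) (hμ0 : 0 < μ) (hμ1 : μ ≤ 1)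
    (hlam : 0 ≤ lam) : ∃ C : ℝ≥0, ∀ (φ : ℝ → ℂ) (hφ : IsTest a b φ), ∃ W : ℝ → ℂ,
      Continuous W ∧ (∃ M, ∀ x, ‖W x‖ ≤ M) ∧ MemLp W 2 volume ∧
      (∀ x ∈ Set.Ioo a b, leftTemperedRL a lam μ φ x = W x) ∧
      eLpNorm W 2 volume ≤ C * (eLpNorm φ 2 volume + frSemi μ hφ.toL2) := by
  rcases hμ1.eq_or_lt with rfl | hμ1'
  · refine ⟨_, fun φ hφ => ⟨temperedDeriv lam φ, (hφ.temperedDeriv lam).continuous,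
      (hφ.temperedDeriv lam).continuous.bounded_above_of_compact_support (hφ.temperedDeriv lam).2.1,
      (hφ.temperedDeriv lam).memLp, fun x _ => leftTemperedRL_one hφ x,
      eLpNorm_le_of_fourier_multiplier hlam hφ (hφ.temperedDeriv lam).integrable
      (hφ.temperedDeriv lam).memLp (m := fun _ => 1) (M := 1) (C := 1) (fun ξ => by rw [one_mul])
      (fun ξ => by simp) (fun ξ => by simp)⟩⟩
  · have hK : Integrable (temperedKernel (1 - μ) lam (b - a)) :=
      integrable_temperedKernel (by linarith) hlam
    obtain ⟨C, hC⟩ := norm_fourier_temperedKernel_le (ν := 1 - μ) (by linarith) (by linarith) hlam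
      (sub_pos.2 hab)
    set N : ℝ≥0 := NNReal.mk (∫ s, ‖temperedKernel (1 - μ) lam (b - a) s‖)
      (integral_nonneg fun _ => norm_nonneg _)
    refine ⟨N * lam.toNNReal + C * (2 * Real.pi).toNNReal, fun φ hφ => ?_⟩
    · have hχ := hφ.temperedDeriv lam
      obtain ⟨M, hM⟩ := hχ.continuous.bounded_above_of_compact_support hχ.2.1
      have hb := norm_conv_le hK hM
      have hi := integrable_conv hK hχ.integrable
      have h2 := memLp_two_of_bounded hi hb
      exact ⟨conv (temperedKernel (1 - μ) lam (b - a)) (temperedDeriv lam φ),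
        continuous_conv hK hχ.continuous hχ.2.1, ⟨_, hb⟩, h2,
        fun x hx => leftTemperedRL_eq_conv hμ1' hφ hx,
        eLpNorm_le_of_fourier_multiplier hlam hφ hi h2
          (fun ξ => fourier_conv hK hχ.integrable ξ)
          (M := N) (fun ξ => norm_fourier_le _ ξ) hC⟩

/-! ### Two-sided bounds for the left and right derivatives on test functions. -/

/-- An operator on test functions that is linear and comparable to the `H^μ` seminorm. -/
structure IsSobolevOp (a b μ : ℝ) (D : (ℝ → ℂ) → ℝ → ℂ) : Prop where
  memLp : ∀ φ, IsTest a b φ → MemLp (D φ) 2 (volume.restrict (Set.Ioo a b))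
  sub : ∀ φ ψ, IsTest a b φ → IsTest a b ψ → ∀ x ∈ Set.Ioo a b, D (φ - ψ) x = D φ x - D ψ x
  upper : ∃ C : ℝ≥0, ∀ φ, IsTest a b φ → ∀ v : L2, v =ᵐ[volume.restrict (Set.Ioo a b)] φ →
    l2Norm a b (D φ) ≤ C * frSemi μ v
  lower : ∃ C : ℝ≥0, ∀ φ, IsTest a b φ → ∃ v : L2, v =ᵐ[volume.restrict (Set.Ioo a b)] φ ∧
    frSemi μ v ≤ C * l2Norm a b (D φ)

theorem l2Norm_congr {a b : ℝ} {u w : ℝ → ℂ} (h : ∀ x ∈ Set.Ioo a b, u x = w x) :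
    l2Norm a b u = l2Norm a b w :=
  eLpNorm_congr_ae ((ae_restrict_iff' measurableSet_Ioo).2 (Eventually.of_forall h))

/-- The upper bound combines the multiplier estimate with extension by zero. For the lower bound the
witness is the fractional integral of `1_Ω D^μ φ`, an extension of `φ` that need not vanish beyond
`b`. -/
theorem isSobolevOp_left {a b lam μ : ℝ} (hab : a < b) (hμ0 : 0 < μ) (hμ1 : μ ≤ 1)
    (hμ : μ ≠ 1 / 2) (hlam : 0 ≤ lam) : IsSobolevOp a b μ (leftTemperedRL a lam μ) := by
  obtain ⟨C, hC⟩ := leftTemperedRL_rep hab hμ0 hμ1 hlam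
  obtain ⟨Z, hZ⟩ := zero_extension_bound hab hμ0 hμ1 hμ
  obtain ⟨E, hE⟩ := norm_fourier_temperedKernel_le hμ0 hμ1 hlam (sub_pos.2 hab)
  have hae : ∀ {φ W : ℝ → ℂ}, (∀ x ∈ Set.Ioo a b, leftTemperedRL a lam μ φ x = W x) →
      leftTemperedRL a lam μ φ =ᵐ[volume.restrict (Set.Ioo a b)] W := fun h =>
    (ae_restrict_iff' measurableSet_Ioo).2 (Eventually.of_forall h)
  refine ⟨fun φ hφ => ?_, fun φ ψ hφ hψ x hx => ?_, ⟨2 * C * Z, fun φ hφ v hv => ?_⟩,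
    ⟨E, fun φ hφ => ?_⟩⟩
  · obtain ⟨W, -, -, hW2, hW, -⟩ := hC φ hφ
    exact (memLp_congr_ae (hae hW)).2 (hW2.restrict _)
  · rcases hμ1.eq_or_lt with rfl | hμ1'
    · rw [leftTemperedRL_one (hφ.sub hψ), leftTemperedRL_one hφ, leftTemperedRL_one hψ,
        hφ.temperedDeriv_sub hψ]; rfl
    · have hK : Integrable (temperedKernel (1 - μ) lam (b - a)) :=
        integrable_temperedKernel (by linarith) hlam
      rw [leftTemperedRL_eq_conv hμ1' (hφ.sub hψ) hx, leftTemperedRL_eq_conv hμ1' hφ hx,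
        leftTemperedRL_eq_conv hμ1' hψ hx, hφ.temperedDeriv_sub hψ, conv, conv, conv,
        ← integral_sub]
      · congr 1; ext s; simp only [Pi.sub_apply]; ring
      · exact (hφ.temperedDeriv lam).2.1.convolutionExists_right
          (ContinuousLinearMap.mul ℝ ℂ) hK.locallyIntegrable (hφ.temperedDeriv lam).continuous x
      · exact (hψ.temperedDeriv lam).2.1.convolutionExists_right
          (ContinuousLinearMap.mul ℝ ℂ) hK.locallyIntegrable (hψ.temperedDeriv lam).continuous x
  · obtain ⟨W, -, -, -, hW, hb⟩ := hC φ hφ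
    obtain ⟨h1, h2⟩ := hZ φ hφ v hv
    rw [l2Norm_congr hW]
    calc l2Norm a b W ≤ eLpNorm W 2 volume := eLpNorm_mono_measure _ Measure.restrict_le_self
      _ ≤ C * (Z * frSemi μ v + Z * frSemi μ v) := hb.trans (by gcongr)
      _ = _ := by push_cast; ring
  · obtain ⟨W, hWc, ⟨M, hM⟩, hW2, hW, -⟩ := hC φ hφ
    set w := (Set.Ioo a b).indicator (leftTemperedRL a lam μ φ) with hw
    have hwW : w = (Set.Ioo a b).indicator W := Set.indicator_congr hW
    have hwi : Integrable w := by
      rw [hwW, integrable_indicator_iff measurableSet_Ioo]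
      exact (hWc.integrableOn_Icc (a := a) (b := b)).mono_set Set.Ioo_subset_Icc_self
    have hwM : ∀ x, ‖w x‖ ≤ M := fun x => by
      rw [hwW]; exact (norm_indicator_le_norm_self W x).trans (hM x)
    have hK : Integrable (temperedKernel μ lam (b - a)) := integrable_temperedKernel hμ0 hlam
    have h2 : MemLp (conv (temperedKernel μ lam (b - a)) w) 2 volume :=
      memLp_two_of_bounded (integrable_conv hK hwi) (norm_conv_le hK hwM)
    have hw2 := memLp_two_of_bounded hwi hwM
    refine ⟨h2.toLp _, ?_, ?_⟩
    · refine (h2.coeFn_toLp.filter_mono (ae_mono Measure.restrict_le_self)).trans ?_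
      exact (ae_restrict_iff' measurableSet_Ioo).2 (Eventually.of_forall fun x hx =>
        conv_leftTemperedRL hab hμ0 hμ1 hlam hφ hx)
    · refine (frSemi_conv_le hK hwi hw2 h2 hE).trans (le_of_eq ?_)
      rw [hw, eLpNorm_indicator_eq_eLpNorm_restrict measurableSet_Ioo, l2Norm]

/-- Under `ξ ↦ a + b - ξ` the exponentials shift by the constant `e^(-λ(a+b))`, and the sign
`(-1)^n` cancels against the one from differentiating a reflected function `n` times. -/
theorem rightTemperedRL_eq_left {a b lam μ : ℝ} (u : ℝ → ℂ) (x : ℝ) :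
    rightTemperedRL b lam μ u x =
      leftTemperedRL a lam μ (fun y => u (a + b - y)) (a + b - x) := by
  simp only [rightTemperedRL, leftTemperedRL]
  set n := ⌊μ⌋₊ + 1
  set F : ℝ → ℂ := fun y => ∫ ξ in a..y,
    ((Real.exp (lam * ξ) / (y - ξ) ^ (μ - n + 1) : ℝ) : ℂ) * u (a + b - ξ) with hF
  have e : (fun y : ℝ => ∫ ξ in y..b,
      ((Real.exp (-lam * ξ) / (ξ - y) ^ (μ - n + 1) : ℝ) : ℂ) * u ξ) =
      fun y => (Real.exp (-lam * (a + b)) : ℂ) * F (a + b - y) := by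
    ext y
    have h1 := intervalIntegral.integral_comp_sub_left (a := a) (b := a + b - y)
      (fun ξ => ((Real.exp (-lam * ξ) / (ξ - y) ^ (μ - n + 1) : ℝ) : ℂ) * u ξ) (a + b)
    simp only [sub_sub_cancel, add_sub_cancel_left] at h1
    rw [← h1, hF, ← intervalIntegral.integral_const_mul]
    congr 1; ext ξ
    rw [← mul_assoc, ← Complex.ofReal_mul]
    congr 2
    have : Real.exp (-lam * (a + b - ξ)) = Real.exp (-lam * (a + b)) * Real.exp (lam * ξ) := by
      rw [← Real.exp_add]; congr 1; ring
    rw [this, show a + b - ξ - y = a + b - y - ξ by ring]; ring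
  rw [e, iteratedDeriv_const_mul_field, iteratedDeriv_comp_const_sub]
  have h2 : Real.exp (lam * x) * Real.exp (-lam * (a + b)) = Real.exp (-lam * (a + b - x)) := by
    rw [← Real.exp_add]; congr 1; ring
  simp only [← h2, Complex.real_smul]
  have h3 : ((-1 : ℂ) ^ n) * ((-1) ^ n) = 1 := by rw [← mul_pow]; simp
  simp only [Complex.ofReal_div, Complex.ofReal_mul, Complex.ofReal_pow, Complex.ofReal_neg,
    Complex.ofReal_one]
  linear_combination (Real.exp (lam * x) : ℂ) / (Real.Gamma (n - μ) : ℂ) *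
    (Real.exp (-lam * (a + b)) : ℂ) * iteratedDeriv n F (a + b - x) * h3

/-- Conjugation of an operator by the reflection of `(a, b)`. -/
theorem IsSobolevOp.reflect {a b μ : ℝ} {D : (ℝ → ℂ) → ℝ → ℂ} (hL : IsSobolevOp a b μ D) :
    IsSobolevOp a b μ fun φ x => D (fun y => φ (a + b - y)) (a + b - x) := by
  obtain ⟨C, hC⟩ := hL.upper
  obtain ⟨E, hE⟩ := hL.lower
  have hrefl : ∀ {φ : ℝ → ℂ}, IsTest a b φ → IsTest a b fun y => φ (a + b - y) := fun h => by
    simpa using h.comp_const_sub (a + b)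
  have hmem : ∀ {x}, x ∈ Set.Ioo a b → a + b - x ∈ Set.Ioo a b := fun h =>
    ⟨by linarith [h.2], by linarith [h.1]⟩
  have hmp : MeasurePreserving (fun x : ℝ => a + b - x) (volume.restrict (Set.Ioo a b))
      (volume.restrict (Set.Ioo a b)) := by
    have := (Measure.measurePreserving_sub_left volume (a + b)).restrict_preimage
      (measurableSet_Ioo (a := a) (b := b))
    simpa using this
  have hn : ∀ φ, IsTest a b φ → l2Norm a b (fun x => D (fun y => φ (a + b - y)) (a + b - x)) =
      l2Norm a b (D fun y => φ (a + b - y)) := fun φ hφ =>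
    eLpNorm_comp_measurePreserving (hL.memLp _ (hrefl hφ)).1 hmp
  have hext : ∀ {φ : ℝ → ℂ} {v : L2}, v =ᵐ[volume.restrict (Set.Ioo a b)] φ →
      ∃ w : L2, w =ᵐ[volume.restrict (Set.Ioo a b)] (fun y => φ (a + b - y)) ∧
        frSemi μ w = frSemi μ v := by
    intro φ v hv
    set w : L2 := Lp.compMeasurePreserving (fun x : ℝ => a + b - x)
      (Measure.measurePreserving_sub_left volume (a + b)) v
    have hw : w =ᵐ[volume] fun x => v (a + b - x) := Lp.coeFn_compMeasurePreserving _ _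
    refine ⟨w, ?_, frSemi_comp_const_sub μ hw⟩
    have := ae_restrict_comp_const_sub (c := a + b) hv
    simp only [add_sub_cancel_right, add_sub_cancel_left] at this
    exact (hw.filter_mono (ae_mono Measure.restrict_le_self)).trans this
  refine ⟨fun φ hφ => ?_, fun φ ψ hφ hψ x hx => ?_, ⟨C, fun φ hφ v hv => ?_⟩,
    ⟨E, fun φ hφ => ?_⟩⟩
  · exact (hL.memLp _ (hrefl hφ)).comp_measurePreserving hmp
  · exact hL.sub _ _ (hrefl hφ) (hrefl hψ) _ (hmem hx)
  · obtain ⟨w, hw, he⟩ := hext hv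
    rw [hn φ hφ, ← he]
    exact hC _ (hrefl hφ) w hw
  · obtain ⟨v, hv, hb⟩ := hE _ (hrefl hφ)
    obtain ⟨w, hw, he⟩ := hext hv
    refine ⟨w, by simpa using hw, ?_⟩
    rw [he, hn φ hφ]; exact hb

theorem isSobolevOp_right {a b lam μ : ℝ} (hab : a < b) (hμ0 : 0 < μ) (hμ1 : μ ≤ 1)
    (hμ : μ ≠ 1 / 2) (hlam : 0 ≤ lam) : IsSobolevOp a b μ (rightTemperedRL b lam μ) := by
  have h : rightTemperedRL b lam μ =
      fun φ x => leftTemperedRL a lam μ (fun y => φ (a + b - y)) (a + b - x) :=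
    funext fun φ => funext fun x => rightTemperedRL_eq_left φ x
  rw [h]
  exact (isSobolevOp_left hab hμ0 hμ1 hμ hlam).reflect

/-! ### The quotient seminorm and norm on the interval. -/

section Seminorm

variable {a b μ : ℝ} {u w : ℝ → ℂ}

theorem coe_semiConst_ne_zero (μ : ℝ) : (semiConst μ : ℝ≥0∞) ≠ 0 :=
  ENNReal.coe_ne_zero.2 (semiConst_ne_zero μ)

theorem isSobolevExtension_iff {v : L2} : IsSobolevExtension a b μ u v ↔
    frSemi μ v < ⊤ ∧ v =ᵐ[volume.restrict (Set.Ioo a b)] u := by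
  rw [IsSobolevExtension, seminormLine_eq, lt_top_iff_ne_top, lt_top_iff_ne_top, ne_eq, ne_eq,
    ENNReal.mul_eq_top]
  simp [semiConst_ne_zero]

theorem sobolevSeminorm_le {v : L2} (hv : v =ᵐ[volume.restrict (Set.Ioo a b)] u) :
    sobolevSeminorm a b μ u ≤ semiConst μ * frSemi μ v := by
  rcases eq_or_ne (frSemi μ v) ⊤ with h | h
  · rw [h, ENNReal.mul_top (coe_semiConst_ne_zero μ)]; exact le_top
  · rw [← seminormLine_eq]
    exact iInf₂_le v (isSobolevExtension_iff.2 ⟨h.lt_top, hv⟩)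

/-- Passes an estimate valid for all extensions to the infimum. Using `C + 1` instead of `C` keeps
the factor nonzero, so that it commutes with infima even when there is no extension and the infimum
is `⊤`. -/
theorem le_sobolevSeminorm {A : ℝ≥0∞} {C : ℝ≥0}
    (h : ∀ v : L2, v =ᵐ[volume.restrict (Set.Ioo a b)] u → A ≤ C * frSemi μ v) :
    A ≤ ((C + 1) / semiConst μ : ℝ≥0) * sobolevSeminorm a b μ u := by
  have hκ := semiConst_ne_zero μ
  rw [sobolevSeminorm, ENNReal.mul_iInf_of_ne (ENNReal.coe_ne_zero.2 (by positivity))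
    ENNReal.coe_ne_top]
  refine le_iInf fun v => ?_
  rw [ENNReal.mul_iInf_of_ne (ENNReal.coe_ne_zero.2 (by positivity)) ENNReal.coe_ne_top]
  refine le_iInf fun hv => (h v hv.2).trans ?_
  rw [seminormLine_eq, ← mul_assoc, ← ENNReal.coe_mul, div_mul_cancel₀ _ hκ]
  gcongr
  exact le_self_add

theorem sobolevSeminorm_sub_le :
    sobolevSeminorm a b μ (u - w) ≤ sobolevSeminorm a b μ u + sobolevSeminorm a b μ w := by
  have e : ∀ f : ℝ → ℂ, sobolevSeminorm a b μ f =
      ⨅ p : {v : L2 // IsSobolevExtension a b μ f v}, seminormLine μ p.1 := fun f => by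
    rw [sobolevSeminorm, iInf_subtype']
  rw [e u, e w, ENNReal.iInf_add]
  refine le_iInf fun p => ?_
  rw [ENNReal.add_iInf]
  refine le_iInf fun q => ?_
  rw [seminormLine_eq, seminormLine_eq, ← mul_add]
  refine (sobolevSeminorm_le (v := p.1 - q.1) ?_).trans (mul_le_mul' le_rfl (frSemi_sub_le _ _ _))
  filter_upwards [(Lp.coeFn_sub p.1 q.1).filter_mono (ae_mono Measure.restrict_le_self), p.2.2, q.2.2]
    with x h1 h2 h3
  rw [h1, Pi.sub_apply, h2, h3, Pi.sub_apply]

theorem sobolevSeminorm_neg : sobolevSeminorm a b μ (-u) = sobolevSeminorm a b μ u := by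
  have key : ∀ f : ℝ → ℂ, sobolevSeminorm a b μ (-f) ≤ sobolevSeminorm a b μ f := by
    intro f
    refine le_iInf₂ fun v hv => ?_
    rw [seminormLine_eq, ← frSemi_neg]
    refine sobolevSeminorm_le ?_
    filter_upwards [(Lp.coeFn_neg v).filter_mono (ae_mono Measure.restrict_le_self), hv.2]
      with x h1 h2
    rw [h1, Pi.neg_apply, h2, Pi.neg_apply]
  exact le_antisymm (key u) (by simpa using key (-u))

theorem sobolevNorm_sub_comm : sobolevNorm a b μ (u - w) = sobolevNorm a b μ (w - u) := by
  rw [← neg_sub w u, sobolevNorm, sobolevNorm, sobolevSeminorm_neg, l2Norm, l2Norm, eLpNorm_neg]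

theorem sq_rpow_half (A : ℝ≥0∞) : (A ^ 2) ^ (1 / 2 : ℝ) = A := by
  rw [← ENNReal.rpow_natCast, ← ENNReal.rpow_mul]; norm_num

theorem l2Norm_le_sobolevNorm : l2Norm a b u ≤ sobolevNorm a b μ u := by
  rw [← sq_rpow_half (l2Norm a b u), sobolevNorm]
  exact ENNReal.rpow_le_rpow le_self_add (by norm_num)

theorem sobolevSeminorm_le_sobolevNorm : sobolevSeminorm a b μ u ≤ sobolevNorm a b μ u := by
  rw [← sq_rpow_half (sobolevSeminorm a b μ u), sobolevNorm]
  exact ENNReal.rpow_le_rpow le_add_self (by norm_num)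

theorem sobolevNorm_le : sobolevNorm a b μ u ≤ l2Norm a b u + sobolevSeminorm a b μ u := by
  rw [← sq_rpow_half (l2Norm a b u + sobolevSeminorm a b μ u), sobolevNorm]
  refine ENNReal.rpow_le_rpow ?_ (by norm_num)
  rw [add_sq]
  refine add_le_add ?_ le_rfl
  exact le_self_add

theorem l2Norm_le_add_sub (hu : AEStronglyMeasurable u (volume.restrict (Set.Ioo a b)))
    (hw : AEStronglyMeasurable w (volume.restrict (Set.Ioo a b))) :
    l2Norm a b u ≤ l2Norm a b w + l2Norm a b (w - u) := by
  have := eLpNorm_sub_le (p := 2) hw (hw.sub hu) (by norm_num)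
  rwa [sub_sub_cancel] at this

theorem sobolevSeminorm_le_add_sub :
    sobolevSeminorm a b μ u ≤ sobolevSeminorm a b μ w + sobolevSeminorm a b μ (w - u) := by
  have := sobolevSeminorm_sub_le (a := a) (b := b) (μ := μ) (u := w) (w := w - u)
  rwa [sub_sub_cancel] at this

end Seminorm

/-! ### Passing to `H_0^μ`: extension by zero, Poincaré inequality, inclusions. -/

theorem IsTest.frSemi_one_le_deriv {a b : ℝ} {φ : ℝ → ℂ} (hφ : IsTest a b φ) :
    frSemi 1 hφ.toL2 ≤ eLpNorm (deriv φ) 2 volume := by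
  have hd := hφ.temperedDeriv 0
  have h0 : _root_.temperedDeriv 0 φ = deriv φ := by ext x; simp [_root_.temperedDeriv]
  have key : frSemi 1 hφ.toL2 ≤ (1 : ℝ≥0) * eLpNorm (𝓕 hd.toL2 : L2) 2 volume := by
    refine eLpNorm_le_of_pointwise ?_
    filter_upwards [fourier_toLp_ae_eq hφ.integrable hφ.memLp,
      fourier_toLp_ae_eq hd.integrable hd.memLp] with ξ e1 e2
    rw [IsTest.toL2, IsTest.toL2, e1, e2, hφ.fourier_temperedDeriv, Real.rpow_one, norm_mul,
      norm_mul]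
    simp only [Complex.norm_real, Real.norm_eq_abs, abs_abs, NNReal.coe_one, one_mul,
      Complex.ofReal_zero, add_zero, norm_mul, Complex.norm_I, mul_one, Complex.norm_ofNat,
      abs_of_pos Real.pi_pos]
    refine mul_le_mul_of_nonneg_right ?_ (norm_nonneg _)
    nlinarith [Real.two_le_pi, abs_nonneg ξ]
  rwa [ENNReal.coe_one, one_mul, eLpNorm_fourier, eLpNorm_congr_ae hd.coe_toL2, h0] at key

theorem IsTest.frSemi_lt_top {a b μ : ℝ} (h0 : 0 ≤ μ) (h1 : μ ≤ 1) {φ : ℝ → ℂ}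
    (hφ : IsTest a b φ) : frSemi μ hφ.toL2 < ⊤ := by
  have hd : deriv φ = _root_.temperedDeriv 0 φ := by ext x; simp [_root_.temperedDeriv]
  refine (frSemi_le_of_le h0 h1 _).trans_lt (ENNReal.add_lt_top.2 ⟨(Lp.memLp _).2, ?_⟩)
  refine hφ.frSemi_one_le_deriv.trans_lt ?_
  rw [hd]
  exact (hφ.temperedDeriv 0).memLp.2

theorem IsTest.mem_sobolev {a b μ : ℝ} (h0 : 0 ≤ μ) (h1 : μ ≤ 1) {φ : ℝ → ℂ}
    (hφ : IsTest a b φ) : φ ∈ sobolev a b μ :=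
  ⟨hφ.memLp.restrict _, hφ.toL2, isSobolevExtension_iff.2 ⟨hφ.frSemi_lt_top h0 h1,
    hφ.coe_toL2.filter_mono (ae_mono Measure.restrict_le_self)⟩⟩

theorem sub_mem_sobolev {a b μ : ℝ} {u w : ℝ → ℂ} (hu : u ∈ sobolev a b μ)
    (hw : w ∈ sobolev a b μ) : u - w ∈ sobolev a b μ := by
  obtain ⟨hu2, v, hv⟩ := hu
  obtain ⟨hw2, v', hv'⟩ := hw
  rw [isSobolevExtension_iff] at hv hv'
  refine ⟨hu2.sub hw2, v - v', isSobolevExtension_iff.2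
    ⟨(frSemi_sub_le _ _ _).trans_lt (ENNReal.add_lt_top.2 ⟨hv.1, hv'.1⟩), ?_⟩⟩
  filter_upwards [(Lp.coeFn_sub v v').filter_mono (ae_mono Measure.restrict_le_self), hv.2, hv'.2]
    with x h1 h2 h3
  rw [h1, Pi.sub_apply, h2, h3, Pi.sub_apply]

theorem test_sub_mem_sobolevZero {a b μ : ℝ} (h0 : 0 ≤ μ) (h1 : μ ≤ 1) {u φ : ℝ → ℂ}
    (hu : u ∈ sobolevZero a b μ) (hφ : IsTest a b φ) : φ - u ∈ sobolevZero a b μ := by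
  refine ⟨sub_mem_sobolev (hφ.mem_sobolev h0 h1) hu.1, fun ε hε => ?_⟩
  obtain ⟨ψ, hψ, h⟩ := hu.2 ε hε
  refine ⟨φ - ψ, hφ.sub hψ, ?_⟩
  rwa [sub_sub_sub_cancel_left, sobolevNorm_sub_comm]

theorem exists_seq_of_mem_sobolevZero {a b μ : ℝ} {u : ℝ → ℂ} (hu : u ∈ sobolevZero a b μ) :
    ∃ φ : ℕ → ℝ → ℂ, (∀ k, IsTest a b (φ k)) ∧
      (∀ k, sobolevNorm a b μ (φ k - u) ≤ (1 / 2) ^ k) := by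
  have h : ∀ k : ℕ, ∃ φ, IsTest a b φ ∧ sobolevNorm a b μ (φ - u) < (1 / 2) ^ k := fun k =>
    hu.2 _ (ENNReal.pow_pos (by simp) k)
  choose φ hφ hφ' using h
  exact ⟨φ, hφ, fun k => (hφ' k).le⟩

theorem tendsto_half_pow : Tendsto (fun k : ℕ => ((1 / 2 : ℝ≥0∞)) ^ k) atTop (𝓝 0) :=
  ENNReal.tendsto_pow_atTop_nhds_zero_of_lt_one (by simp)

/-- Lower semicontinuity of the Fourier seminorm in `L²`. -/
theorem frSemi_le_of_tendsto {μ : ℝ} {f : ℕ → L2} {g : L2} (h : Tendsto f atTop (𝓝 g))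
    {B : ℕ → ℝ≥0∞} {B' : ℝ≥0∞} (hB : ∀ k, frSemi μ (f k) ≤ B k) (hB' : Tendsto B atTop (𝓝 B')) :
    frSemi μ g ≤ B' := by
  have hF : Tendsto (fun k => (𝓕 (f k) : L2)) atTop (𝓝 (𝓕 g)) :=
    ((Lp.fourierTransformₗᵢ ℝ ℂ).continuous.tendsto g).comp h
  -- `L²` convergence of the transforms gives almost everywhere convergence of a subsequence, to
  -- which Fatou's lemma applies.
  obtain ⟨ns, hns, hae⟩ := (tendstoInMeasure_of_tendsto_Lp hF).exists_seq_tendsto_ae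
  have hBn := hB'.comp hns.tendsto_atTop
  have hm : ∀ k, AEMeasurable (fun ξ : ℝ => ENNReal.ofReal (|ξ| ^ (2 * μ)) *
      ‖(𝓕 (f (ns k)) : L2) ξ‖ₑ ^ 2) := fun k => by
    have := (aestronglyMeasurable_weight μ (f (ns k))).enorm.pow_const 2
    simpa only [enorm_weight] using this
  rw [← ENNReal.pow_le_pow_left_iff two_ne_zero, frSemi_sq]
  calc _ = ∫⁻ ξ, liminf (fun k => ENNReal.ofReal (|ξ| ^ (2 * μ)) *
        ‖(𝓕 (f (ns k)) : L2) ξ‖ₑ ^ 2) atTop := by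
        refine lintegral_congr_ae ?_
        filter_upwards [hae] with ξ hξ
        refine (Tendsto.liminf_eq ?_).symm
        refine ENNReal.Tendsto.const_mul ?_ (Or.inr ENNReal.ofReal_ne_top)
        exact ((ENNReal.continuous_pow 2).tendsto _).comp hξ.enorm
    _ ≤ liminf (fun k => ∫⁻ ξ, ENNReal.ofReal (|ξ| ^ (2 * μ)) *
        ‖(𝓕 (f (ns k)) : L2) ξ‖ₑ ^ 2) atTop := lintegral_liminf_le' hm
    _ ≤ liminf (fun k => B (ns k) ^ 2) atTop := by
        refine liminf_le_liminf (Eventually.of_forall fun k => ?_)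
        rw [← frSemi_sq]
        gcongr
        exact hB _
    _ = B' ^ 2 := (((ENNReal.continuous_pow 2).tendsto _).comp hBn).liminf_eq

/-- Bounded extension by zero and the Poincaré inequality on `H_0^μ`. -/
theorem sobolevZero_extension {a b μ : ℝ} (hab : a < b) (h0 : 0 < μ) (h1 : μ ≤ 1)
    (hμ : μ ≠ 1 / 2) : ∃ C : ℝ≥0, ∀ u ∈ sobolevZero a b μ,
      l2Norm a b u ≤ C * sobolevSeminorm a b μ u ∧
      ∃ v : L2, v =ᵐ[volume.restrict (Set.Ioo a b)] u ∧ eLpNorm v 2 volume = l2Norm a b u ∧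
        frSemi μ v ≤ C * sobolevSeminorm a b μ u := by
  obtain ⟨Z, hZ⟩ := zero_extension_bound hab h0 h1 hμ
  set C := (Z + 1) / semiConst μ
  have hC : ∀ (φ : ℝ → ℂ) (hφ : IsTest a b φ), eLpNorm φ 2 volume ≤ C * sobolevSeminorm a b μ φ ∧
      frSemi μ hφ.toL2 ≤ C * sobolevSeminorm a b μ φ := fun φ hφ =>
    ⟨le_sobolevSeminorm fun v hv => (hZ φ hφ v hv).1, le_sobolevSeminorm fun v hv => (hZ φ hφ v hv).2⟩
  refine ⟨C, fun u hu => ?_⟩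
  obtain ⟨φ, hφ, hn⟩ := exists_seq_of_mem_sobolevZero hu
  have hu2 := hu.1.1
  have hsemi : ∀ k, sobolevSeminorm a b μ (φ k) ≤ sobolevSeminorm a b μ u + (1 / 2) ^ k := by
    intro k
    have := sobolevSeminorm_le_add_sub (a := a) (b := b) (μ := μ) (u := φ k) (w := u)
    refine this.trans (add_le_add le_rfl (sobolevSeminorm_le_sobolevNorm.trans ?_))
    rw [sobolevNorm_sub_comm]; exact hn k
  have hlim : Tendsto (fun k : ℕ => (C : ℝ≥0∞) * (sobolevSeminorm a b μ u + (1 / 2) ^ k)) atTop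
      (𝓝 (C * sobolevSeminorm a b μ u)) := by
    refine ENNReal.Tendsto.const_mul ?_ (Or.inr ENNReal.coe_ne_top)
    simpa using tendsto_half_pow.const_add (sobolevSeminorm a b μ u)
  refine ⟨?_, ?_⟩
  · refine ge_of_tendsto' (b := l2Norm a b u) (f := fun k : ℕ => (C : ℝ≥0∞) *
      (sobolevSeminorm a b μ u + (1 / 2) ^ k) + (1 / 2) ^ k) (x := atTop) ?_ fun k => ?_
    · simpa using hlim.add tendsto_half_pow
    · refine (l2Norm_le_add_sub hu2.1 (hφ k).memLp.1.restrict).trans (add_le_add ?_ ?_)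
      · calc l2Norm a b (φ k) ≤ eLpNorm (φ k) 2 volume :=
              eLpNorm_mono_measure _ Measure.restrict_le_self
          _ ≤ _ := (hC _ (hφ k)).1.trans (by gcongr; exact hsemi k)
      · exact l2Norm_le_sobolevNorm.trans (hn k)
  · have hi : MemLp ((Set.Ioo a b).indicator u) 2 volume :=
      (memLp_indicator_iff_restrict measurableSet_Ioo).2 hu2
    refine ⟨hi.toLp _, ?_, ?_, ?_⟩
    · refine (hi.coeFn_toLp.filter_mono (ae_mono Measure.restrict_le_self)).trans ?_
      exact (ae_restrict_iff' measurableSet_Ioo).2 (Eventually.of_forall fun x hx =>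
        Set.indicator_of_mem hx u)
    · rw [eLpNorm_congr_ae hi.coeFn_toLp, eLpNorm_indicator_eq_eLpNorm_restrict measurableSet_Ioo,
        l2Norm]
    · refine frSemi_le_of_tendsto (f := fun k => (hφ k).toL2) ?_
        (fun k => (hC _ (hφ k)).2.trans (by gcongr; exact hsemi k)) hlim
      rw [tendsto_iff_edist_tendsto_0]
      refine tendsto_of_tendsto_of_tendsto_of_le_of_le tendsto_const_nhds tendsto_half_pow
        (fun _ => zero_le) fun k => ?_
      simp only [IsTest.toL2]
      rw [Lp.edist_toLp_toLp]
      refine le_trans (le_of_eq ?_) (l2Norm_le_sobolevNorm.trans (hn k))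
      -- As `φ k` vanishes off `Ω`, the `L²(ℝ)` distance of the zero extensions is the `L²(Ω)`
      -- distance.
      have e : φ k - (Set.Ioo a b).indicator u = (Set.Ioo a b).indicator (φ k - u) := by
        ext x
        by_cases hx : x ∈ Set.Ioo a b
        · simp [hx]
        · simp [hx, (hφ k).eq_zero hx]
      rw [e, eLpNorm_indicator_eq_eLpNorm_restrict measurableSet_Ioo, l2Norm]

theorem sobolevZero_mono {a b μ ν : ℝ} (hab : a < b) (h0 : 0 < μ) (h1 : μ ≤ 1)
    (hμ : μ ≠ 1 / 2) (hν0 : 0 ≤ ν) (hν : ν ≤ μ) : ∃ C : ℝ≥0, ∀ u ∈ sobolevZero a b μ,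
      u ∈ sobolevZero a b ν ∧ sobolevNorm a b ν u ≤ C * sobolevNorm a b μ u := by
  obtain ⟨C, hC⟩ := sobolevZero_extension hab h0 h1 hμ
  have key : ∀ u ∈ sobolevZero a b μ, u ∈ sobolev a b ν ∧
      sobolevNorm a b ν u ≤ (1 + semiConst ν * (1 + C) : ℝ≥0) * sobolevNorm a b μ u := by
    intro u hu
    obtain ⟨h1, v, hv, hv2, hvs⟩ := hC u hu
    have hb : frSemi ν v ≤ (1 + C) * sobolevNorm a b μ u := by
      refine (frSemi_le_of_le hν0 hν v).trans ?_
      rw [hv2, add_mul, one_mul]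
      exact add_le_add l2Norm_le_sobolevNorm
        (hvs.trans (mul_le_mul' le_rfl sobolevSeminorm_le_sobolevNorm))
    have hfin : frSemi ν v < ⊤ := by
      obtain ⟨-, v', hv'⟩ := hu.1
      refine (frSemi_le_of_le hν0 hν v).trans_lt (ENNReal.add_lt_top.2 ⟨(Lp.memLp v).2, ?_⟩)
      refine hvs.trans_lt (ENNReal.mul_lt_top ENNReal.coe_lt_top ?_)
      exact lt_of_le_of_lt (iInf₂_le v' hv') hv'.1
    refine ⟨⟨hu.1.1, v, isSobolevExtension_iff.2 ⟨hfin, hv⟩⟩, ?_⟩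
    refine sobolevNorm_le.trans ?_
    push_cast
    rw [add_mul, one_mul, mul_assoc]
    refine add_le_add l2Norm_le_sobolevNorm ((sobolevSeminorm_le hv).trans ?_)
    gcongr
  refine ⟨_, fun u hu => ⟨⟨(key u hu).1, fun ε hε => ?_⟩, (key u hu).2⟩⟩
  set K : ℝ≥0 := 1 + semiConst ν * (1 + C)
  have hK : (K : ℝ≥0∞) ≠ 0 := ENNReal.coe_ne_zero.2 (by positivity)
  obtain ⟨φ, hφ, h⟩ := hu.2 (ε / K) (ENNReal.div_pos hε.ne' ENNReal.coe_ne_top)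
  -- The norm comparison is reused for `φ - u`, itself in `H_0^μ`, so one approximating test
  -- function serves both orders.
  refine ⟨φ, hφ, ((key _ (test_sub_mem_sobolevZero h0.le h1 hu hφ)).2).trans_lt ?_⟩
  rw [ENNReal.lt_div_iff_mul_lt (Or.inl hK) (Or.inl ENNReal.coe_ne_top)] at h
  rwa [mul_comm]

/-! ### Extension by continuity and its two-sided bounds. -/

section Extension

variable {a b μ : ℝ} {D : (ℝ → ℂ) → ℝ → ℂ}

theorem IsSobolevOp.upper_seminorm (hD : IsSobolevOp a b μ D) : ∃ C : ℝ≥0, ∀ φ, IsTest a b φ →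
    l2Norm a b (D φ) ≤ C * sobolevSeminorm a b μ φ := by
  obtain ⟨C, hC⟩ := hD.upper
  exact ⟨_, fun φ hφ => le_sobolevSeminorm (hC φ hφ)⟩

theorem IsSobolevOp.lower_seminorm (hD : IsSobolevOp a b μ D) : ∃ C : ℝ≥0, ∀ φ, IsTest a b φ →
    sobolevSeminorm a b μ φ ≤ C * l2Norm a b (D φ) := by
  obtain ⟨C, hC⟩ := hD.lower
  refine ⟨semiConst μ * C, fun φ hφ => ?_⟩
  obtain ⟨v, hv, h⟩ := hC φ hφ
  refine (sobolevSeminorm_le hv).trans ?_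
  rw [ENNReal.coe_mul, mul_assoc]
  gcongr

/-- Linearity and the upper bound make the images of a fast approximating sequence Cauchy in
`L²(Ω)`; comparing any other sequence with this one shows that the limit does not depend on the
choice. -/
theorem IsSobolevOp.exists_extension (hD : IsSobolevOp a b μ D) {u : ℝ → ℂ}
    (hu : u ∈ sobolevZero a b μ) : ∃ w, IsContinuousExtensionValue a b μ D u w := by
  obtain ⟨C, hC⟩ := hD.upper_seminorm
  obtain ⟨φ, hφ, hn⟩ := exists_seq_of_mem_sobolevZero hu
  have hdiff : ∀ ψ χ, IsTest a b ψ → IsTest a b χ → l2Norm a b (D ψ - D χ) ≤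
      C * (sobolevNorm a b μ (ψ - u) + sobolevNorm a b μ (χ - u)) := by
    intro ψ χ hψ hχ
    have e : l2Norm a b (D ψ - D χ) = l2Norm a b (D (ψ - χ)) :=
      l2Norm_congr fun x hx => (hD.sub ψ χ hψ hχ x hx).symm
    rw [e]
    refine (hC _ (hψ.sub hχ)).trans ?_
    gcongr
    have h := sobolevSeminorm_sub_le (a := a) (b := b) (μ := μ) (u := ψ - u) (w := χ - u)
    rw [sub_sub_sub_cancel_right] at h
    exact h.trans (add_le_add sobolevSeminorm_le_sobolevNorm sobolevSeminorm_le_sobolevNorm)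
  set g : ℕ → Lp ℂ 2 (volume.restrict (Set.Ioo a b)) := fun k => (hD.memLp _ (hφ k)).toLp _
  have hcau : CauchySeq g := by
    refine cauchySeq_of_edist_le_geometric_two (C * 4) (by finiteness) fun k => ?_
    simp only [g]
    rw [Lp.edist_toLp_toLp]
    refine (hdiff _ _ (hφ k) (hφ (k + 1))).trans ?_
    have h1 : ((1 / 2 : ℝ≥0∞)) ^ (k + 1) ≤ (1 / 2) ^ k :=
      pow_le_pow_of_le_one zero_le (by simp) (Nat.le_succ k)
    calc _ ≤ (C : ℝ≥0∞) * ((1 / 2) ^ k + (1 / 2) ^ k) := by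
          gcongr
          · exact hn k
          · exact (hn (k + 1)).trans h1
      _ = C * 2 * (1 / 2) ^ k := by ring
      _ ≤ C * 4 * (1 / 2) ^ k := by
        gcongr
        norm_num
      _ = _ := by simp only [div_eq_mul_inv, one_mul, ENNReal.inv_pow]
  obtain ⟨w, hw⟩ := cauchySeq_tendsto_of_complete hcau
  have hw' : Tendsto (fun k => l2Norm a b (D (φ k) - w)) atTop (𝓝 0) := by
    rw [tendsto_iff_edist_tendsto_0] at hw
    refine hw.congr fun k => ?_
    rw [Lp.edist_def, l2Norm]
    refine eLpNorm_congr_ae ?_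
    filter_upwards [(hD.memLp _ (hφ k)).coeFn_toLp] with x hx
    simp only [Pi.sub_apply, g, hx]
  refine ⟨w, hu, Lp.memLp w, fun ψ hψ => ⟨fun k => hD.memLp _ (hψ k), fun hlim => ?_⟩⟩
  have hb : Tendsto (fun k => (C : ℝ≥0∞) * (sobolevNorm a b μ (ψ k - u) + (1 / 2) ^ k) +
      l2Norm a b (D (φ k) - w)) atTop (𝓝 0) := by
    have h1 := ENNReal.Tendsto.const_mul (a := (C : ℝ≥0∞)) (hlim.add tendsto_half_pow)
      (Or.inr ENNReal.coe_ne_top)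
    simpa using h1.add hw'
  refine tendsto_of_tendsto_of_tendsto_of_le_of_le tendsto_const_nhds hb (fun _ => zero_le)
    fun k => ?_
  have h2 := eLpNorm_add_le (p := 2) ((hD.memLp _ (hψ k)).1.sub (hD.memLp _ (hφ k)).1)
    ((hD.memLp _ (hφ k)).1.sub (Lp.memLp w).1) (by norm_num)
  rw [sub_add_sub_cancel] at h2
  refine h2.trans (add_le_add ((hdiff _ _ (hψ k) (hφ k)).trans ?_) le_rfl)
  gcongr
  exact hn k

theorem IsSobolevOp.continuousExtension_spec (hD : IsSobolevOp a b μ D) {u : ℝ → ℂ}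
    (hu : u ∈ sobolevZero a b μ) :
    IsContinuousExtensionValue a b μ D u (continuousExtension a b μ D u) := by
  have h := hD.exists_extension hu
  rw [continuousExtension, dif_pos h]
  exact h.choose_spec

theorem IsSobolevOp.extension_bounds (hD : IsSobolevOp a b μ D) : ∃ C : ℝ≥0,
    ∀ u ∈ sobolevZero a b μ,
      l2Norm a b (continuousExtension a b μ D u) ≤ C * sobolevSeminorm a b μ u ∧
      sobolevSeminorm a b μ u ≤ C * l2Norm a b (continuousExtension a b μ D u) := by
  obtain ⟨C, hC⟩ := hD.upper_seminorm
  obtain ⟨E, hE⟩ := hD.lower_seminorm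
  refine ⟨max C E, fun u hu => ?_⟩
  obtain ⟨-, hw, hlim⟩ := hD.continuousExtension_spec hu
  set w := continuousExtension a b μ D u
  obtain ⟨φ, hφ, hn⟩ := exists_seq_of_mem_sobolevZero hu
  have hD' := (hlim φ hφ).2 (tendsto_of_tendsto_of_tendsto_of_le_of_le tendsto_const_nhds
    tendsto_half_pow (fun _ => zero_le) hn)
  have hmax1 : (C : ℝ≥0∞) ≤ (max C E : ℝ≥0) := by exact_mod_cast le_max_left C E
  have hmax2 : (E : ℝ≥0∞) ≤ (max C E : ℝ≥0) := by exact_mod_cast le_max_right C E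
  constructor
  · refine le_trans ?_ (mul_le_mul' hmax1 le_rfl)
    refine ge_of_tendsto' (b := l2Norm a b w) (f := fun k : ℕ => (C : ℝ≥0∞) *
      (sobolevSeminorm a b μ u + (1 / 2) ^ k) + l2Norm a b (D (φ k) - w)) (x := atTop) ?_ fun k => ?_
    · have h1 := ENNReal.Tendsto.const_mul (a := (C : ℝ≥0∞))
        (tendsto_half_pow.const_add (sobolevSeminorm a b μ u)) (Or.inr ENNReal.coe_ne_top)
      simpa using h1.add hD'
    · refine (l2Norm_le_add_sub hw.1 (hD.memLp _ (hφ k)).1).trans (add_le_add ?_ le_rfl)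
      refine (hC _ (hφ k)).trans ?_
      gcongr
      refine sobolevSeminorm_le_add_sub.trans (add_le_add le_rfl
        (sobolevSeminorm_le_sobolevNorm.trans ?_))
      rw [sobolevNorm_sub_comm]; exact hn k
  · refine le_trans ?_ (mul_le_mul' hmax2 le_rfl)
    refine ge_of_tendsto' (b := sobolevSeminorm a b μ u) (f := fun k : ℕ => (E : ℝ≥0∞) *
      (l2Norm a b w + l2Norm a b (D (φ k) - w)) + (1 / 2) ^ k) (x := atTop) ?_ fun k => ?_
    · have h1 := ENNReal.Tendsto.const_mul (a := (E : ℝ≥0∞))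
        (hD'.const_add (l2Norm a b w)) (Or.inr ENNReal.coe_ne_top)
      simpa using h1.add tendsto_half_pow
    · refine sobolevSeminorm_le_add_sub.trans (add_le_add ?_
        (sobolevSeminorm_le_sobolevNorm.trans (hn k)))
      refine (hE _ (hφ k)).trans ?_
      gcongr
      refine (l2Norm_le_add_sub (hD.memLp _ (hφ k)).1 hw.1).trans (add_le_add le_rfl (le_of_eq ?_))
      rw [l2Norm, l2Norm, ← eLpNorm_neg, neg_sub]

end Extension

/-! ### Density of test functions for orders up to `1/2`. -/

theorem lintegral_enorm_mul_le {f g : ℝ → ℂ} (hf : AEStronglyMeasurable f volume)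
    (hg : AEStronglyMeasurable g volume) :
    ∫⁻ x, ‖f x‖ₑ * ‖g x‖ₑ ≤ eLpNorm f 2 volume * eLpNorm g 2 volume := by
  have h := ENNReal.lintegral_mul_le_Lp_mul_Lq volume Real.HolderConjugate.two_two
    hf.enorm hg.enorm
  simp only [Pi.mul_apply] at h
  refine h.trans_eq ?_
  rw [eLpNorm_eq_lintegral_rpow_enorm_toReal (by norm_num) (by norm_num),
    eLpNorm_eq_lintegral_rpow_enorm_toReal (by norm_num) (by norm_num)]
  norm_num

/-- Expand the square under the weight `|ξ|`; in the terms containing `w`, Cauchy–Schwarz puts the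
whole weight on one factor and leaves `w` in `L²`. -/
theorem frSemi_half_add_sq_le (v w : L2) : frSemi (1 / 2) (v + w) ^ 2 ≤
    frSemi (1 / 2) v ^ 2 + (2 * frSemi 1 v + frSemi 1 w) * eLpNorm w 2 volume := by
  have hm : ∀ z : L2, AEMeasurable (fun ξ : ℝ => ENNReal.ofReal |ξ| * ‖(𝓕 z : L2) ξ‖ₑ ^ 2) :=
    fun z => by
      have := (Lp.aestronglyMeasurable (𝓕 z : L2)).enorm
      fun_prop
  have hm' : ∀ z : L2, AEMeasurable (fun ξ : ℝ => ENNReal.ofReal |ξ| * ‖(𝓕 z : L2) ξ‖ₑ *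
      ‖(𝓕 w : L2) ξ‖ₑ) := fun z => by
    have := (Lp.aestronglyMeasurable (𝓕 z : L2)).enorm
    have := (Lp.aestronglyMeasurable (𝓕 w : L2)).enorm
    fun_prop
  have hh : ∀ z : L2, ∫⁻ ξ : ℝ, ENNReal.ofReal |ξ| * ‖(𝓕 z : L2) ξ‖ₑ * ‖(𝓕 w : L2) ξ‖ₑ ≤
      frSemi 1 z * eLpNorm w 2 volume := fun z => by
    rw [← eLpNorm_fourier w]
    refine le_trans (le_of_eq ?_) (lintegral_enorm_mul_le (aestronglyMeasurable_weight 1 z)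
      (Lp.aestronglyMeasurable _))
    refine lintegral_congr fun ξ => ?_
    rw [enorm_mul, Real.rpow_one, ← ofReal_norm ((|ξ| : ℝ) : ℂ), Complex.norm_real,
      Real.norm_eq_abs, abs_abs]
  rw [frSemi_sq, frSemi_sq]
  norm_num only [mul_one_div_cancel, Real.rpow_one]
  calc _ ≤ ∫⁻ ξ : ℝ, (ENNReal.ofReal |ξ| * ‖(𝓕 v : L2) ξ‖ₑ ^ 2 +
        (2 * (ENNReal.ofReal |ξ| * ‖(𝓕 v : L2) ξ‖ₑ * ‖(𝓕 w : L2) ξ‖ₑ) +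
          ENNReal.ofReal |ξ| * ‖(𝓕 w : L2) ξ‖ₑ * ‖(𝓕 w : L2) ξ‖ₑ)) := by
        rw [FourierTransform.fourier_add]
        refine lintegral_mono_ae ?_
        filter_upwards [Lp.coeFn_add (𝓕 v : L2) (𝓕 w : L2)] with ξ hξ
        rw [hξ, Pi.add_apply]
        calc _ ≤ ENNReal.ofReal |ξ| * (‖(𝓕 v : L2) ξ‖ₑ + ‖(𝓕 w : L2) ξ‖ₑ) ^ 2 := by
              gcongr
              exact enorm_add_le _ _
          _ = _ := by ring
    _ = (∫⁻ ξ : ℝ, ENNReal.ofReal |ξ| * ‖(𝓕 v : L2) ξ‖ₑ ^ 2) +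
        (2 * (∫⁻ ξ : ℝ, ENNReal.ofReal |ξ| * ‖(𝓕 v : L2) ξ‖ₑ * ‖(𝓕 w : L2) ξ‖ₑ) +
          ∫⁻ ξ : ℝ, ENNReal.ofReal |ξ| * ‖(𝓕 w : L2) ξ‖ₑ * ‖(𝓕 w : L2) ξ‖ₑ) := by
        rw [lintegral_add_left' (hm v), lintegral_add_left' ((hm' v).const_mul 2),
          lintegral_const_mul'' _ (hm' v)]
    _ ≤ _ := by
        rw [add_mul, mul_assoc]
        gcongr
        · exact hh v
        · exact hh w

theorem frSemi_smul (μ : ℝ) (c : ℂ) (v : L2) : frSemi μ (c • v) = ‖c‖ₑ * frSemi μ v := by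
  have : (𝓕 (c • v) : L2) = c • 𝓕 v := (Lp.fourierTransformₗᵢ ℝ ℂ).map_smul c v
  rw [frSemi, this, frSemi, ← eLpNorm_const_smul]
  refine eLpNorm_congr_ae ?_
  filter_upwards [Lp.coeFn_smul c (𝓕 v : L2)] with ξ h
  rw [h]
  simp only [Pi.smul_apply, smul_eq_mul]
  ring

theorem frSemi_zero (μ : ℝ) : frSemi μ 0 = 0 := by
  have := frSemi_smul μ 0 0
  simpa using this

/-- Sums of almost orthogonal functions: the norm in `H^{1/2}` grows like the square root of the
number of summands. -/
theorem frSemi_half_sum_le {f : ℕ → L2} {K : ℝ≥0∞}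
    (h0 : ∀ j, ‖f j‖ₑ ≤ K * (1 / 2) ^ j) (h1 : ∀ j, frSemi 1 (f j) ≤ K * 2 ^ j) (N : ℕ) :
    frSemi 1 (∑ j ∈ Finset.range N, f j) ≤ K * 2 ^ N ∧
    frSemi (1 / 2) (∑ j ∈ Finset.range N, f j) ^ 2 ≤ 3 * K ^ 2 * N := by
  induction N with
  | zero => simp [frSemi_zero]
  | succ N ih =>
    obtain ⟨i1, i2⟩ := ih
    have hpp : (2 : ℝ≥0∞) ^ N * (1 / 2) ^ N = 1 := by
      rw [← mul_pow, one_div, ENNReal.mul_inv_cancel (by norm_num) (by norm_num), one_pow]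
    rw [Finset.sum_range_succ]
    refine ⟨?_, ?_⟩
    · refine (frSemi_add_le _ _ _).trans ?_
      rw [pow_succ, mul_two, mul_add]
      exact add_le_add i1 (h1 N)
    · refine (frSemi_half_add_sq_le _ _).trans ?_
      push_cast
      rw [mul_add, mul_one]
      refine add_le_add i2 ?_
      -- The `H^1` growth `2^N` of the partial sum cancels the `L²` decay `2^(-N)` of the new term,
      -- so each step adds only `3K²`.
      calc _ ≤ (2 * (K * 2 ^ N) + K * 2 ^ N) * (K * (1 / 2) ^ N) := by
            gcongr
            · exact h1 N
            · rw [← Lp.enorm_def]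
              exact h0 N
        _ = 3 * K ^ 2 * (2 ^ N * (1 / 2) ^ N) := by ring
        _ = _ := by rw [hpp, mul_one]

theorem enorm_sum_le_of_geometric {f : ℕ → L2} {K : ℝ≥0∞}
    (h0 : ∀ j, ‖f j‖ₑ ≤ K * (1 / 2) ^ j) (N : ℕ) : ‖∑ j ∈ Finset.range N, f j‖ₑ ≤ K * 2 := by
  refine (enorm_sum_le _ _).trans ((Finset.sum_le_sum fun j _ => h0 j).trans ?_)
  rw [← Finset.mul_sum]
  gcongr
  refine (ENNReal.sum_le_tsum _).trans_eq ?_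
  rw [ENNReal.tsum_geometric, one_div, ENNReal.one_sub_inv_two, inv_inv]

/-- Approximate `m · 𝓕 v` in `L²` by a smooth compactly supported `p`, where `m = (1 + ξ²)^(ν/2)`,
and invert the transform of `p / m`, a Schwartz function. The weight `m` is smooth, unlike `|ξ|^ν`,
and dominates both `1` and `|ξ|^ν`, so one approximation controls both errors. -/
theorem exists_smooth_approx {ν : ℝ} (h0 : 0 ≤ ν) (h1 : ν ≤ 1) {v : L2} (hv : frSemi ν v < ⊤)
    {ε : ℝ} (hε : 0 < ε) : ∃ (h : ℝ → ℂ) (w : L2), ContDiff ℝ ∞ h ∧ w =ᵐ[volume] h ∧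
      eLpNorm (w - v : L2) 2 volume ≤ ENNReal.ofReal ε ∧
      frSemi ν (w - v) ≤ ENNReal.ofReal ε := by
  set m : ℝ → ℝ := fun ξ => (1 + ξ ^ 2) ^ (ν / 2) with hm
  have hpos : ∀ ξ : ℝ, 0 < 1 + ξ ^ 2 := fun ξ => by positivity
  have hmpos : ∀ ξ, 0 < m ξ := fun ξ => Real.rpow_pos_of_pos (hpos ξ) _
  have hm1 : ∀ ξ, 1 ≤ m ξ := fun ξ => Real.one_le_rpow (by nlinarith [sq_nonneg ξ]) (by linarith)
  have hmν : ∀ ξ, |ξ| ^ ν ≤ m ξ := fun ξ => by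
    have : |ξ| ^ ν = (ξ ^ 2) ^ (ν / 2) := by
      rw [← sq_abs, ← Real.rpow_natCast, ← Real.rpow_mul (abs_nonneg _)]
      congr 1; push_cast; ring
    rw [this]
    exact Real.rpow_le_rpow (sq_nonneg _) (by linarith) (by linarith)
  have hmle : ∀ ξ, m ξ ≤ 1 + |ξ| ^ ν := fun ξ => by
    have e1 : m ξ ≤ (1 + |ξ|) ^ ν := by
      have : (1 + |ξ|) ^ ν = ((1 + |ξ|) ^ 2) ^ (ν / 2) := by
        rw [← Real.rpow_natCast, ← Real.rpow_mul (by positivity)]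
        congr 1; push_cast; ring
      rw [this]
      refine Real.rpow_le_rpow (hpos ξ).le ?_ (by linarith)
      nlinarith [abs_nonneg ξ, sq_abs ξ]
    refine e1.trans ?_
    have := Real.rpow_add_le_add_rpow zero_le_one (abs_nonneg ξ) h0 h1
    simpa using this
  have hms : ContDiff ℝ ∞ m := by
    refine ContDiff.rpow_const_of_ne (by fun_prop) fun ξ => (hpos ξ).ne'
  set F : L2 := 𝓕 v with hF
  have hg : MemLp (fun ξ => (m ξ : ℂ) * F ξ) 2 volume := by
    have e2 : MemLp (fun ξ : ℝ => ((|ξ| ^ ν : ℝ) : ℂ) * F ξ) 2 volume :=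
      ⟨aestronglyMeasurable_weight ν v, hv⟩
    refine ((Lp.memLp F).norm.add e2.norm).of_le ?_ (Eventually.of_forall fun ξ => ?_)
    · exact ((Complex.continuous_ofReal.comp hms.continuous).aestronglyMeasurable).mul
        (Lp.aestronglyMeasurable _)
    · rw [norm_mul, Pi.add_apply, norm_mul, Complex.norm_real, Complex.norm_real,
        Real.norm_of_nonneg (hmpos ξ).le, Real.norm_of_nonneg (by positivity : (0:ℝ) ≤ |ξ| ^ ν),
        Real.norm_of_nonneg (by positivity)]
      nlinarith [hmle ξ, norm_nonneg (F ξ)]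
  obtain ⟨p, hpc, hps, hp⟩ := hg.exist_eLpNorm_sub_le (by norm_num) one_le_two hε
  set ψ : ℝ → ℂ := fun ξ => ((m ξ)⁻¹ : ℝ) * p ξ with hψ
  have hψs : ContDiff ℝ ∞ ψ :=
    (Complex.ofRealCLM.contDiff.comp (hms.inv fun ξ => (hmpos ξ).ne')).mul hps
  have hψc : HasCompactSupport ψ := hpc.mul_left
  set S : SchwartzMap ℝ ℂ := hψc.toSchwartzMap hψs with hS
  have hSψ : ∀ ξ, S ξ = ψ ξ := fun ξ => rfl
  have hw : (𝓕 ((𝓕⁻ S : SchwartzMap ℝ ℂ).toLp 2 volume : L2) : L2) = (S.toLp 2 volume : L2) := by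
    rw [← SchwartzMap.toLp_fourierInv_eq]
    exact FourierTransform.fourier_fourierInv_eq _
  have hdiff : (𝓕 ((𝓕⁻ S : SchwartzMap ℝ ℂ).toLp 2 volume - v : L2) : L2) =ᵐ[volume]
      fun ξ => ((-(m ξ)⁻¹ : ℝ) : ℂ) * (((m ξ : ℂ) * F ξ) - p ξ) := by
    have : (𝓕 ((𝓕⁻ S : SchwartzMap ℝ ℂ).toLp 2 volume - v : L2) : L2) = (S.toLp 2 volume : L2) - F := by
      rw [← hw]
      exact (Lp.fourierTransformₗᵢ ℝ ℂ).map_sub _ v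
    rw [this]
    filter_upwards [Lp.coeFn_sub (S.toLp 2 volume : L2) F, S.coeFn_toLp 2 volume] with ξ e1 e2
    have : (m ξ : ℂ) ≠ 0 := by exact_mod_cast (hmpos ξ).ne'
    rw [e1, Pi.sub_apply, e2, hSψ, hψ]
    push_cast
    field_simp
    ring
  refine ⟨(𝓕⁻ S : SchwartzMap ℝ ℂ), (𝓕⁻ S : SchwartzMap ℝ ℂ).toLp 2 volume,
    (𝓕⁻ S : SchwartzMap ℝ ℂ).smooth _, SchwartzMap.coeFn_toLp _ 2 volume, ?_, ?_⟩
  · rw [← eLpNorm_fourier]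
    refine le_trans ?_ hp
    refine eLpNorm_mono_ae ?_
    filter_upwards [hdiff] with ξ hξ
    rw [hξ, norm_mul, Complex.norm_real, norm_neg, Real.norm_of_nonneg (by have := hmpos ξ; positivity)]
    exact mul_le_of_le_one_left (norm_nonneg _) (inv_le_one_of_one_le₀ (hm1 ξ))
  · refine le_trans ?_ hp
    refine eLpNorm_mono_ae ?_
    filter_upwards [hdiff] with ξ hξ
    rw [hξ, norm_mul, norm_mul, Complex.norm_real, Complex.norm_real, norm_neg,
      Real.norm_of_nonneg (by positivity : (0:ℝ) ≤ |ξ| ^ ν),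
      Real.norm_of_nonneg (by have := hmpos ξ; positivity), ← mul_assoc]
    refine mul_le_of_le_one_left (norm_nonneg _) ?_
    rw [← div_eq_mul_inv]
    exact div_le_one_of_le₀ (hmν ξ) (hmpos ξ).le

theorem eLpNorm_le_of_support_ball {g : ℝ → ℂ} {c s B : ℝ} (hs : 0 ≤ s) (hB : ∀ x, ‖g x‖ ≤ B)
    (h0 : ∀ x, s < |x - c| → g x = 0) :
    eLpNorm g 2 volume ≤ ENNReal.ofReal (B * Real.sqrt (2 * s)) := by
  have hB0 : 0 ≤ B := (norm_nonneg _).trans (hB 0)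
  have h1 : eLpNorm g 2 volume ≤
      eLpNorm ((Metric.closedBall c s).indicator fun _ => B) 2 volume := by
    refine eLpNorm_mono_real fun x => ?_
    by_cases hx : x ∈ Metric.closedBall c s
    · rw [Set.indicator_of_mem hx]; exact hB x
    · rw [Metric.mem_closedBall, Real.dist_eq, not_le] at hx
      rw [h0 x hx, norm_zero]
      exact Set.indicator_nonneg (fun _ _ => hB0) _
  refine h1.trans ?_
  rw [eLpNorm_indicator_const measurableSet_closedBall (by norm_num) (by norm_num),
    Real.volume_closedBall, ENNReal.ofReal_mul hB0, Real.sqrt_eq_rpow,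
    ← ENNReal.ofReal_rpow_of_nonneg (by positivity) (by norm_num),
    Real.enorm_of_nonneg hB0]
  norm_num

theorem isTest_of_eq_zero {g : ℝ → ℂ} (hg : ContDiff ℝ ∞ g) {c s r : ℝ} (hsr : s < r)
    (h0 : ∀ x, s < |x - c| → g x = 0) : IsTest (c - r) (c + r) g := by
  have hsub : tsupport g ⊆ Metric.closedBall c s :=
    closure_minimal (fun x hx => by
      rw [Metric.mem_closedBall, Real.dist_eq]
      by_contra! h
      exact hx (h0 x h)) Metric.isClosed_closedBall
  refine ⟨hg, (isCompact_closedBall c s).of_isClosed_subset (isClosed_tsupport g) hsub,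
    hsub.trans ?_⟩
  rw [← Real.ball_eq_Ioo]
  exact Metric.closedBall_subset_ball hsr

/-- A smooth function agrees near a point with smooth functions that are supported in a given
neighbourhood of the point and arbitrarily small in `H^{1/2}`. -/
theorem exists_small_germ {h : ℝ → ℂ} (hh : ContDiff ℝ ∞ h) (c : ℝ) {r : ℝ} (hr : 0 < r) {ε : ℝ≥0∞}
    (hε : 0 < ε) : ∃ (A : ℝ → ℂ) (hA : IsTest (c - r) (c + r) A), A =ᶠ[𝓝 c] h ∧
      ‖hA.toL2‖ₑ ≤ ε ∧ frSemi (1 / 2) hA.toL2 ≤ ε := by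
  let ρ : ContDiffBump (0 : ℝ) := ⟨r / 4, r / 2, by positivity, by linarith⟩
  have hρs : ContDiff ℝ ∞ ρ := ρ.contDiff
  have hρ0 : ∀ y, r / 2 < |y| → ρ y = 0 := fun y hy =>
    ρ.zero_of_le_dist (by rw [Real.dist_eq, sub_zero]; exact hy.le)
  have hρ1 : ∀ y, |y| ≤ r / 4 → ρ y = 1 := fun y hy =>
    ρ.one_of_mem_closedBall (by rw [Metric.mem_closedBall, Real.dist_eq, sub_zero]; exact hy)
  have hρb : ∀ y, |ρ y| ≤ 1 := fun y => by rw [abs_of_nonneg ρ.nonneg]; exact ρ.le_one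
  obtain ⟨R, hR⟩ := ρ.hasCompactSupport.deriv.exists_bound_of_continuous
    (hρs.continuous_deriv (by simp))
  have hR0 : 0 ≤ R := (norm_nonneg _).trans (hR 0)
  obtain ⟨H₁, hH₁⟩ := (isCompact_closedBall c r).exists_bound_of_continuousOn
    hh.continuous.continuousOn
  obtain ⟨H₂, hH₂⟩ := (isCompact_closedBall c r).exists_bound_of_continuousOn
    (hh.continuous_deriv (by simp)).continuousOn
  set H := max H₁ H₂ with hHd
  have hc : c ∈ Metric.closedBall c r := Metric.mem_closedBall_self hr.le
  have hH0 : 0 ≤ H := (norm_nonneg _).trans ((hH₁ c hc).trans (le_max_left _ _))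
  have hp : ∀ j : ℕ, (1 : ℝ) ≤ 4 ^ j := fun j => one_le_pow₀ (by norm_num)
  have hcut : ∀ (j : ℕ) (x : ℝ), r / 2 / 4 ^ j < |x - c| → r / 2 < |4 ^ j * (x - c)| := by
    intro j x hx
    have := hp j
    rw [abs_mul, abs_of_pos (by positivity), mul_comm]
    exact (div_lt_iff₀ (by positivity)).1 hx
  have hle : ∀ j : ℕ, r / 2 / 4 ^ j ≤ r / 2 := fun j =>
    div_le_self (by positivity) (hp j)
  -- Supports of width `4^(-j)` give `L²` norms of order `2^(-j)`; derivatives of size `4^j` on them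
  -- give `H^1` seminorms of order `2^j`, as `frSemi_half_sum_le` requires.
  let f : ℕ → ℝ → ℂ := fun j x => (ρ (4 ^ j * (x - c)) : ℂ) * h x
  have hfs : ∀ j, ContDiff ℝ ∞ (f j) := fun j =>
    (Complex.ofRealCLM.contDiff.comp (hρs.comp (by fun_prop))).mul hh
  have hf0 : ∀ j x, r / 2 / 4 ^ j < |x - c| → f j x = 0 := fun j x hx => by
    simp only [f, hρ0 _ (hcut j x hx), Complex.ofReal_zero, zero_mul]
  have hf : ∀ j, IsTest (c - r) (c + r) (f j) := fun j =>
    isTest_of_eq_zero (hfs j) (half_lt_self hr) fun x hx => hf0 j x ((hle j).trans_lt hx)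
  have hmem : ∀ x, |x - c| ≤ r / 2 → x ∈ Metric.closedBall c r := fun x hx => by
    rw [Metric.mem_closedBall, Real.dist_eq]; linarith
  have hfb : ∀ j x, ‖f j x‖ ≤ H := fun j x => by
    rcases le_or_gt |x - c| (r / 2) with hx | hx
    · simp only [f, norm_mul, Complex.norm_real, Real.norm_eq_abs]
      refine (mul_le_of_le_one_left (norm_nonneg _) (hρb _)).trans ?_
      exact (hH₁ x (hmem x hx)).trans (le_max_left _ _)
    · rw [hf0 j x ((hle j).trans_lt hx), norm_zero]; exact hH0
  have hder : ∀ j x, deriv (f j) x =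
      ((4 ^ j * deriv ρ (4 ^ j * (x - c)) : ℝ) : ℂ) * h x +
        (ρ (4 ^ j * (x - c)) : ℂ) * deriv h x := fun j x => by
    have d1 : HasDerivAt (fun x : ℝ => (4 : ℝ) ^ j * (x - c)) (4 ^ j) x := by
      simpa using ((hasDerivAt_id x).sub_const c).const_mul ((4 : ℝ) ^ j)
    have d2 := ((hρs.differentiable (by simp) _).hasDerivAt.comp x d1).ofReal_comp
    have d3 := (hh.differentiable (by simp) x).hasDerivAt
    have := (d2.mul d3).deriv
    simp only [Function.comp_def] at this
    rw [mul_comm ((4 : ℝ) ^ j)]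
    exact this
  have hd0 : ∀ j x, r / 2 / 4 ^ j < |x - c| → deriv (f j) x = 0 := fun j x hx => by
    have : f j =ᶠ[𝓝 x] fun _ => 0 := by
      have ho : IsOpen {y : ℝ | r / 2 / 4 ^ j < |y - c|} := isOpen_lt (by fun_prop) (by fun_prop)
      filter_upwards [ho.mem_nhds hx] with y hy using hf0 j y hy
    rw [this.deriv_eq, deriv_const]
  have hdb : ∀ j x, ‖deriv (f j) x‖ ≤ 4 ^ j * (R * H + H) := fun j x => by
    rcases le_or_gt |x - c| (r / 2) with hx | hx
    · have b1 : ‖h x‖ ≤ H := (hH₁ x (hmem x hx)).trans (le_max_left _ _)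
      have b2 : ‖deriv h x‖ ≤ H := (hH₂ x (hmem x hx)).trans (le_max_right _ _)
      rw [hder]
      refine (norm_add_le _ _).trans ?_
      rw [norm_mul, norm_mul, Complex.norm_real, Complex.norm_real, norm_mul,
        Real.norm_of_nonneg (by positivity : (0:ℝ) ≤ 4 ^ j), Real.norm_eq_abs (ρ _)]
      calc _ ≤ 4 ^ j * R * H + 1 * H := by
            gcongr
            · exact hR _
            · exact hρb _
        _ ≤ 4 ^ j * R * H + 4 ^ j * H := by gcongr; exact hp j
        _ = _ := by ring
    · rw [hd0 j x ((hle j).trans_lt hx), norm_zero]; positivity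
  have hsq : ∀ j : ℕ, Real.sqrt (2 * (r / 2 / 4 ^ j)) = Real.sqrt r * (1 / 2) ^ j := fun j => by
    have h4 : ((1 / 2 : ℝ) ^ j) ^ 2 * 4 ^ j = 1 := by
      rw [← pow_mul, mul_comm j, pow_mul, ← mul_pow]; norm_num
    have e : 2 * (r / 2 / 4 ^ j) = r * ((1 / 2) ^ j) ^ 2 := by
      rw [div_div, mul_div_assoc', div_eq_iff (by positivity)]
      linear_combination (-2 * r) * h4
    rw [e, Real.sqrt_mul hr.le, Real.sqrt_sq (by positivity)]
  set K : ℝ := (R * H + H) * Real.sqrt r with hK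
  have hK0 : 0 ≤ K := by positivity
  have hn0 : ∀ j, ‖(hf j).toL2‖ₑ ≤ ENNReal.ofReal K * (1 / 2) ^ j := fun j => by
    rw [Lp.enorm_def, eLpNorm_congr_ae (hf j).coe_toL2]
    refine (eLpNorm_le_of_support_ball (by positivity) (hfb j) (hf0 j)).trans ?_
    rw [hsq, ← mul_assoc, ENNReal.ofReal_mul (by positivity), ENNReal.ofReal_pow (by norm_num)]
    gcongr
    · nlinarith [mul_nonneg hR0 hH0]
    · rw [ENNReal.ofReal_div_of_pos (by norm_num)]; norm_num
  have hn1 : ∀ j, frSemi 1 (hf j).toL2 ≤ ENNReal.ofReal K * 2 ^ j := fun j => by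
    refine (hf j).frSemi_one_le_deriv.trans ?_
    refine (eLpNorm_le_of_support_ball (by positivity) (hdb j) (hd0 j)).trans_eq ?_
    rw [hsq, show 4 ^ j * (R * H + H) * (Real.sqrt r * (1 / 2) ^ j) = K * 2 ^ j by
      rw [hK, show (4 : ℝ) ^ j = 2 ^ j * 2 ^ j by rw [← mul_pow]; norm_num, one_div, inv_pow]
      field_simp, ENNReal.ofReal_mul hK0, ENNReal.ofReal_pow (by norm_num)]
    norm_num
  have hlim : ∀ X : ℝ≥0∞, X ≠ ⊤ → Tendsto (fun N : ℕ => (N : ℝ≥0∞)⁻¹ * X) atTop (𝓝 0) :=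
    fun X hX => by
      simpa using ENNReal.Tendsto.mul_const ENNReal.tendsto_inv_nat_nhds_zero (Or.inr hX)
  obtain ⟨N, hN1, hN2, hN0⟩ := (((hlim (ENNReal.ofReal K * 2) (by finiteness)).eventually_lt_const
    hε).and (((hlim (3 * ENNReal.ofReal K ^ 2) (by finiteness)).eventually_lt_const
    (ENNReal.pow_pos hε 2)).and (eventually_gt_atTop 0))).exists
  have hNC : (N : ℂ) ≠ 0 := by exact_mod_cast hN0.ne'
  -- Near `c` all `N` cutoffs equal `1`, so the average is `h`; its squared `H^{1/2}` seminorm is at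
  -- most `N^(-2) · 3K²N`.
  let A : ℝ → ℂ := fun x => (N : ℂ)⁻¹ * ∑ j ∈ Finset.range N, f j x
  have hA : IsTest (c - r) (c + r) A := by
    refine isTest_of_eq_zero (contDiff_const.mul (ContDiff.sum fun j _ => hfs j))
      (half_lt_self hr) fun x hx => ?_
    change (N : ℂ)⁻¹ * _ = 0
    rw [Finset.sum_eq_zero fun j _ => hf0 j x ((hle j).trans_lt hx), mul_zero]
  have hAL : hA.toL2 = (N : ℂ)⁻¹ • ∑ j ∈ Finset.range N, (hf j).toL2 := by
    refine Lp.ext ?_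
    have hall : ∀ᵐ x, ∀ j ∈ Finset.range N, (hf j).toL2 x = f j x :=
      (Finset.eventually_all _).2 fun j _ => (hf j).coe_toL2
    filter_upwards [hA.coe_toL2, Lp.coeFn_smul (N : ℂ)⁻¹ (∑ j ∈ Finset.range N, (hf j).toL2),
      Lp.coeFn_finsetSum (Finset.range N) fun j => (hf j).toL2, hall] with x e1 e2 e3 e4
    rw [e1, e2, Pi.smul_apply, e3, Finset.sum_apply, Finset.sum_congr rfl e4, smul_eq_mul]
  have hNe : ‖((N : ℂ)⁻¹)‖ₑ = (N : ℝ≥0∞)⁻¹ := by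
    rw [enorm_inv hNC, ← ofReal_norm, Complex.norm_natCast, ENNReal.ofReal_natCast]
  refine ⟨A, hA, ?_, ?_, ?_⟩
  · have : ∀ᶠ x in 𝓝 c, ∀ j ∈ Finset.range N, |4 ^ j * (x - c)| ≤ r / 4 := by
      rw [Filter.eventually_all_finset]
      intro j _
      have : Tendsto (fun x : ℝ => |4 ^ j * (x - c)|) (𝓝 c) (𝓝 0) := by
        have : Continuous fun x : ℝ => |4 ^ j * (x - c)| := by fun_prop
        simpa using this.tendsto c
      exact this.eventually_le_const (by positivity)
    filter_upwards [this] with x hx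
    simp only [A, f]
    rw [Finset.sum_congr rfl fun j hj => by rw [hρ1 _ (hx j hj), Complex.ofReal_one, one_mul]]
    simp [hNC]
  · rw [hAL, enorm_smul, hNe]
    refine le_trans ?_ hN1.le
    gcongr
    exact enorm_sum_le_of_geometric hn0 N
  · rw [hAL, frSemi_smul, hNe, ← ENNReal.pow_le_pow_left_iff two_ne_zero, mul_pow]
    refine le_trans ?_ hN2.le
    calc _ ≤ (N : ℝ≥0∞)⁻¹ ^ 2 * (3 * ENNReal.ofReal K ^ 2 * N) := by
          gcongr
          exact (frSemi_half_sum_le hn0 hn1 N).2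
      _ = (N : ℝ≥0∞)⁻¹ * (3 * ENNReal.ofReal K ^ 2) * ((N : ℝ≥0∞)⁻¹ * N) := by ring
      _ = _ := by
          rw [ENNReal.inv_mul_cancel (by exact_mod_cast hN0.ne') (by simp), mul_one]

theorem isTest_indicator {a b : ℝ} {g : ℝ → ℂ} (hg : ContDiff ℝ ∞ g) (ha : g =ᶠ[𝓝 a] 0)
    (hb : g =ᶠ[𝓝 b] 0) : IsTest a b ((Set.Ioo a b).indicator g) := by
  have hz : ∀ x ∉ Set.Ioo a b, (Set.Ioo a b).indicator g =ᶠ[𝓝 x] 0 := by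
    intro x hx
    have hg0 : g =ᶠ[𝓝 x] 0 → (Set.Ioo a b).indicator g =ᶠ[𝓝 x] 0 := fun h => by
      filter_upwards [h] with y hy
      by_cases hy' : y ∈ Set.Ioo a b <;> simp [hy', hy]
    rcases eq_or_ne x a with rfl | hxa
    · exact hg0 ha
    rcases eq_or_ne x b with rfl | hxb
    · exact hg0 hb
    have : x ∉ Set.Icc a b := fun h => hx ⟨lt_of_le_of_ne h.1 hxa.symm, lt_of_le_of_ne h.2 hxb⟩
    filter_upwards [isClosed_Icc.isOpen_compl.mem_nhds this] with y hy
    exact Set.indicator_of_notMem (fun h => hy (Set.Ioo_subset_Icc_self h)) _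
  have hsub : tsupport ((Set.Ioo a b).indicator g) ⊆ Set.Ioo a b := fun x hx => by
    by_contra h
    exact (notMem_tsupport_iff_eventuallyEq.2 (hz x h)) hx
  refine ⟨contDiff_iff_contDiffAt.2 fun x => ?_, ?_, hsub⟩
  · by_cases hx : x ∈ Set.Ioo a b
    · refine hg.contDiffAt.congr_of_eventuallyEq ?_
      filter_upwards [isOpen_Ioo.mem_nhds hx] with y hy using Set.indicator_of_mem hy g
    · exact (contDiffAt_const (c := (0 : ℂ))).congr_of_eventuallyEq (hz x hx)
  · exact isCompact_Icc.of_isClosed_subset (isClosed_tsupport _)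
      (hsub.trans Set.Ioo_subset_Icc_self)

theorem IsTest.eventually_zero {a b : ℝ} {φ : ℝ → ℂ} (h : IsTest a b φ) {x : ℝ}
    (hx : x ∉ Set.Ioo a b) : φ =ᶠ[𝓝 x] 0 :=
  notMem_tsupport_iff_eventuallyEq.1 fun hx' => hx (h.2.2 hx')

/-- `C_0^∞(Ω)` is dense in `H^ν(Ω)` for `ν ≤ 1/2`. -/
theorem sobolev_eq_sobolevZero {a b ν : ℝ} (hab : a < b) (h0 : 0 ≤ ν) (h1 : ν ≤ 1 / 2) :
    sobolev a b ν = sobolevZero a b ν := by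
  refine Set.Subset.antisymm (fun u hu => ⟨hu, fun ε hε => ?_⟩) fun u hu => hu.1
  obtain ⟨-, v, hv⟩ := hu
  obtain ⟨hv, hvu⟩ := isSobolevExtension_iff.1 hv
  -- The error is `w - v` minus the two germs: `3η` in `L²`; in the seminorm `η` for `w - v` and
  -- `2η` for each germ, since `|ξ|^ν ≤ 1 + |ξ|^(1/2)`.
  obtain ⟨η, hη, hηε⟩ := ENNReal.exists_nnreal_pos_mul_lt
    (a := 3 + (semiConst ν : ℝ≥0∞) * 5) (by finiteness) hε.ne'
  obtain ⟨h, w, hh, hwh, hw0, hw1⟩ := exists_smooth_approx h0 (by linarith) hv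
    (ε := η) (by exact_mod_cast hη)
  rw [ENNReal.ofReal_coe_nnreal] at hw0 hw1
  have hη' : (0 : ℝ≥0∞) < η := by exact_mod_cast hη
  obtain ⟨A, hA, hAe, hA0, hA1⟩ := exists_small_germ hh a (sub_pos.2 hab) hη'
  obtain ⟨B, hB, hBe, hB0, hB1⟩ := exists_small_germ hh b (sub_pos.2 hab) hη'
  have hφ : IsTest a b ((Set.Ioo a b).indicator (h - A - B)) := by
    refine isTest_indicator ((hh.sub hA.1).sub hB.1) ?_ ?_
    -- The germ at `b` has radius `b - a`, so its support stays away from `a`, and conversely.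
    · filter_upwards [hAe, hB.eventually_zero (x := a) (by simp)] with x e1 e2
      simp [e1, e2]
    · filter_upwards [hBe, hA.eventually_zero (x := b) (by simp)] with x e1 e2
      simp [e1, e2]
  refine ⟨_, hφ, ?_⟩
  set z : L2 := w - v - hA.toL2 - hB.toL2 with hz
  have hzu : z =ᵐ[volume.restrict (Set.Ioo a b)] (Set.Ioo a b).indicator (h - A - B) - u := by
    have hr : ae (volume.restrict (Set.Ioo a b)) ≤ ae (volume : Measure ℝ) :=
      ae_mono Measure.restrict_le_self
    filter_upwards [(Lp.coeFn_sub (w - v - hA.toL2) hB.toL2).filter_mono hr,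
      (Lp.coeFn_sub (w - v) hA.toL2).filter_mono hr, (Lp.coeFn_sub w v).filter_mono hr,
      hwh.filter_mono hr, hA.coe_toL2.filter_mono hr, hB.coe_toL2.filter_mono hr, hvu,
      ae_restrict_mem measurableSet_Ioo] with x e1 e2 e3 e4 e5 e6 e7 hx
    rw [e1, Pi.sub_apply, e2, Pi.sub_apply, e3, Pi.sub_apply, e4, e5, e6, e7, Pi.sub_apply,
      Set.indicator_of_mem hx, Pi.sub_apply, Pi.sub_apply]
    ring
  have hz0 : l2Norm a b ((Set.Ioo a b).indicator (h - A - B) - u) ≤ 3 * η := by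
    rw [l2Norm, ← eLpNorm_congr_ae hzu]
    refine (eLpNorm_mono_measure _ Measure.restrict_le_self).trans ?_
    rw [← Lp.enorm_def] at hw0 ⊢
    calc ‖z‖ₑ ≤ ‖w - v‖ₑ + ‖hA.toL2‖ₑ + ‖hB.toL2‖ₑ :=
          enorm_sub_le.trans (add_le_add enorm_sub_le le_rfl)
      _ ≤ η + η + η := by gcongr
      _ = _ := by ring
  have hhalf : ∀ y : L2, ‖y‖ₑ ≤ η → frSemi (1 / 2) y ≤ η → frSemi ν y ≤ η + η :=
    fun y hy hy' => (frSemi_le_of_le h0 h1 y).trans (add_le_add (by rwa [← Lp.enorm_def]) hy')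
  have hz1 : frSemi ν z ≤ 5 * η := by
    calc frSemi ν z ≤ frSemi ν (w - v) + frSemi ν hA.toL2 + frSemi ν hB.toL2 :=
          (frSemi_sub_le _ _ _).trans (add_le_add (frSemi_sub_le _ _ _) le_rfl)
      _ ≤ η + (η + η) + (η + η) := by
          gcongr
          · exact hhalf _ hA0 hA1
          · exact hhalf _ hB0 hB1
      _ = _ := by ring
  refine lt_of_le_of_lt ?_ hηε
  refine sobolevNorm_le.trans ?_
  calc _ ≤ 3 * (η : ℝ≥0∞) + semiConst ν * (5 * η) := by
        gcongr
        exact (sobolevSeminorm_le hzu).trans (by gcongr)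
    _ = _ := by ring

/-! ### Calculus of `≲` and the main theorem. -/

theorem LeSim.trans {V : Type*} {S : Set V} {A B C : V → ℝ≥0∞} (h : LeSim S A B)
    (h' : LeSim S B C) : LeSim S A C := by
  obtain ⟨K, hK⟩ := h
  obtain ⟨L, hL⟩ := h'
  refine ⟨K * L, fun u hu => (hK u hu).trans ?_⟩
  rw [ENNReal.coe_mul, mul_assoc]
  gcongr
  exact hL u hu

theorem LeSim.sq {V : Type*} {S : Set V} {A B : V → ℝ≥0∞} (h : LeSim S A B) :
    LeSim S (fun u => A u ^ 2) fun u => B u ^ 2 := by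
  obtain ⟨K, hK⟩ := h
  refine ⟨K ^ 2, fun u hu => ?_⟩
  rw [ENNReal.coe_pow, ← mul_pow]
  exact pow_le_pow_left' (hK u hu) 2

theorem LeSim.mono {V : Type*} {S T : Set V} {A B : V → ℝ≥0∞} (h : LeSim T A B) (hST : S ⊆ T) :
    LeSim S A B :=
  h.imp fun _ hC u hu => hC u (hST hu)

theorem leSim_sobolevSeminorm_sobolevNorm {a b μ : ℝ} (S : Set (ℝ → ℂ)) :
    LeSim S (sobolevSeminorm a b μ) (sobolevNorm a b μ) :=
  ⟨1, fun u _ => by simpa using sobolevSeminorm_le_sobolevNorm⟩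

theorem leSim_sobolevNorm_sobolevSeminorm {a b μ : ℝ} (hab : a < b) (h0 : 0 < μ) (h1 : μ ≤ 1)
    (hμ : μ ≠ 1 / 2) :
    LeSim (sobolevZero a b μ) (sobolevNorm a b μ) (sobolevSeminorm a b μ) := by
  obtain ⟨C, hC⟩ := sobolevZero_extension hab h0 h1 hμ
  refine ⟨C + 1, fun u hu => sobolevNorm_le.trans ?_⟩
  rw [ENNReal.coe_add, ENNReal.coe_one, add_mul, one_mul]
  exact add_le_add (hC u hu).1 le_rfl

theorem IsSobolevOp.leSim {a b μ : ℝ} {D : (ℝ → ℂ) → ℝ → ℂ} (hD : IsSobolevOp a b μ D) :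
    LeSim (sobolevZero a b μ) (fun u => l2Norm a b (continuousExtension a b μ D u))
      (sobolevSeminorm a b μ) ∧
    LeSim (sobolevZero a b μ) (sobolevSeminorm a b μ)
      (fun u => l2Norm a b (continuousExtension a b μ D u)) := by
  obtain ⟨C, hC⟩ := hD.extension_bounds
  exact ⟨⟨C, fun u hu => (hC u hu).1⟩, ⟨C, fun u hu => (hC u hu).2⟩⟩

end

theorem mainTheorem5 (a b lam μ : ℝ) (hab : a < b) (hlam : 0 ≤ lam)
    (hμ0 : 0 < μ) (hμ1 : μ ≤ 1) (hμ : μ ≠ 1 / 2) :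
    (∀ X : Set (ℝ → ℂ), (X = sobolevZero a b μ ∨ (μ < 1 / 2 ∧ X = sobolev a b μ)) →
      -- the extended operators are defined on `X`
      (∀ u ∈ X,
        IsContinuousExtensionValue a b μ (leftTemperedRL a lam μ) u (leftTempered a b lam μ u) ∧
        IsContinuousExtensionValue a b μ (rightTemperedRL b lam μ) u
          (rightTempered a b lam μ u)) ∧
      Sim X (fun u => sobolevSeminorm a b μ u ^ 2) (fun u => sobolevNorm a b μ u ^ 2) ∧
      Sim X (fun u => sobolevNorm a b μ u ^ 2)
        (fun u => l2Norm a b (leftTempered a b lam μ u) ^ 2) ∧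
      Sim X (fun u => l2Norm a b (leftTempered a b lam μ u) ^ 2)
        (fun u => l2Norm a b (rightTempered a b lam μ u) ^ 2) ∧
      (∀ μ₁ : ℝ, 0 < μ₁ → μ₁ < μ → μ₁ ≠ 1 / 2 →
        (∀ u ∈ X,
          IsContinuousExtensionValue a b μ₁ (leftTemperedRL a lam μ₁) u
            (leftTempered a b lam μ₁ u) ∧
          IsContinuousExtensionValue a b μ₁ (rightTemperedRL b lam μ₁) u
            (rightTempered a b lam μ₁ u)) ∧
        LeSim X (fun u => l2Norm a b (leftTempered a b lam μ₁ u) ^ 2)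
          (fun u => l2Norm a b (leftTempered a b lam μ u) ^ 2) ∧
        LeSim X (fun u => l2Norm a b (rightTempered a b lam μ₁ u) ^ 2)
          (fun u => l2Norm a b (rightTempered a b lam μ u) ^ 2))) ∧
    (∀ ν : ℝ, 0 ≤ ν → ν ≤ 1 / 2 → sobolev a b ν = sobolevZero a b ν) := by
  have main : ∀ ν : ℝ, 0 ≤ ν → ν ≤ 1 / 2 → sobolev a b ν = sobolevZero a b ν :=
    fun ν h0 h1 => sobolev_eq_sobolevZero hab h0 h1
  refine ⟨fun X hX => ?_, main⟩
  -- For `μ < 1/2` the two admissible choices of `X` coincide by density.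
  obtain rfl : X = sobolevZero a b μ := by
    rcases hX with h | ⟨hμ2, h⟩
    · exact h
    · rw [h, main μ hμ0.le hμ2.le]
  have hL := isSobolevOp_left hab hμ0 hμ1 hμ hlam
  have hR := isSobolevOp_right hab hμ0 hμ1 hμ hlam
  have hsn := leSim_sobolevSeminorm_sobolevNorm (a := a) (b := b) (μ := μ) (sobolevZero a b μ)
  have hns := leSim_sobolevNorm_sobolevSeminorm hab hμ0 hμ1 hμ
  obtain ⟨hLs, hsL⟩ := hL.leSim
  obtain ⟨hRs, hsR⟩ := hR.leSim
  refine ⟨fun u hu => ⟨hL.continuousExtension_spec hu, hR.continuousExtension_spec hu⟩,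
    ⟨hsn.sq, hns.sq⟩, ⟨(hns.trans hsL).sq, (hLs.trans hsn).sq⟩,
    ⟨(hLs.trans hsR).sq, (hRs.trans hsL).sq⟩, fun μ₁ h0 hlt hμ₁ => ?_⟩
  have hL₁ := isSobolevOp_left hab h0 (hlt.le.trans hμ1) hμ₁ hlam
  have hR₁ := isSobolevOp_right hab h0 (hlt.le.trans hμ1) hμ₁ hlam
  obtain ⟨C, hC⟩ := sobolevZero_mono hab hμ0 hμ1 hμ h0.le hlt.le
  have hsub : sobolevZero a b μ ⊆ sobolevZero a b μ₁ := fun u hu => (hC u hu).1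
  have hnn : LeSim (sobolevZero a b μ) (sobolevNorm a b μ₁) (sobolevNorm a b μ) :=
    ⟨C, fun u hu => (hC u hu).2⟩
  -- The comparison of orders passes through the seminorms: order `μ₁` seminorm, order `μ₁` norm,
  -- order `μ` norm, order `μ` seminorm.
  have hss := ((leSim_sobolevSeminorm_sobolevNorm _).trans hnn).trans hns
  exact ⟨fun u hu => ⟨hL₁.continuousExtension_spec (hsub hu),
      hR₁.continuousExtension_spec (hsub hu)⟩,
    (((hL₁.leSim.1.mono hsub).trans hss).trans hsL).sq,
    (((hR₁.leSim.1.mono hsub).trans hss).trans hsR).sq⟩
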